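/- **Corollary (any multiplicative quiver variety is a fission variety).** *Conventions.* Varieties are reduced complex affine varieties. For $G=\prod_{i\in I}GL_{n_i}(\mathbb C)$, with the trace form on $\mathrm{Lie}(G)$, let $\theta=g^{-1}dg$ and $\bar\theta=(dg)g^{-1}$; for $\mathrm{Lie}(G)$-valued one-forms $\alpha,\beta$ the two-form $(\alpha,\beta)$ is obtained by wedging the form parts and pairing the Lie algebra parts. Let $v_X$ be minus the tangent to the flow of $X\in \mathrm{Lie}(G)$. A *quasi-Hamiltonian datum* for $G$ is an affine variety $M$ with an algebraic $G$-action, an equivariant regular map $\mu:M\to G$ and an invariant algebraic two-form $\omega$. It is a *quasi-Hamiltonian $G$-space* if $M$ is smooth, $d\omega=\tfrac16\mu^*(\theta^3)$, $\omega(v_X,\cdot)=\tfrac12\mu^*(\theta+\bar\theta,X)$ for all $X\in\mathrm{Lie}(G)$, and $\ker\omega_m\cap\ker d\mu_m=0$ for all $m\in M$. *Fusing* two equal factors of the group replaces their action by the diagonal action, their moment maps $\mu_1,\mu_2$ by $\mu_1\mu_2$ and $\omega$ by $\omega-\tfrac12(\mu_1^*\theta,\mu_2^*\bar\theta)$. *Reduction*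 by a product $K$ of some of the factors replaces $M$ by $\mu_K^{-1}(1)/K$ (when this is a smooth affine variety whose points are the $K$-orbits and whose functions are the $K$-invariant functions) with the induced action, moment map and two-form (when $\omega|_{\mu_K^{-1}(1)}$ descends). Let $\mathcal F$ be the smallest class of such data (up to isomorphism and relabelling of the factors of the group) that is closed under products, fusion and reduction and contains * the closed conjugacy classes $\mathcal C\subset GL_m(\mathbb C)$, with $\mu$ the inclusion and $\omega_g(v_X,v_Y)=\frac12\bigl((X,gYg^{-1})-(Y,gXg^{-1})\bigr)$; * the higher fission spaces $\mathcal A^r(V_1,\dots,V_k)=G\times(U_+\times U_-)^r\times H$ for $r,k\ge1$, where $G=GL(V_1\oplus\dots\oplus V_k)$, $H=\prod_i GL(V_i)$ and $U_\pm$ are the block upper/lower unitriangular subgroups, with action $(g,k)(C,\mathbf S,h)=(kCg^{-1},k\mathbf Sk^{-1},khk^{-1})$ of $G\times H$, moment map $(C^{-1}hS_{2r}\cdots S_1C,\ h^{-1})$, and two-form given by $2\omega=(\bar\gamma_0,\mathrm{Ad}_b\bar\gamma_0)+(\bar\gamma_0,\bar\beta)+(\bar\gamma_{2r},\eta)-\sum_{i=1}^{2r}(\gamma_i,\gamma_{i-1})$,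 where $C_i=S_i\cdots S_1C$, $b=hS_{2r}\cdots S_1$, $\gamma_i=C_i^*\theta$, $\bar\gamma_i=C_i^*\bar\theta$, $\eta=h^*\theta$, $\bar\beta=b^*\bar\theta$. *Quivers.* Let $Q$ be a finite quiver with vertex set $I$ (loops and multiple arrows are allowed), $q\in(\mathbb C^*)^I$, $\alpha\in\mathbb N^I$, $G_\alpha=\prod_i GL_{\alpha_i}(\mathbb C)$, and fix a total order on the arrows of the double $\overline Q$ of $Q$. Put $\varepsilon(a)=1$ and $\varepsilon(a^*)=-1$ for $a\in Q$, and $(a^*)^*=a$. Let $\mathrm{Rep}(\Lambda^q,\alpha)$ be the affine variety of representations of $\overline Q$ of dimension vector $\alpha$ such that every $1+bb^*$ ($b\in\overline Q$) is invertible and the ordered product $\prod_{b\in\overline Q}(1+bb^*)^{\varepsilon(b)}$ equals $\sum_iq_ie_i$. The *multiplicative quiver variety* of Crawley-Boevey and Shaw is the affine quotient $\mathrm{Rep}(\Lambda^q,\alpha)/G_\alpha=\mathrm{Spec}\,\mathbb C[\mathrm{Rep}(\Lambda^q,\alpha)]^{G_\alpha}$. Let $\omega_{\mathrm{VdB}}$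 be the restriction to $\mathrm{Rep}(\Lambda^q,\alpha)$ of the two-form obtained from the product, over the arrows $a:t\to h$ of $Q$, of the Van den Bergh spaces $\mathcal B(V_t,V_h)$, fused at each vertex in the given order. Here the points of $\mathcal B(V,W)$ are the pairs $(x,y)\in\mathrm{Hom}(W,V)\oplus\mathrm{Hom}(V,W)$ with $1+xy$ invertible (in the present case $(x,y)=(a^*,a)$), its moment map is $((1+xy)^{-1},1+yx)$ and its two-form is $\frac12(\mathrm{Tr}_V(1+xy)^{-1}dx\wedge dy-\mathrm{Tr}_W(1+yx)^{-1}dy\wedge dx)$. *Statement.* Every multiplicative quiver variety is a fission variety: it is the reduction $M/\!\!/G$ of a quasi-Hamiltonian space $M\in\mathcal F$. More precisely, for all $Q$, $q$, $\alpha$ and every order on $\overline Q$ there is a quasi-Hamiltonian $G_\alpha$-space $M\in\mathcal F$ and a $G_\alpha$-equivariant isomorphism of varieties $\mathrm{Rep}(\Lambda^q,\alpha)\cong\mu_M^{-1}(1)$ under which $\omega_M$ restricts to $\omega_{\mathrm{VdB}}$. Under it the multiplicative quiver variety is identified with the affine quotient $M/\!\!/G_\alpha$ of $\mu_M^{-1}(1)$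 by $G_\alpha$. If moreover the multiplicative quiver variety is smooth, its points are exactly the $G_\alpha$-orbits, and $\omega_{\mathrm{VdB}}$ descends to a two-form on it, then, with this two-form, it is itself a member of $\mathcal F$ (for the trivial group). -/

import Mathlib

noncomputable section

namespace FissionVar

/-! ### Complex affine varieties, regular maps, tangent spaces -/

/-- A set of points together with its algebra of regular functions. -/
structure FunSpace where
  /-- the points -/
  Pt : Type
  /-- the regular functions -/
  reg : Subalgebra ℂ (Pt → ℂ)

namespace FunSpace

/-- Evaluation of regular functions at a point. -/
def evalAt (X : FunSpace) (x : X.Pt) : X.reg →ₐ[ℂ] ℂ :=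
  (Pi.evalAlgHom ℂ (fun _ : X.Pt => ℂ) x).comp X.reg.val

/-- `X` is a (reduced) complex affine variety: the algebra of regular functions is finitely
generated and the points are exactly its characters. -/
def IsAffine (X : FunSpace) : Prop :=
  X.reg.FG ∧ ∀ χ : X.reg →ₐ[ℂ] ℂ, ∃! x : X.Pt, χ = X.evalAt x

/-- The subset `Z` of `X`, with the restrictions of the regular functions on `X`. -/
def restrict (X : FunSpace) (Z : Set X.Pt) : FunSpace where
  Pt := Z
  reg :=
    { carrier := {F | ∃ f ∈ X.reg, ∀ z : Z, F z = f z}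
      mul_mem' := by
        rintro F G ⟨f, hf, hF⟩ ⟨g, hg, hG⟩
        exact ⟨f * g, X.reg.mul_mem hf hg, fun z => by simp [hF, hG]⟩
      add_mem' := by
        rintro F G ⟨f, hf, hF⟩ ⟨g, hg, hG⟩
        exact ⟨f + g, X.reg.add_mem hf hg, fun z => by simp [hF, hG]⟩
      algebraMap_mem' := fun c =>
        ⟨algebraMap ℂ (X.Pt → ℂ) c, X.reg.algebraMap_mem c, fun _ => rfl⟩ }

/-- A regular map. -/
structure Hom (X Y : FunSpace) where
  /-- the map on points -/
  toFun : X.Pt → Y.Pt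
  regular : ∀ f ∈ Y.reg, f ∘ toFun ∈ X.reg

instance (X Y : FunSpace) : CoeFun (Hom X Y) (fun _ => X.Pt → Y.Pt) := ⟨Hom.toFun⟩

/-- Pull back of regular functions. -/
def Hom.pull {X Y : FunSpace} (φ : Hom X Y) : Y.reg →ₐ[ℂ] X.reg where
  toFun f := ⟨f.1 ∘ φ.toFun, φ.regular f.1 f.2⟩
  map_one' := rfl
  map_mul' _ _ := rfl
  map_zero' := rfl
  map_add' _ _ := rfl
  commutes' _ := rfl

/-- `φ` is an isomorphism (bijective with regular inverse). -/
def Hom.IsIso {X Y : FunSpace} (φ : Hom X Y) : Prop :=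
  Function.Bijective φ ∧ ∀ F ∈ X.reg, ∃ f ∈ Y.reg, F = f ∘ φ

/-- The inclusion of a subset. -/
def incl (X : FunSpace) (Z : Set X.Pt) : Hom (X.restrict Z) X where
  toFun := fun z => z.1
  regular := fun f hf => ⟨f, hf, fun _ => rfl⟩

/-- The (Zariski) tangent space at `x`: the point derivations of the regular functions. -/
def Tangent (X : FunSpace) (x : X.Pt) : Submodule ℂ (X.reg →ₗ[ℂ] ℂ) where
  carrier := {v | ∀ f g : X.reg, v (f * g) = f.1 x * v g + g.1 x * v f}
  add_mem' := by
    intro v w hv hw f g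
    simp only [LinearMap.add_apply, hv f g, hw f g]
    ring
  zero_mem' := by intro f g; simp
  smul_mem' := by
    intro c v hv f g
    simp only [LinearMap.smul_apply, hv f g, smul_eq_mul]
    ring

/-- The derivative of a regular map. -/
def Hom.push {X Y : FunSpace} (φ : Hom X Y) {x : X.Pt} (v : X.Tangent x) : Y.Tangent (φ x) :=
  ⟨v.1.comp φ.pull.toLinearMap, fun f g => by
    simp only [LinearMap.comp_apply, AlgHom.toLinearMap_apply, map_mul]
    exact v.2 _ _⟩

/-- The value at `x` of a matrix of regular functions. -/
def val {X : FunSpace} {m n : Type} (x : X.Pt) (F : Matrix m n X.reg) : Matrix m n ℂ :=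
  F.map (X.evalAt x)

/-- The derivative, along a tangent vector, of a matrix of regular functions. -/
def der {X : FunSpace} {m n : Type} {x : X.Pt} (v : X.Tangent x) (F : Matrix m n X.reg) :
    Matrix m n ℂ :=
  F.map v.1

/-- Pull back `F^* θ`, evaluated on a tangent vector, of the form `θ = g⁻¹ dg`. -/
def mcL {X : FunSpace} {m : Type} [Fintype m] [DecidableEq m] {x : X.Pt}
    (F : Matrix m m X.reg) (v : X.Tangent x) : Matrix m m ℂ :=
  (val x F)⁻¹ * der v F

/-- Pull back `F^* θ̄`, evaluated on a tangent vector, of the form `θ̄ = (dg) g⁻¹`. -/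
def mcR {X : FunSpace} {m : Type} [Fintype m] [DecidableEq m] {x : X.Pt}
    (F : Matrix m m X.reg) (v : X.Tangent x) : Matrix m m ℂ :=
  der v F * (val x F)⁻¹

/-- A family of bilinear forms on the tangent spaces. -/
abbrev Form (X : FunSpace) : Type := ∀ x : X.Pt, X.Tangent x → X.Tangent x → ℂ

/-- `ω = ∑ k, a k * (d (b k) ∧ d (c k))`. -/
def Form.Presents {X : FunSpace} (ω : X.Form) {N : ℕ} (a b c : Fin N → X.reg) : Prop :=
  ∀ (x : X.Pt) (v w : X.Tangent x),
    ω x v w = ∑ k, (a k).1 x * (v.1 (b k) * w.1 (c k) - w.1 (b k) * v.1 (c k))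

/-- `ω` is a regular (algebraic) two-form. -/
def Form.IsRegular {X : FunSpace} (ω : X.Form) : Prop :=
  ∃ (N : ℕ) (a b c : Fin N → X.reg), ω.Presents a b c

/-- `dω = η`, for a regular two-form `ω`: the exterior derivative of
`∑ k, a k * (d (b k) ∧ d (c k))` is `∑ k, d (a k) ∧ d (b k) ∧ d (c k)`. -/
def Form.HasExtDeriv {X : FunSpace} (ω : X.Form)
    (η : ∀ x : X.Pt, X.Tangent x → X.Tangent x → X.Tangent x → ℂ) : Prop :=
  ∃ (N : ℕ) (a b c : Fin N → X.reg), ω.Presents a b c ∧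
    ∀ (x : X.Pt) (u v w : X.Tangent x),
      η x u v w = ∑ k, Matrix.det !![u.1 (a k), u.1 (b k), u.1 (c k);
                                     v.1 (a k), v.1 (b k), v.1 (c k);
                                     w.1 (a k), w.1 (b k), w.1 (c k)]

/-- `π : Z → Y` is the affine (geometric invariant theory) quotient of `Z` by a group whose orbit
relation is `r`: pulling back along `π` identifies the regular functions on the affine variety `Y` with
the invariant regular functions on `Z`. -/
def IsAffineQuotient {Z Y : FunSpace} (r : Z.Pt → Z.Pt → Prop) (π : Hom Z Y) : Prop :=
  Y.IsAffine ∧ (∀ z z', r z z' → π z = π z') ∧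
  ∀ F ∈ Z.reg, (∀ z z', r z z' → F z = F z') → ∃! f : Y.reg, F = f.1 ∘ π

/-- The set of entries of a matrix of regular functions. -/
def entries {X : FunSpace} {m n : Type} (F : Matrix m n X.reg) : Set X.reg :=
  {f | ∃ i j, f = F i j}

end FunSpace

open FunSpace

/-- `(α, β)(v, w)` for two matrix valued one-forms `α`, `β` (the bilinear form on matrices is the
trace form `(A, B) = Tr (A B)`). -/
def wedgeTr {T m : Type} [Fintype m] (α β : T → Matrix m m ℂ) (v w : T) : ℂ :=
  (α v * β w).trace - (α w * β v).trace

/-- Identification of square matrices of sizes known to be equal. -/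
def castMat {R : Type} {a b : ℕ} (h : a = b) (F : Matrix (Fin a) (Fin a) R) :
    Matrix (Fin b) (Fin b) R :=
  Matrix.reindex (finCongr h) (finCongr h) F

/-! ### Quasi-Hamiltonian spaces for products of general linear groups -/

/-- The group `∏ i, GL_{n i}(ℂ)`. -/
abbrev GLProd {I : Type} (n : I → ℕ) : Type := ∀ i, GL (Fin (n i)) ℂ

/-- The one-parameter element `exp X` of `∏ i, GL_{n i}(ℂ)`. -/
def expG {I : Type} {n : I → ℕ} (X : ∀ i, Matrix (Fin (n i)) (Fin (n i)) ℂ) : GLProd n :=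
  fun i => (Matrix.isUnit_exp (X i)).unit

/-- The regular functions on the product of `∏ i, GL_{n i}(ℂ)` with `X`. -/
def regGLProd {I : Type} (n : I → ℕ) (X : FunSpace) : Subalgebra ℂ (GLProd n × X.Pt → ℂ) :=
  Algebra.adjoin ℂ
    ({F | ∃ i a b, F = fun p => (p.1 i).val a b} ∪
     {F | ∃ i a b, F = fun p => ((p.1 i)⁻¹).val a b} ∪
     {F | ∃ f ∈ X.reg, F = fun p => f p.2})

/-- An affine variety with an algebraic action of `G = ∏ i, GL_{n i}(ℂ)`, a `G`-equivariant regular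
map `μ = (μ i)` to `G` and a `G`-invariant regular two-form. (The axioms (QH1)-(QH3) are
`IsQuasiHamiltonian` below.) A map to `GL_m` is given as an invertible matrix of regular
functions. -/
structure QHDatum (I : Type) (n : I → ℕ) where
  X : FunSpace
  affine : X.IsAffine
  act : GLProd n → Hom X X
  act_one : ∀ x, act 1 x = x
  act_mul : ∀ g g' x, act (g * g') x = act g (act g' x)
  act_regular : ∀ f ∈ X.reg, (fun p : GLProd n × X.Pt => f (act p.1 p.2)) ∈ regGLProd n X
  μ : ∀ i, Matrix (Fin (n i)) (Fin (n i)) X.reg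
  μ_unit : ∀ i, IsUnit (μ i)
  μ_act : ∀ g x i, val (act g x) (μ i) = (g i).val * val x (μ i) * ((g i)⁻¹).val
  ω : X.Form
  ω_regular : ω.IsRegular
  ω_act : ∀ g x (v w : X.Tangent x), ω (act g x) ((act g).push v) ((act g).push w) = ω x v w

namespace QHDatum

variable {I : Type} {n : I → ℕ}

/-- `v` is the value at `x` of the fundamental vector field of `A ∈ Lie G`, which is minus the
tangent to the flow. -/
def IsFundamental (M : QHDatum I n) (A : ∀ i, Matrix (Fin (n i)) (Fin (n i)) ℂ) {x : M.X.Pt}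
    (v : M.X.Tangent x) : Prop :=
  ∀ f : M.X.reg, HasDerivAt (fun t : ℂ => f.1 (M.act (expG (t • A)) x)) (-(v.1 f)) 0

/-- (QH1): `dω = μ^*(θ³)/6`, where `(θ³)/6` is the canonical three-form
`(u, v, w) ↦ (θ(u), [θ(v), θ(w)]) / 2`. -/
def QH1 [Fintype I] (M : QHDatum I n) : Prop :=
  M.ω.HasExtDeriv fun _ u v w =>
    (1 / 2 : ℂ) * ∑ i, (mcL (M.μ i) u *
      (mcL (M.μ i) v * mcL (M.μ i) w - mcL (M.μ i) w * mcL (M.μ i) v)).trace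

/-- (QH2): `ω(v_A, ·) = μ^*(θ + θ̄, A) / 2`. -/
def QH2 [Fintype I] (M : QHDatum I n) : Prop :=
  ∀ (x : M.X.Pt) (A : ∀ i, Matrix (Fin (n i)) (Fin (n i)) ℂ),
    ∃ v : M.X.Tangent x, M.IsFundamental A v ∧ ∀ w : M.X.Tangent x,
      M.ω x v w = (1 / 2 : ℂ) * ∑ i, ((mcL (M.μ i) w + mcR (M.μ i) w) * A i).trace

/-- (QH3): `ker ω ∩ ker dμ = 0` at each point. -/
def QH3 (M : QHDatum I n) : Prop :=
  ∀ (x : M.X.Pt) (v : M.X.Tangent x),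
    (∀ w, M.ω x v w = 0) → (∀ i, der v (M.μ i) = 0) → v = 0

/-- `M` is a smooth quasi-Hamiltonian space. -/
def IsQuasiHamiltonian [Fintype I] (M : QHDatum I n) : Prop :=
  Algebra.Smooth ℂ M.X.reg ∧ M.QH1 ∧ M.QH2 ∧ M.QH3

/-- The fibre of the moment map at the identity. -/
def level (M : QHDatum I n) : FunSpace :=
  M.X.restrict {x | ∀ i, val x (M.μ i) = 1}

/-- The orbit relation on the fibre of the moment map at the identity. -/
def levelOrbit (M : QHDatum I n) (z z' : M.level.Pt) : Prop :=
  ∃ g : GLProd n, z'.1 = M.act g z.1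

/-- `π` identifies `Y` with the reduced variety `M // G`: the affine quotient of `μ⁻¹(1)` by
`G`. -/
def IsReducedVariety (M : QHDatum I n) {Y : FunSpace} (π : Hom M.level Y) : Prop :=
  IsAffineQuotient M.levelOrbit π

/-! ### Operations -/

/-- `N` is `M` with the factors of the group relabelled along the bijection `e`. -/
def IsRelabelling {J : Type} {m : J → ℕ} (e : I ≃ J) (he : ∀ i, n i = m (e i))
    (M : QHDatum I n) (N : QHDatum J m) : Prop :=
  ∃ φ : Hom M.X N.X, φ.IsIso ∧
    (∀ (g : GLProd n) (g' : GLProd m), (∀ i, (g' (e i)).val = castMat (he i) (g i).val) →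
      ∀ x, φ (M.act g x) = N.act g' (φ x)) ∧
    (∀ x i, val (φ x) (N.μ (e i)) = castMat (he i) (val x (M.μ i))) ∧
    (∀ x (v w : M.X.Tangent x), N.ω (φ x) (φ.push v) (φ.push w) = M.ω x v w)

/-- `N` is the product of `M₁` and `M₂`. -/
def IsProduct {J : Type} {m : J → ℕ} (M₁ : QHDatum I n) (M₂ : QHDatum J m)
    (N : QHDatum (I ⊕ J) (Sum.elim n m)) : Prop :=
  ∃ (p₁ : Hom N.X M₁.X) (p₂ : Hom N.X M₂.X),
    Function.Bijective (fun x => (p₁ x, p₂ x)) ∧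
    p₁.pull.range ⊔ p₂.pull.range = ⊤ ∧
    (∀ g x, p₁ (N.act g x) = M₁.act (fun i => g (Sum.inl i)) (p₁ x)) ∧
    (∀ g x, p₂ (N.act g x) = M₂.act (fun j => g (Sum.inr j)) (p₂ x)) ∧
    (∀ x i, val x (N.μ (Sum.inl i)) = val (p₁ x) (M₁.μ i)) ∧
    (∀ x j, val x (N.μ (Sum.inr j)) = val (p₂ x) (M₂.μ j)) ∧
    (∀ x (v w : N.X.Tangent x),
      N.ω x v w = M₁.ω (p₁ x) (p₁.push v) (p₁.push w) + M₂.ω (p₂ x) (p₂.push v) (p₂.push w))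

/-- `N` is obtained from `M` by fusing the factors `i₁` and `i₂` (in this order) of the group into
one factor. The map `f` sends each factor of the old group to the corresponding factor of the new
group: `f i₁ = f i₂` and `f` is injective otherwise. The new group acts through the diagonal
embedding, the new moment map is `μ i₁ * μ i₂` on the fused factor, and the new two-form is
`ω - (μ_{i₁}^* θ, μ_{i₂}^* θ̄) / 2`. -/
def IsFusion {J : Type} {m : J → ℕ} (f : I → J) (hf : ∀ i, n i = m (f i)) (i₁ i₂ : I)
    (M : QHDatum I n) (N : QHDatum J m) : Prop :=
  i₁ ≠ i₂ ∧ ∃ h₂ : f i₂ = f i₁, Function.Surjective f ∧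
  (∀ i i', f i = f i' → i = i' ∨ (i = i₁ ∧ i' = i₂) ∨ (i = i₂ ∧ i' = i₁)) ∧
  ∃ φ : Hom M.X N.X, φ.IsIso ∧
    (∀ (g : GLProd n) (g' : GLProd m), (∀ i, (g' (f i)).val = castMat (hf i) (g i).val) →
      ∀ x, φ (M.act g x) = N.act g' (φ x)) ∧
    (∀ x i, i ≠ i₁ → i ≠ i₂ → val (φ x) (N.μ (f i)) = castMat (hf i) (val x (M.μ i))) ∧
    (∀ x, val (φ x) (N.μ (f i₁)) = castMat (hf i₁) (val x (M.μ i₁)) *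
      castMat ((hf i₂).trans (congrArg m h₂)) (val x (M.μ i₂))) ∧
    (∀ x (v w : M.X.Tangent x), N.ω (φ x) (φ.push v) (φ.push w) = M.ω x v w -
      (1 / 2 : ℂ) * wedgeTr (fun u => castMat (hf i₁) (mcL (M.μ i₁) u))
        (fun u => castMat ((hf i₂).trans (congrArg m h₂)) (mcR (M.μ i₂) u)) v w)

/-- `N` is the reduction (at the identity) of `M` by the factors of the group indexed by `K`:
`N = μ_K⁻¹(1) / G_K` is smooth and is both the affine quotient and the set of orbits, with the
induced action, moment map and two-form. -/
def IsReduction {K J : Type} {n : K ⊕ J → ℕ} (M : QHDatum (K ⊕ J) n)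
    (N : QHDatum J (fun j => n (Sum.inr j))) : Prop :=
  let Z : Set M.X.Pt := {x | ∀ k, val x (M.μ (Sum.inl k)) = 1}
  let r : (M.X.restrict Z).Pt → (M.X.restrict Z).Pt → Prop :=
    fun z z' => ∃ g : GLProd n, (∀ j, g (Sum.inr j) = 1) ∧ z'.1 = M.act g z.1
  Algebra.Smooth ℂ N.X.reg ∧ ∃ π : Hom (M.X.restrict Z) N.X,
    IsAffineQuotient r π ∧ Function.Surjective π ∧ (∀ z z', π z = π z' → r z z') ∧
    (∀ (g : GLProd n) (z z' : (M.X.restrict Z).Pt), z'.1 = M.act g z.1 →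
      π z' = N.act (fun j => g (Sum.inr j)) (π z)) ∧
    (∀ z j, val (π z) (N.μ j) = val z.1 (M.μ (Sum.inr j))) ∧
    (∀ (z : (M.X.restrict Z).Pt) (v w : (M.X.restrict Z).Tangent z),
      N.ω (π z) (π.push v) (π.push w) =
        M.ω z.1 ((M.X.incl Z).push v) ((M.X.incl Z).push w))

/-! ### Conjugacy classes -/

/-- `M` is the (closed) conjugacy class of `c` in `GL_m(ℂ)`: the moment map is a closed embedding
with image the class, and `ω_g(v_A, v_B) = ((A, g B g⁻¹) - (B, g A g⁻¹)) / 2`. -/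
def IsConjugacyClass {m : ℕ} (c : GL (Fin m) ℂ) (M : QHDatum Unit (fun _ => m)) : Prop :=
  Function.Injective (fun x => val x (M.μ ())) ∧
  (∀ g : Matrix (Fin m) (Fin m) ℂ, (∃ x, val x (M.μ ()) = g) ↔
    ∃ k : GL (Fin m) ℂ, g = k.val * c.val * (k⁻¹).val) ∧
  Algebra.adjoin ℂ (entries (M.μ ()) ∪ entries (M.μ ())⁻¹) = ⊤ ∧
  ∀ x (A B : Unit → Matrix (Fin m) (Fin m) ℂ) (v w : M.X.Tangent x),
    M.IsFundamental A v → M.IsFundamental B w →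
    M.ω x v w = (1 / 2 : ℂ) *
      ((A () * (val x (M.μ ()) * B () * (val x (M.μ ()))⁻¹)).trace -
       (B () * (val x (M.μ ()) * A () * (val x (M.μ ()))⁻¹)).trace)

end QHDatum

/-! ### Higher fission spaces of general linear groups -/

section Fission

variable {k : ℕ} (d : Fin k → ℕ)

/-- The block (summand of `⨁ i, ℂ^{d i}`) in which a basis vector lies. -/
def blk (a : Fin (∑ i, d i)) : Fin k := (finSigmaFinEquiv.symm a).1

/-- Block diagonal matrices. -/
def blockDiag {R : Type} [Zero R] (h : ∀ i, Matrix (Fin (d i)) (Fin (d i)) R) :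
    Matrix (Fin (∑ i, d i)) (Fin (∑ i, d i)) R :=
  Matrix.reindex finSigmaFinEquiv finSigmaFinEquiv (Matrix.blockDiagonal' h)

/-- Membership of `U₊`: block upper triangular with identity diagonal blocks. -/
def IsUpper (A : Matrix (Fin (∑ i, d i)) (Fin (∑ i, d i)) ℂ) : Prop :=
  ∀ a b, blk d b ≤ blk d a → A a b = (1 : Matrix (Fin (∑ i, d i)) (Fin (∑ i, d i)) ℂ) a b

/-- Membership of `U₋`: block lower triangular with identity diagonal blocks. -/
def IsLower (A : Matrix (Fin (∑ i, d i)) (Fin (∑ i, d i)) ℂ) : Prop :=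
  ∀ a b, blk d a ≤ blk d b → A a b = (1 : Matrix (Fin (∑ i, d i)) (Fin (∑ i, d i)) ℂ) a b

/-- `(C, S, h)` lies in `GL × (U₊ × U₋)^r × H`. Here `S j` is the Stokes factor usually written
`S_{j+1}`, so that `S 0, S 2, …` lie in `U₊` and `S 1, S 3, …` in `U₋`. -/
def IsFissionPoint (r : ℕ) (C : Matrix (Fin (∑ i, d i)) (Fin (∑ i, d i)) ℂ)
    (S : Fin (2 * r) → Matrix (Fin (∑ i, d i)) (Fin (∑ i, d i)) ℂ)
    (h : ∀ i, Matrix (Fin (d i)) (Fin (d i)) ℂ) : Prop :=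
  IsUnit C ∧ (∀ i, IsUnit (h i)) ∧
  (∀ j, Even j.val → IsUpper d (S j)) ∧ (∀ j, Odd j.val → IsLower d (S j))

/-- The product `S (i-1) * ⋯ * S 1 * S 0`. -/
def stokesProd {R : Type} [CommRing R] {m : ℕ} {N : Type} [Fintype N] [DecidableEq N]
    (S : Fin m → Matrix N N R) : ℕ → Matrix N N R
  | 0 => 1
  | i + 1 => (if hi : i < m then S ⟨i, hi⟩ else 1) * stokesProd S i

/-- The dimensions of the factors of `GL_{∑ d i} × ∏ i, GL_{d i}`. -/
def fissionDim : Option (Fin k) → ℕ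
  | none => ∑ i, d i
  | some i => d i

/-- `M` is the higher fission space `𝒜^r(V₁, …, V_k) = G × (U₊ × U₋)^r × H`, where `V_i = ℂ^{d i}`,
`G = GL(⨁ V_i)` and `H = ∏ GL(V_i)`, as a space with action of `G × H`. -/
def IsFissionSpace (r : ℕ) (M : QHDatum (Option (Fin k)) (fissionDim d)) : Prop :=
  ∃ (C : Matrix (Fin (∑ i, d i)) (Fin (∑ i, d i)) M.X.reg)
    (S : Fin (2 * r) → Matrix (Fin (∑ i, d i)) (Fin (∑ i, d i)) M.X.reg)
    (h : ∀ i, Matrix (Fin (d i)) (Fin (d i)) M.X.reg),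
    -- the coordinates `(C, S, h)` identify `M` with `G × (U₊ × U₋)^r × H`
    (∀ x, IsFissionPoint d r (val x C) (fun j => val x (S j)) (fun i => val x (h i))) ∧
    (∀ C₀ S₀ h₀, IsFissionPoint d r C₀ S₀ h₀ → ∃! x,
      val x C = C₀ ∧ (∀ j, val x (S j) = S₀ j) ∧ (∀ i, val x (h i) = h₀ i)) ∧
    Algebra.adjoin ℂ (entries C ∪ entries C⁻¹ ∪ (⋃ j, entries (S j)) ∪
      (⋃ i, entries (h i)) ∪ (⋃ i, entries (h i)⁻¹)) = ⊤ ∧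
    -- the action `(g, k)(C, S, h) = (k C g⁻¹, k S k⁻¹, k h k⁻¹)`
    (∀ (g : GL (Fin (∑ i, d i)) ℂ) (κ : ∀ i, GL (Fin (d i)) ℂ) (a : GLProd (fissionDim d)) x,
      a none = g → (∀ i, a (some i) = κ i) →
      val (M.act a x) C = blockDiag d (fun i => (κ i).val) * val x C * (g⁻¹).val ∧
      (∀ j, val (M.act a x) (S j) =
        blockDiag d (fun i => (κ i).val) * val x (S j) * blockDiag d (fun i => ((κ i)⁻¹).val)) ∧
      (∀ i, val (M.act a x) (h i) = (κ i).val * val x (h i) * ((κ i)⁻¹).val)) ∧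
    -- the moment map `(C⁻¹ h S_{2r} ⋯ S_1 C, h⁻¹)`
    (∀ x, val x (M.μ none) =
      (val x C)⁻¹ * val x (blockDiag d h * stokesProd S (2 * r)) * val x C) ∧
    (∀ x i, val x (M.μ (some i)) = (val x (h i))⁻¹) ∧
    -- the two-form, with `C_i = S_i ⋯ S_1 C` and `b = h S_{2r} ⋯ S_1`:
    -- `2ω = (γ̄, Ad_b γ̄) + (γ̄, β̄) + (γ̄_{2r}, η) - ∑ (γ_i, γ_{i-1})`
    (∀ x (v w : M.X.Tangent x),
      let Ci : ℕ → Matrix (Fin (∑ i, d i)) (Fin (∑ i, d i)) M.X.reg :=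
        fun i => stokesProd S i * C
      let b := blockDiag d h * stokesProd S (2 * r)
      2 * M.ω x v w =
        wedgeTr (fun u : M.X.Tangent x => mcR C u)
          (fun u => val x b * mcR C u * (val x b)⁻¹) v w +
        wedgeTr (fun u : M.X.Tangent x => mcR C u) (fun u => mcR b u) v w +
        wedgeTr (fun u : M.X.Tangent x => mcR (Ci (2 * r)) u)
          (fun u => mcL (blockDiag d h) u) v w -
        ∑ i ∈ Finset.range (2 * r),
          wedgeTr (fun u : M.X.Tangent x => mcL (Ci (i + 1)) u) (fun u => mcL (Ci i) u) v w)

end Fission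

/-- The class of spaces obtained by the operations of fusion (products and fusion of two factors of
the group) and reduction from higher fission spaces and conjugacy classes of general linear
groups. -/
inductive FissionBuilt : ∀ {I : Type} {n : I → ℕ}, QHDatum I n → Prop
  | conj {m : ℕ} (c : GL (Fin m) ℂ) (M : QHDatum Unit (fun _ => m)) :
      M.IsConjugacyClass c → FissionBuilt M
  | fission {k : ℕ} (d : Fin k → ℕ) (r : ℕ) (M : QHDatum (Option (Fin k)) (fissionDim d)) :
      1 ≤ k → 1 ≤ r → IsFissionSpace d r M → FissionBuilt M
  | relabel {I J : Type} {n : I → ℕ} {m : J → ℕ} (e : I ≃ J) (he : ∀ i, n i = m (e i))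
      (M : QHDatum I n) (N : QHDatum J m) :
      FissionBuilt M → M.IsRelabelling e he N → FissionBuilt N
  | prod {I J : Type} {n : I → ℕ} {m : J → ℕ} (M₁ : QHDatum I n) (M₂ : QHDatum J m)
      (N : QHDatum (I ⊕ J) (Sum.elim n m)) :
      FissionBuilt M₁ → FissionBuilt M₂ → M₁.IsProduct M₂ N → FissionBuilt N
  | fusion {I J : Type} {n : I → ℕ} {m : J → ℕ} (f : I → J) (hf : ∀ i, n i = m (f i)) (i₁ i₂ : I)
      (M : QHDatum I n) (N : QHDatum J m) :
      FissionBuilt M → M.IsFusion f hf i₁ i₂ N → FissionBuilt N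
  | reduction {K J : Type} {n : K ⊕ J → ℕ} (M : QHDatum (K ⊕ J) n)
      (N : QHDatum J (fun j => n (Sum.inr j))) :
      FissionBuilt M → M.IsReduction N → FissionBuilt N

/-- `Y` is a fission variety obtained by a final reduction: `Y = M // G` for a smooth
quasi-Hamiltonian `G`-space `M` obtained by the operations above. -/
def IsFissionVariety (Y : FunSpace) : Prop :=
  ∃ (I : Type) (_ : Fintype I) (n : I → ℕ) (M : QHDatum I n) (π : Hom M.level Y),
    FissionBuilt M ∧ M.IsQuasiHamiltonian ∧ M.IsReducedVariety π

/-! ### Multiplicative quiver varieties -/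

section Quiver

variable {V A : Type} (src tgt : A → V) (α : V → ℕ)

/-- Tail of an arrow of the double quiver (`inl a` is the arrow `a`, `inr a` is the opposite
arrow `a^*`). -/
def tailD : A ⊕ A → V
  | .inl a => src a
  | .inr a => tgt a

/-- Head of an arrow of the double quiver. -/
def headD : A ⊕ A → V
  | .inl a => tgt a
  | .inr a => src a

/-- Representations of the double quiver with dimension vector `α`, with entries in `R`. -/
abbrev RepD (R : Type) : Type :=
  ∀ b : A ⊕ A, Matrix (Fin (α (headD src tgt b))) (Fin (α (tailD src tgt b))) R

variable {src tgt α}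

/-- The matrix `x_a` of an arrow `a` of the quiver. -/
def arr {R : Type} (x : RepD src tgt α R) (a : A) :
    Matrix (Fin (α (tgt a))) (Fin (α (src a))) R := x (.inl a)

/-- The matrix `x_{a^*}` of the arrow opposite to an arrow `a` of the quiver. -/
def opp {R : Type} (x : RepD src tgt α R) (a : A) :
    Matrix (Fin (α (src a))) (Fin (α (tgt a))) R := x (.inr a)

/-- `1 + x_b x_{b^*}`, an endomorphism of the space at the head of `b`. -/
def onePlus {R : Type} [CommRing R] (x : RepD src tgt α R) :
    ∀ b : A ⊕ A, Matrix (Fin (α (headD src tgt b))) (Fin (α (headD src tgt b))) R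
  | .inl a => (1 + arr x a * opp x a : Matrix (Fin (α (tgt a))) (Fin (α (tgt a))) R)
  | .inr a => (1 + opp x a * arr x a : Matrix (Fin (α (src a))) (Fin (α (src a))) R)

/-- `(1 + x_b x_{b^*})^{ε(b)}`, where `ε` is `1` on the arrows of the quiver and `-1` on the
opposite arrows. -/
def factor {R : Type} [CommRing R] (x : RepD src tgt α R) :
    ∀ b : A ⊕ A, Matrix (Fin (α (headD src tgt b))) (Fin (α (headD src tgt b))) R
  | .inl a => onePlus x (.inl a)
  | .inr a => (onePlus x (.inr a))⁻¹

open Classical in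
/-- The list of the factors `(1 + x_b x_{b^*})^{ε(b)}` acting at the vertex `i`, in the order in
which the arrows `b` occur in the list `ord`. -/
def factorsAt {R : Type} [CommRing R] (ord : List (A ⊕ A)) (x : RepD src tgt α R) (i : V) :
    List (Matrix (Fin (α i)) (Fin (α i)) R) :=
  ord.flatMap fun b =>
    if hb : headD src tgt b = i then [castMat (congrArg α hb) (factor x b)] else []

variable (src tgt α)

/-- The points of `Rep(Λ^q, α)`: representations `x` of the double quiver such that all
`1 + x_b x_{b^*}` are invertible and the ordered product of the `(1 + x_b x_{b^*})^{ε(b)}`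
equals `∑ i, q_i e_i`. -/
def RepPt (ord : List (A ⊕ A)) (q : V → ℂˣ) : Type :=
  {x : RepD src tgt α ℂ // (∀ b, IsUnit (onePlus x b)) ∧
    ∀ i, (factorsAt ord x i).prod = (q i : ℂ) • (1 : Matrix (Fin (α i)) (Fin (α i)) ℂ)}

/-- The affine variety `Rep(Λ^q, α)` of representations of the multiplicative preprojective algebra
`Λ^q` with dimension vector `α`; the regular functions are generated by the matrix entries of the
elements `b` and `(1 + b b^*)⁻¹` of the algebra. -/
def repVar (ord : List (A ⊕ A)) (q : V → ℂˣ) : FunSpace where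
  Pt := RepPt src tgt α ord q
  reg := Algebra.adjoin ℂ
    ({F | ∃ b i j, F = fun x => x.1 b i j} ∪ {F | ∃ b i j, F = fun x => (onePlus x.1 b)⁻¹ i j})

/-- `x' = g · x` for the action of `∏ i, GL_{α i}(ℂ)` on `Rep(Λ^q, α)` by change of basis. -/
def repRel (ord : List (A ⊕ A)) (q : V → ℂˣ) (g : GLProd α) (x x' : RepPt src tgt α ord q) :
    Prop :=
  ∀ b, x'.1 b = (g (headD src tgt b)).val * x.1 b * ((g (tailD src tgt b))⁻¹).val

/-- `π : Rep(Λ^q, α) → Y` identifies `Y` with the multiplicative quiver variety, the affine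
quotient of `Rep(Λ^q, α)` by `∏ i, GL_{α i}(ℂ)`. -/
def IsMultiplicativeQuiverVariety (ord : List (A ⊕ A)) (q : V → ℂˣ) {Y : FunSpace}
    (π : Hom (repVar src tgt α ord q) Y) : Prop :=
  IsAffineQuotient (fun x x' => ∃ g, repRel src tgt α ord q g x x') π

/-- The tautological representation, with entries in the regular functions on `Rep(Λ^q, α)`. -/
def coord (ord : List (A ⊕ A)) (q : V → ℂˣ) : RepD src tgt α (repVar src tgt α ord q).reg :=
  fun b i j => ⟨fun x : RepPt src tgt α ord q => x.1 b i j,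
    Algebra.subset_adjoin (R := ℂ) (A := RepPt src tgt α ord q → ℂ)
      (Or.inl ⟨b, i, j, rfl⟩)⟩

/-- The sum of the fusion terms of an ordered list of maps to `GL_m`:
`∑_{k} (F_k^* θ, (F_{k+1} F_{k+2} ⋯)^* θ̄)`. -/
def fusionTerms {X : FunSpace} {m : Type} [Fintype m] [DecidableEq m] {x : X.Pt}
    (v w : X.Tangent x) : List (Matrix m m X.reg) → ℂ
  | [] => 0
  | F :: L => wedgeTr (fun u : X.Tangent x => mcL F u) (fun u => mcR L.prod u) v w +
      fusionTerms v w L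

/-- The two-form on `Rep(Λ^q, α)`: the restriction of the two-form of the fusion of the Van den
Bergh spaces `𝓑(V_{src a}, V_{tgt a}) ∋ (x_{a^*}, x_a)`, fused at each vertex in the given order.
The two-form on `𝓑(V, W) ∋ (a, b)` is
`(Tr_V (1 + a b)⁻¹ da ∧ db - Tr_W (1 + b a)⁻¹ db ∧ da) / 2`. -/
def repForm [Fintype V] [Fintype A] (ord : List (A ⊕ A)) (q : V → ℂˣ) :
    (repVar src tgt α ord q).Form :=
  fun x v w =>
    let X := coord src tgt α ord q
    (1 / 2 : ℂ) * ∑ a : A,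
      (((1 + opp x.1 a * arr x.1 a)⁻¹ *
          (der v (opp X a) * der w (arr X a) - der w (opp X a) * der v (arr X a))).trace -
       ((1 + arr x.1 a * opp x.1 a)⁻¹ *
          (der v (arr X a) * der w (opp X a) - der w (arr X a) * der v (opp X a))).trace) -
    (1 / 2 : ℂ) * ∑ i : V, fusionTerms v w (factorsAt ord X i)

end Quiver

end FissionVar

end

/-! The Van den Bergh space of one arrow is a reduction of a fission space with two blocks and four
Stokes factors. Everything else is product, fusion and a reading of the moment map equation.

One arrow. A point of `𝒜²` with two blocks is `(C, S₀, S₁, S₂, S₃, h)`, where the Stokes factors are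
alternately upper and lower unitriangular with off-diagonal blocks `a, x, y, s`. Reduction by the
big general linear group imposes `h S₃ S₂ S₁ S₀ = 1`. Block elimination solves this equation
(`blocks_level`): `1 + yx = h₀⁻¹` is invertible, `a` and `s` are determined by `x` and `y`, and `h₁
= 1 + xy`. The level set is thus parametrised by `C` and a pair `(x, y)` with `1 + xy` invertible.
The group acts simply transitively on the coordinate `C`, and the locus `C = 1` is a section, so the
quotient is the Van den Bergh space with moment map `(1 + yx, (1 + xy)⁻¹)` (`isReduction_vdb`).

Its two-form. On the level set the sum over the Stokes factors in the fission form telescopes to the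
fusion terms of `S₃, S₂, S₁, S₀, C`, and the terms that involve `C` cancel against the rest
(`fissionForm_of_level`). What remains is `-1/2` times the fusion terms of the four Stokes factors.
The factor `S₃` contributes nothing by triangularity, and the other three give the Van den Bergh
form by a computation with traces (`trace_identity`, `fusionTerms_eq_vdbForm`).

The axioms (QH1)-(QH3). Membership in `FissionBuilt` and the quasi-Hamiltonian axioms are
established separately: the axioms are checked directly for the Van den Bergh spaces and for
one-point classes, and then carried through products, fusion and relabelling. For (QH1), the fusion
term has as derivative the difference between the Cartan three-form of a product and those of its
factors (`hasExtDeriv_fusion`). Since the Van den Bergh form consists of fusion terms of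
unitriangular matrices, whose Cartan forms vanish, only the diagonal part of their product survives.
(QH2) and (QH3) are linear algebra with `1 + xy` and `1 + yx` (`trace_fundamental_vdb`,
`eq_zero_of_vdb`). Smoothness holds because every space in question is a principal open subset of an
affine space.

The quiver. Take the product of the Van den Bergh spaces of the arrows and, for each vertex `i`, the
conjugacy class of the scalar `q_i⁻¹`, which is a point with zero form. Fuse the factors of the
group, in the given order, in front of the factors of their vertices (`IsListFusion.cons`,
`exists_fusedQuiver`). The moment map at `i` becomes the ordered product of the `(1 + bb*)^{ε(b)}`
times `q_i⁻¹`, so its value is `1` exactly on `Rep(Λ^q, α)`. The scalar, being constant, adds no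
fusion term, so the two-form restricts to the required one.

Quotients. The isomorphism of `Rep(Λ^q, α)` with the level set matches orbits, so affine quotients
correspond. When the quotient is a smooth orbit space and the form descends, this is a reduction by
all the factors, which leaves the trivial group (`FissionBuilt.of_isReducedVariety`). -/

noncomputable section

namespace FissionVar

namespace FunSpace

/-! ### Values and derivatives of matrices of regular functions -/

section Calculus

variable {X Y : FunSpace} {l m n p : Type} {x : X.Pt} (v w : X.Tangent x)

theorem val_apply (x : X.Pt) (F : Matrix m n X.reg) (i : m) (j : n) :
    val x F i j = (F i j).1 x := rfl

theorem der_apply (F : Matrix m n X.reg) (i : m) (j : n) : der v F i j = v.1 (F i j) := rfl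

theorem tangent_mul (f g : X.reg) : v.1 (f * g) = f.1 x * v.1 g + g.1 x * v.1 f := v.2 f g

theorem tangent_one : v.1 1 = 0 := by
  have h := v.2 1 1
  have h1 : (1 : X.reg).1 x = 1 := rfl
  rw [h1, mul_one] at h
  linear_combination -h

theorem tangent_algebraMap (c : ℂ) : v.1 (algebraMap ℂ X.reg c) = 0 := by
  rw [Algebra.algebraMap_eq_smul_one, map_smul, tangent_one, smul_zero]

theorem val_mul [Fintype m] (x : X.Pt) (F : Matrix l m X.reg) (G : Matrix m n X.reg) :
    val x (F * G) = val x F * val x G := Matrix.map_mul (f := X.evalAt x)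

theorem val_add (x : X.Pt) (F G : Matrix m n X.reg) : val x (F + G) = val x F + val x G := by
  ext i j; rfl

theorem val_neg (x : X.Pt) (F : Matrix m n X.reg) : val x (-F) = -val x F := by
  ext i j; rfl

theorem val_zero (x : X.Pt) : val x (0 : Matrix m n X.reg) = 0 := by
  ext i j; rfl

theorem val_one [DecidableEq m] (x : X.Pt) : val x (1 : Matrix m m X.reg) = 1 :=
  Matrix.map_one _ (map_zero (X.evalAt x)) (map_one (X.evalAt x))

/-- Regular functions are functions on points. An equation that holds at every point therefore holds
over the ring, and can then be differentiated along any tangent vector. -/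
theorem ext_val {F G : Matrix m n X.reg} (h : ∀ x, val x F = val x G) : F = G := by
  ext i j x
  exact congrFun (congrFun (h x) i) j

theorem der_mul [Fintype m] (F : Matrix l m X.reg) (G : Matrix m n X.reg) :
    der v (F * G) = val x F * der v G + der v F * val x G := by
  ext i j
  simp only [der_apply, Matrix.mul_apply, map_sum, tangent_mul, Matrix.add_apply, val_apply,
    ← Finset.sum_add_distrib]
  exact Finset.sum_congr rfl fun k _ => by ring

theorem der_add (F G : Matrix m n X.reg) : der v (F + G) = der v F + der v G := by
  ext i j; simp [der_apply]

theorem der_neg (F : Matrix m n X.reg) : der v (-F) = -der v F := by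
  ext i j; simp [der_apply]

theorem der_zero : der v (0 : Matrix m n X.reg) = 0 := by
  ext i j; simp [der_apply]

theorem der_one [DecidableEq m] : der v (1 : Matrix m m X.reg) = 0 := by
  ext i j
  by_cases h : i = j
  · subst h; simpa [der_apply] using tangent_one v
  · simp [der_apply, Matrix.one_apply_ne h]

theorem val_map (φ : Hom X Y) (F : Matrix m n Y.reg) :
    val (φ x) F = val x (F.map φ.pull) := rfl

variable [Fintype m] [DecidableEq m]

theorem isUnit_val {F : Matrix m m X.reg} (h : IsUnit F) (x : X.Pt) : IsUnit (val x F) :=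
  h.map (X.evalAt x).mapMatrix

theorem val_inv {F : Matrix m m X.reg} (h : IsUnit F) (x : X.Pt) :
    val x F⁻¹ = (val x F)⁻¹ := by
  refine (Matrix.inv_eq_right_inv ?_).symm
  rw [← val_mul, Matrix.mul_nonsing_inv _ ((Matrix.isUnit_iff_isUnit_det _).1 h), val_one]

theorem map_inv_of_isUnit {R S : Type} [CommRing R] [CommRing S] (f : R →+* S)
    {F : Matrix m m R} (h : IsUnit F) : F⁻¹.map f = (F.map f)⁻¹ := by
  refine (Matrix.inv_eq_right_inv ?_).symm
  rw [← Matrix.map_mul, Matrix.mul_nonsing_inv _ ((Matrix.isUnit_iff_isUnit_det _).1 h),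
    Matrix.map_one _ (map_zero f) (map_one f)]

theorem isUnit_mul_inv {R : Type} [CommRing R] {F : Matrix m m R} (h : IsUnit F) :
    F * F⁻¹ = 1 := Matrix.mul_nonsing_inv _ ((Matrix.isUnit_iff_isUnit_det _).1 h)

theorem isUnit_inv_mul {R : Type} [CommRing R] {F : Matrix m m R} (h : IsUnit F) :
    F⁻¹ * F = 1 := Matrix.nonsing_inv_mul _ ((Matrix.isUnit_iff_isUnit_det _).1 h)

theorem isUnit_inv {R : Type} [CommRing R] {F : Matrix m m R} (h : IsUnit F) :
    IsUnit F⁻¹ :=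
  IsUnit.of_mul_eq_one F (isUnit_inv_mul h)

theorem inv_mul_rev {R : Type} [CommRing R] (F G : Matrix m m R) :
    (F * G)⁻¹ = G⁻¹ * F⁻¹ := Matrix.mul_inv_rev F G

theorem der_inv {F : Matrix m m X.reg} (h : IsUnit F) :
    der v F⁻¹ = -((val x F)⁻¹ * der v F * (val x F)⁻¹) := by
  have h1 : der v (F⁻¹ * F) = 0 := by rw [isUnit_inv_mul h, der_one]
  rw [der_mul, val_inv h] at h1
  have h2 := isUnit_mul_inv (isUnit_val h x)
  calc der v F⁻¹ = der v F⁻¹ * (val x F * (val x F)⁻¹) := by rw [h2, Matrix.mul_one]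
    _ = ((val x F)⁻¹ * der v F + der v F⁻¹ * val x F) * (val x F)⁻¹ -
        (val x F)⁻¹ * der v F * (val x F)⁻¹ := by noncomm_ring
    _ = _ := by rw [h1, Matrix.zero_mul, zero_sub]

theorem inv_inv_of_isUnit {R : Type} [CommRing R] {F : Matrix m m R} (h : IsUnit F) :
    F⁻¹⁻¹ = F := Matrix.nonsing_inv_nonsing_inv F ((Matrix.isUnit_iff_isUnit_det _).1 h)

theorem isUnit_of_val {F G : Matrix m m X.reg} (h : ∀ x, val x F * val x G = 1) : IsUnit F :=
  IsUnit.of_mul_eq_one G (ext_val fun x => by rw [val_mul, h, val_one])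

theorem mcR_eq {F : Matrix m m X.reg} (h : IsUnit F) :
    mcR F v = val x F * mcL F v * (val x F)⁻¹ := by
  have h2 := isUnit_mul_inv (isUnit_val h x)
  rw [mcR, mcL, ← Matrix.mul_assoc, h2, Matrix.one_mul]

theorem mcL_eq {F : Matrix m m X.reg} (h : IsUnit F) :
    mcL F v = (val x F)⁻¹ * mcR F v * val x F := by
  have h2 := isUnit_inv_mul (isUnit_val h x)
  rw [mcR, mcL, Matrix.mul_assoc, Matrix.mul_assoc, h2, Matrix.mul_one]

theorem der_eq_mul_mcL {F : Matrix m m X.reg} (h : IsUnit F) :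
    der v F = val x F * mcL F v := by
  rw [mcL, ← Matrix.mul_assoc, isUnit_mul_inv (isUnit_val h x), Matrix.one_mul]

theorem der_eq_mcR_mul {F : Matrix m m X.reg} (h : IsUnit F) :
    der v F = mcR F v * val x F := by
  rw [mcR, Matrix.mul_assoc, isUnit_inv_mul (isUnit_val h x), Matrix.mul_one]

/-- Both `mcL (F * G)` and `mcR (F * G)` are conjugates of the one element `F^*θ + G^*θ̄`. Keeping
this sum intact lets invariance of the trace remove the conjugations later. -/
theorem mcL_mul {F G : Matrix m m X.reg} (hF : IsUnit F) (hG : IsUnit G) :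
    mcL (F * G) v = (val x G)⁻¹ * (mcL F v + mcR G v) * val x G := by
  have h1 := isUnit_inv_mul (isUnit_val hF x)
  have h2 := isUnit_inv_mul (isUnit_val hG x)
  have h3 := der_eq_mcR_mul v hG
  rw [mcL, der_mul, val_mul, inv_mul_rev, Matrix.mul_add, Matrix.mul_assoc (val x G)⁻¹,
    ← Matrix.mul_assoc (val x F)⁻¹, h1, Matrix.one_mul, mcL, h3]
  noncomm_ring

theorem mcR_mul {F G : Matrix m m X.reg} (hF : IsUnit F) (hG : IsUnit G) :
    mcR (F * G) v = val x F * (mcL F v + mcR G v) * (val x F)⁻¹ := by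
  have h1 := isUnit_mul_inv (isUnit_val hF x)
  have h2 := isUnit_mul_inv (isUnit_val hG x)
  have h3 := der_eq_mul_mcL v hF
  rw [mcR, der_mul, val_mul, inv_mul_rev, Matrix.add_mul, ← Matrix.mul_assoc _ (val x G)⁻¹,
    ← Matrix.mul_assoc _ (val x G)⁻¹, Matrix.mul_assoc _ (val x G) (val x G)⁻¹, h2,
    Matrix.mul_one, mcR, h3]
  noncomm_ring

theorem mcR_one : mcR (1 : Matrix m m X.reg) v = 0 := by
  rw [mcR, der_one, Matrix.zero_mul]

theorem mcL_one : mcL (1 : Matrix m m X.reg) v = 0 := by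
  rw [mcL, der_one, Matrix.mul_zero]

theorem mcL_inv {F : Matrix m m X.reg} (h : IsUnit F) : mcL F⁻¹ v = -mcR F v := by
  have h1 := isUnit_mul_inv (isUnit_val h x)
  rw [mcL, der_inv v h, val_inv h, inv_inv_of_isUnit (isUnit_val h x), mcR,
    Matrix.mul_neg, ← Matrix.mul_assoc, ← Matrix.mul_assoc, h1, Matrix.one_mul]

end Calculus

end FunSpace

end FissionVar

end

noncomputable section

namespace FissionVar

open FunSpace

/-! ### Traces of products of matrices -/

section Trace

variable {m : Type} [Fintype m]

theorem trace_conj {P Q : Matrix m m ℂ} [DecidableEq m] (h : P * Q = 1) (A : Matrix m m ℂ) :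
    (Q * A * P).trace = A.trace := by
  rw [Matrix.trace_mul_cycle, h, Matrix.one_mul]

theorem conj_mul_conj {P Q : Matrix m m ℂ} [DecidableEq m] (h : P * Q = 1) (A B : Matrix m m ℂ) :
    Q * A * P * (Q * B * P) = Q * (A * B) * P := by
  calc Q * A * P * (Q * B * P) = Q * A * (P * Q) * B * P := by noncomm_ring
    _ = _ := by rw [h]; noncomm_ring

variable {T : Type}

theorem wedgeTr_swap (α β : T → Matrix m m ℂ) (v w : T) :
    wedgeTr β α v w = -wedgeTr α β v w := by
  rw [wedgeTr, wedgeTr, Matrix.trace_mul_comm (β v), Matrix.trace_mul_comm (β w)]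
  ring

theorem wedgeTr_self (α : T → Matrix m m ℂ) (v w : T) : wedgeTr α α v w = 0 := by
  rw [wedgeTr, Matrix.trace_mul_comm (α v), sub_self]

theorem wedgeTr_congr {S : Type} {α β : T → Matrix m m ℂ} {α' β' : S → Matrix m m ℂ} {v w : T}
    {v' w' : S} (h₁ : α v = α' v') (h₂ : α w = α' w') (h₃ : β v = β' v') (h₄ : β w = β' w') :
    wedgeTr α β v w = wedgeTr α' β' v' w' := by
  rw [wedgeTr, wedgeTr, h₁, h₂, h₃, h₄]

/-- Invariance of the trace form under conjugation. The hypotheses concern only the values at the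
two vectors in play, so the forms compared may live on different tangent spaces. -/
theorem wedgeTr_conj [DecidableEq m] {S : Type} {α β : T → Matrix m m ℂ} {α' β' : S → Matrix m m ℂ}
    {v w : T} {v' w' : S} {P Q : Matrix m m ℂ} (h : P * Q = 1)
    (h₁ : α v = Q * α' v' * P) (h₂ : α w = Q * α' w' * P)
    (h₃ : β v = Q * β' v' * P) (h₄ : β w = Q * β' w' * P) :
    wedgeTr α β v w = wedgeTr α' β' v' w' := by
  rw [wedgeTr, wedgeTr, h₁, h₂, h₃, h₄, conj_mul_conj h, conj_mul_conj h, trace_conj h,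
    trace_conj h]

theorem wedgeTr_add_left (α α' β : T → Matrix m m ℂ) (v w : T) :
    wedgeTr (fun u => α u + α' u) β v w = wedgeTr α β v w + wedgeTr α' β v w := by
  simp only [wedgeTr, Matrix.add_mul, Matrix.trace_add]; ring

theorem wedgeTr_add_right (α β β' : T → Matrix m m ℂ) (v w : T) :
    wedgeTr α (fun u => β u + β' u) v w = wedgeTr α β v w + wedgeTr α β' v w := by
  simp only [wedgeTr, Matrix.mul_add, Matrix.trace_add]; ring

theorem wedgeTr_neg_left (α β : T → Matrix m m ℂ) (v w : T) :
    wedgeTr (fun u => -α u) β v w = -wedgeTr α β v w := by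
  simp only [wedgeTr, Matrix.neg_mul, Matrix.trace_neg]; ring

end Trace

/-! ### Identification of matrices of equal sizes -/

section CastMat

variable {R : Type} {a b c : ℕ}

theorem castMat_rfl (F : Matrix (Fin a) (Fin a) R) : castMat rfl F = F := rfl

theorem castMat_trans (h : a = b) (h' : b = c) (F : Matrix (Fin a) (Fin a) R) :
    castMat h' (castMat h F) = castMat (h.trans h') F := by subst h h'; rfl

theorem castMat_map {S : Type} (h : a = b) (F : Matrix (Fin a) (Fin a) R) (f : R → S) :
    (castMat h F).map f = castMat h (F.map f) := rfl

/-- Members of a family at propositionally equal indices have different matrix types; this is the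
bridge between them when indices of group factors are identified. -/
theorem castMat_family {J : Type} {m : J → ℕ} (F : ∀ j, Matrix (Fin (m j)) (Fin (m j)) R)
    {j j' : J} (h : j = j') : castMat (congrArg m h) (F j) = F j' := by subst h; rfl

variable [CommRing R]

theorem castMat_mul (h : a = b) (F G : Matrix (Fin a) (Fin a) R) :
    castMat h (F * G) = castMat h F * castMat h G := by subst h; rfl

theorem castMat_trace (h : a = b) (F : Matrix (Fin a) (Fin a) R) :
    (castMat h F).trace = F.trace := by subst h; rfl

theorem castMat_isUnit (h : a = b) {F : Matrix (Fin a) (Fin a) R} (hF : IsUnit F) :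
    IsUnit (castMat h F) := by subst h; exact hF

end CastMat

namespace FunSpace

variable {X Y : FunSpace}

theorem mcL_castMat {a b : ℕ} (h : a = b) (F : Matrix (Fin a) (Fin a) X.reg) {x : X.Pt}
    (v : X.Tangent x) : mcL (castMat h F) v = castMat h (mcL F v) := by subst h; rfl

theorem mcR_castMat {a b : ℕ} (h : a = b) (F : Matrix (Fin a) (Fin a) X.reg) {x : X.Pt}
    (v : X.Tangent x) : mcR (castMat h F) v = castMat h (mcR F v) := by subst h; rfl

theorem val_castMat {a b : ℕ} (h : a = b) (F : Matrix (Fin a) (Fin a) X.reg) (x : X.Pt) :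
    val x (castMat h F) = castMat h (val x F) := rfl

theorem der_castMat {a b : ℕ} (h : a = b) (F : Matrix (Fin a) (Fin a) X.reg) {x : X.Pt}
    (v : X.Tangent x) : der v (castMat h F) = castMat h (der v F) := rfl

/-! ### Regular forms -/

/-- A regular one-form. -/
def IsRegularOne (α : ∀ x : X.Pt, X.Tangent x → ℂ) : Prop :=
  ∃ (N : ℕ) (a b : Fin N → X.reg), ∀ x v, α x v = ∑ k, (a k).1 x * v.1 (b k)

theorem IsRegularOne.of_fintype {ι : Type} [Fintype ι] {α : ∀ x : X.Pt, X.Tangent x → ℂ}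
    (a b : ι → X.reg) (h : ∀ x v, α x v = ∑ k, (a k).1 x * v.1 (b k)) : IsRegularOne α :=
  ⟨Fintype.card ι, a ∘ (Fintype.equivFin ι).symm, b ∘ (Fintype.equivFin ι).symm, fun x v => by
    rw [h, ← (Fintype.equivFin ι).symm.sum_comp]; rfl⟩

theorem Form.HasExtDeriv.of_fintype {ι : Type} [Fintype ι] {ω : X.Form}
    {η : ∀ x : X.Pt, X.Tangent x → X.Tangent x → X.Tangent x → ℂ}
    (a b c : ι → X.reg)
    (h : ∀ (x : X.Pt) (v w : X.Tangent x),
      ω x v w = ∑ k, (a k).1 x * (v.1 (b k) * w.1 (c k) - w.1 (b k) * v.1 (c k)))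
    (h' : ∀ (x : X.Pt) (u v w : X.Tangent x),
      η x u v w = ∑ k, Matrix.det !![u.1 (a k), u.1 (b k), u.1 (c k);
                                     v.1 (a k), v.1 (b k), v.1 (c k);
                                     w.1 (a k), w.1 (b k), w.1 (c k)]) : ω.HasExtDeriv η :=
  ⟨Fintype.card ι, a ∘ (Fintype.equivFin ι).symm, b ∘ (Fintype.equivFin ι).symm,
    c ∘ (Fintype.equivFin ι).symm,
    fun x v w => by rw [h, ← (Fintype.equivFin ι).symm.sum_comp]; rfl,
    fun x u v w => by rw [h', ← (Fintype.equivFin ι).symm.sum_comp]; rfl⟩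

/-- Every presentation supplies some exterior derivative, so the closure properties of regular forms
can be read off from those of `HasExtDeriv`. -/
theorem Form.IsRegular.exists_hasExtDeriv {ω : X.Form} (h : ω.IsRegular) :
    ∃ η, ω.HasExtDeriv η := by
  obtain ⟨N, a, b, c, h⟩ := h
  exact ⟨_, N, a, b, c, h, fun _ _ _ _ => rfl⟩

theorem Form.HasExtDeriv.isRegular {ω : X.Form} {η} (h : ω.HasExtDeriv η) : ω.IsRegular := by
  obtain ⟨N, a, b, c, h, -⟩ := h
  exact ⟨N, a, b, c, h⟩

theorem Form.HasExtDeriv.congr {ω ω' : X.Form} {η η'} (h : ω.HasExtDeriv η)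
    (h₁ : ∀ x v w, ω' x v w = ω x v w) (h₂ : ∀ x u v w, η' x u v w = η x u v w) :
    ω'.HasExtDeriv η' := by
  obtain ⟨N, a, b, c, h, h'⟩ := h
  exact ⟨N, a, b, c, fun x v w => by rw [h₁, h], fun x u v w => by rw [h₂, h']⟩

theorem Form.hasExtDeriv_zero :
    Form.HasExtDeriv (X := X) (fun _ _ _ => 0) (fun _ _ _ _ => 0) :=
  Form.HasExtDeriv.of_fintype (ι := Empty) (fun _ => 0) (fun _ => 0) (fun _ => 0)
    (fun _ _ _ => by simp) (fun _ _ _ _ => by simp)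

theorem Form.HasExtDeriv.add {ω ω' : X.Form} {η η'} (h : ω.HasExtDeriv η)
    (h' : ω'.HasExtDeriv η') :
    Form.HasExtDeriv (X := X) (fun x v w => ω x v w + ω' x v w)
      (fun x u v w => η x u v w + η' x u v w) := by
  obtain ⟨N, a, b, c, h₁, h₂⟩ := h
  obtain ⟨N', a', b', c', h₁', h₂'⟩ := h'
  refine Form.HasExtDeriv.of_fintype (ι := Fin N ⊕ Fin N') (Sum.elim a a') (Sum.elim b b')
    (Sum.elim c c') (fun x v w => ?_) (fun x u v w => ?_)
  · rw [h₁, h₁', Fintype.sum_sum_type]; rfl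
  · rw [h₂, h₂', Fintype.sum_sum_type]; rfl

theorem Form.HasExtDeriv.smul {ω : X.Form} {η} (r : ℂ) (h : ω.HasExtDeriv η) :
    Form.HasExtDeriv (X := X) (fun x v w => r * ω x v w) (fun x u v w => r * η x u v w) := by
  obtain ⟨N, a, b, c, h₁, h₂⟩ := h
  refine ⟨N, fun k => r • a k, b, c, fun x v w => ?_, fun x u v w => ?_⟩
  · change r * ω x v w = _
    rw [h₁, Finset.mul_sum]
    exact Finset.sum_congr rfl fun k _ => (mul_assoc _ _ _).symm
  · change r * η x u v w = _
    rw [h₂, Finset.mul_sum]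
    refine Finset.sum_congr rfl fun k _ => ?_
    simp only [Matrix.det_fin_three, Matrix.of_apply, Matrix.cons_val, map_smul, smul_eq_mul]
    ring

theorem Form.HasExtDeriv.sum {ι : Type} (s : Finset ι) {ω : ι → X.Form}
    {η : ι → ∀ x : X.Pt, X.Tangent x → X.Tangent x → X.Tangent x → ℂ}
    (h : ∀ i, (ω i).HasExtDeriv (η i)) :
    Form.HasExtDeriv (X := X) (fun x v w => ∑ i ∈ s, ω i x v w)
      (fun x u v w => ∑ i ∈ s, η i x u v w) := by
  classical
  induction s using Finset.induction_on with
  | empty => simpa using Form.hasExtDeriv_zero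
  | insert i s hi ih =>
    exact ((h i).add ih).congr (fun _ _ _ => Finset.sum_insert hi)
      (fun _ _ _ _ => Finset.sum_insert hi)

theorem Form.HasExtDeriv.pullback {ω : Y.Form} {η} (h : ω.HasExtDeriv η) (φ : Hom X Y) :
    Form.HasExtDeriv (X := X) (fun x v w => ω (φ x) (φ.push v) (φ.push w))
      (fun x u v w => η (φ x) (φ.push u) (φ.push v) (φ.push w)) := by
  obtain ⟨N, a, b, c, h₁, h₂⟩ := h
  refine ⟨N, fun k => φ.pull (a k), fun k => φ.pull (b k), fun k => φ.pull (c k),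
    fun x v w => ?_, fun x u v w => ?_⟩
  · exact h₁ _ _ _
  · exact h₂ _ _ _ _

/-- A matrix of regular one-forms. -/
def IsRegularMat {m n : Type} (α : ∀ x : X.Pt, X.Tangent x → Matrix m n ℂ) : Prop :=
  ∀ i j, IsRegularOne fun x v => α x v i j

theorem isRegularMat_val_der_val {k l m n : Type} [Fintype l] [Fintype m] (F : Matrix k l X.reg)
    (G : Matrix l m X.reg) (H : Matrix m n X.reg) :
    IsRegularMat fun (x : X.Pt) (v : X.Tangent x) => val x F * der v G * val x H := by
  intro i j
  refine IsRegularOne.of_fintype (ι := m × l) (fun p => F i p.2 * H p.1 j) (fun p => G p.2 p.1)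
    fun x v => ?_
  rw [Fintype.sum_prod_type]
  simp only [Matrix.mul_apply, Finset.sum_mul]
  refine Finset.sum_congr rfl fun p _ => Finset.sum_congr rfl fun q _ => ?_
  change (F i q).1 x * v.1 (G q p) * (H p j).1 x = (F i q).1 x * (H p j).1 x * v.1 (G q p)
  ring

theorem isRegular_wedge {α β : ∀ x : X.Pt, X.Tangent x → ℂ} (hα : IsRegularOne α)
    (hβ : IsRegularOne β) :
    Form.IsRegular (X := X) fun x v w => α x v * β x w - α x w * β x v := by
  obtain ⟨N, a, b, h⟩ := hα
  obtain ⟨N', a', b', h'⟩ := hβ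
  refine (Form.HasExtDeriv.of_fintype (ι := Fin N × Fin N') (fun p => a p.1 * a' p.2)
    (fun p => b p.1) (fun p => b' p.2) (fun x v w => ?_) fun _ _ _ _ => rfl).isRegular
  rw [h, h, h', h', Finset.sum_mul_sum, Finset.sum_mul_sum, ← Finset.sum_sub_distrib,
    Fintype.sum_prod_type]
  refine Finset.sum_congr rfl fun p _ => ?_
  rw [← Finset.sum_sub_distrib]
  refine Finset.sum_congr rfl fun q _ => ?_
  change _ = (a p).1 x * (a' q).1 x * _
  ring

theorem Form.IsRegular.congr {ω ω' : X.Form} (h : ω.IsRegular)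
    (h₁ : ∀ x v w, ω' x v w = ω x v w) : ω'.IsRegular := by
  obtain ⟨η, h⟩ := h.exists_hasExtDeriv
  exact (h.congr h₁ fun _ _ _ _ => rfl).isRegular

theorem Form.IsRegular.add {ω ω' : X.Form} (h : ω.IsRegular) (h' : ω'.IsRegular) :
    Form.IsRegular (X := X) fun x v w => ω x v w + ω' x v w := by
  obtain ⟨η, h⟩ := h.exists_hasExtDeriv
  obtain ⟨η', h'⟩ := h'.exists_hasExtDeriv
  exact (h.add h').isRegular

theorem Form.IsRegular.smul {ω : X.Form} (r : ℂ) (h : ω.IsRegular) :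
    Form.IsRegular (X := X) fun x v w => r * ω x v w := by
  obtain ⟨η, h⟩ := h.exists_hasExtDeriv
  exact (h.smul r).isRegular

theorem Form.IsRegular.sub {ω ω' : X.Form} (h : ω.IsRegular) (h' : ω'.IsRegular) :
    Form.IsRegular (X := X) fun x v w => ω x v w - ω' x v w :=
  (h.add (h'.smul (-1))).congr fun _ _ _ => by ring

theorem Form.IsRegular.sum {ι : Type} (s : Finset ι) {ω : ι → X.Form}
    (h : ∀ i, (ω i).IsRegular) : Form.IsRegular (X := X) fun x v w => ∑ i ∈ s, ω i x v w := by
  choose η h using fun i => (h i).exists_hasExtDeriv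
  exact (Form.HasExtDeriv.sum s h).isRegular

theorem isRegular_wedgeTr {m : Type} [Fintype m]
    {α β : ∀ x : X.Pt, X.Tangent x → Matrix m m ℂ}
    (hα : IsRegularMat α) (hβ : IsRegularMat β) :
    Form.IsRegular (X := X) fun x v w => wedgeTr (α x) (β x) v w := by
  refine (Form.IsRegular.sum Finset.univ fun i => Form.IsRegular.sum Finset.univ fun j =>
    isRegular_wedge (hα i j) (hβ j i)).congr fun x v w => ?_
  simp only [wedgeTr, Matrix.trace, Matrix.diag_apply, Matrix.mul_apply, Finset.sum_sub_distrib]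

/-! ### The Cartan three-form and the derivative of the fusion term -/

section Mc

variable {m : Type} [Fintype m] [DecidableEq m]

theorem isRegularMat_mcL {F : Matrix m m X.reg} (hF : IsUnit F) :
    IsRegularMat fun (x : X.Pt) (v : X.Tangent x) => mcL F v := by
  simp only [mcL]
  have h := isRegularMat_val_der_val F⁻¹ F (1 : Matrix m m X.reg)
  simpa only [val_one, Matrix.mul_one, val_inv hF] using h

theorem isRegularMat_mcR {F : Matrix m m X.reg} (hF : IsUnit F) :
    IsRegularMat fun (x : X.Pt) (v : X.Tangent x) => mcR F v := by
  simp only [mcR]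
  have h := isRegularMat_val_der_val (1 : Matrix m m X.reg) F F⁻¹
  simpa only [val_one, Matrix.one_mul, val_inv hF] using h

/-- `F^*(θ³) / 6`. -/
def chi {x : X.Pt} (F : Matrix m m X.reg) (u v w : X.Tangent x) : ℂ :=
  (1 / 2 : ℂ) * (mcL F u * (mcL F v * mcL F w - mcL F w * mcL F v)).trace

/-- This is `d Tr(F dG ∧ dH) = Tr(dF ∧ dG ∧ dH)`. The presentation is indexed by the triples of
matrix indices in the trace, and the determinants in `HasExtDeriv` expand to the cyclic sum. -/
theorem hasExtDeriv_trace {l m n : Type} [Fintype l] [Fintype m] [Fintype n]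
    (F : Matrix l m X.reg) (G : Matrix m n X.reg) (H : Matrix n l X.reg) :
    Form.HasExtDeriv (X := X)
      (fun x v w => (val x F * (der v G * der w H - der w G * der v H)).trace)
      (fun _ u v w => (der u F * (der v G * der w H - der w G * der v H)).trace +
        (der v F * (der w G * der u H - der u G * der w H)).trace +
        (der w F * (der u G * der v H - der v G * der u H)).trace) := by
  refine Form.HasExtDeriv.of_fintype (ι := l × m × n) (fun p => F p.1 p.2.1)
    (fun p => G p.2.1 p.2.2) (fun p => H p.2.2 p.1) (fun x v w => ?_) fun x u v w => ?_
  · simp only [Matrix.trace, Matrix.diag_apply, Matrix.mul_apply, Matrix.sub_apply,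
      Fintype.sum_prod_type, Finset.mul_sum, ← Finset.sum_sub_distrib, val_apply, der_apply]
  · simp only [Matrix.trace, Matrix.diag_apply, Matrix.mul_apply, Matrix.sub_apply,
      Fintype.sum_prod_type, Finset.mul_sum, ← Finset.sum_sub_distrib, der_apply,
      ← Finset.sum_add_distrib, Matrix.det_fin_three, Matrix.of_apply, Matrix.cons_val]
    refine Finset.sum_congr rfl fun i _ => Finset.sum_congr rfl fun j _ =>
      Finset.sum_congr rfl fun k _ => ?_
    ring

theorem triTr_conj {P Q : Matrix m m ℂ} (h : P * Q = 1) (A B C : Matrix m m ℂ) :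
    (Q * A * P * (Q * B * P * (Q * C * P) - Q * C * P * (Q * B * P))).trace =
      (A * (B * C - C * B)).trace := by
  rw [conj_mul_conj h, conj_mul_conj h, ← Matrix.sub_mul, ← Matrix.mul_sub, conj_mul_conj h,
    trace_conj h]

theorem chi_eq_mcR {F : Matrix m m X.reg} (hF : IsUnit F) {x : X.Pt} (u v w : X.Tangent x) :
    chi F u v w = (1 / 2 : ℂ) * (mcR F u * (mcR F v * mcR F w - mcR F w * mcR F v)).trace := by
  rw [chi, mcL_eq u hF, mcL_eq v hF, mcL_eq w hF, triTr_conj (isUnit_mul_inv (isUnit_val hF x))]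

/-- Expansion of the invariant cubic form `Tr(a[a', a''])` on a sum: the mixed terms are collected
by cyclicity of the trace alone. -/
theorem triTr_add {m : Type} [Fintype m] (a a' a'' b b' b'' : Matrix m m ℂ) :
    ((a + b) * ((a' + b') * (a'' + b'') - (a'' + b'') * (a' + b'))).trace -
      (a * (a' * a'' - a'' * a')).trace - (b * (b' * b'' - b'' * b')).trace =
    ((a + b) * (a' * b'' - a'' * b')).trace + ((a' + b') * (a'' * b - a * b'')).trace +
      ((a'' + b'') * (a * b' - a' * b)).trace := by
  have h1 := fun A B C : Matrix m m ℂ => Matrix.trace_mul_cycle A B C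
  simp only [Matrix.add_mul, Matrix.mul_add, Matrix.mul_sub, Matrix.trace_add, Matrix.trace_sub,
    ← Matrix.mul_assoc]
  rw [h1 a' a'' b, h1 a' a b'', h1 a'' a b', h1 a'' a' b, h1 b' a'' b, h1 b' a b'', h1 b'' a b',
    h1 b'' a' b, h1 b b' a'', h1 b b'' a', h1 a'' b b', h1 a b'' b', h1 b a'' a']
  linear_combination -h1 b' a'' a - h1 b' b'' a + h1 b'' a' a - h1 b' a b''

/-- The Polyakov-Wiegmann identity, which makes fusion compatible with (QH1). Presenting `(F^*θ,
G^*θ̄)` as `Tr((FG)⁻¹ dF ∧ dG)` makes its derivative computable. Up to conjugation by `G`, `(FG)^*θ`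
is `F^*θ + G^*θ̄`, and the mixed terms of its cubic form are what the derivative produces. -/
theorem hasExtDeriv_fusion {F G : Matrix m m X.reg} (hF : IsUnit F) (hG : IsUnit G) :
    Form.HasExtDeriv (X := X)
      (fun x v w => -(1 / 2 : ℂ) * wedgeTr (fun u : X.Tangent x => mcL F u) (fun u => mcR G u) v w)
      (fun _ u v w => chi (F * G) u v w - chi F u v w - chi G u v w) := by
  refine ((hasExtDeriv_trace (F * G)⁻¹ F G).smul (-(1 / 2 : ℂ))).congr (fun x v w => ?_)
    fun x u v w => ?_
  · congr 1
    rw [val_inv (hF.mul hG), val_mul, inv_mul_rev, wedgeTr, Matrix.mul_sub, Matrix.trace_sub]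
    have h : ∀ A B : Matrix m m ℂ, ((val x G)⁻¹ * (val x F)⁻¹ * (A * B)).trace =
        ((val x F)⁻¹ * A * (B * (val x G)⁻¹)).trace := fun A B => by
      rw [Matrix.mul_assoc, Matrix.trace_mul_comm]
      congr 1
      noncomm_ring
    rw [h, h]
    rfl
  · have h : ∀ a b c : X.Tangent x,
        (der a (F * G)⁻¹ * (der b F * der c G - der c F * der b G)).trace =
        -((mcL F a + mcR G a) * (mcL F b * mcR G c - mcL F c * mcR G b)).trace := by
      intro a b c
      have hv := isUnit_inv_mul (isUnit_val hF x)
      have hg := isUnit_mul_inv (isUnit_val hG x)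
      rw [der_inv a (hF.mul hG), ← mcL, mcL_mul a hF hG, val_mul, inv_mul_rev,
        der_eq_mul_mcL b hF, der_eq_mul_mcL c hF, der_eq_mcR_mul b hG, der_eq_mcR_mul c hG,
        Matrix.neg_mul, Matrix.trace_neg, neg_inj]
      calc _ = ((val x G)⁻¹ * ((mcL F a + mcR G a) * (val x G * (val x G)⁻¹) *
              ((val x F)⁻¹ * val x F) *
              (mcL F b * mcR G c - mcL F c * mcR G b)) * val x G).trace := by
            congr 1; noncomm_ring
        _ = _ := by rw [trace_conj hg, hv, hg, Matrix.mul_one, Matrix.mul_one]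
    rw [chi, chi, chi_eq_mcR hG, mcL_mul u hF hG, mcL_mul v hF hG, mcL_mul w hF hG,
      triTr_conj (isUnit_mul_inv (isUnit_val hG x)), h, h, h]
    linear_combination (1 / 2 : ℂ) * triTr_add (mcL F u) (mcL F v) (mcL F w) (mcR G u) (mcR G v)
      (mcR G w)

theorem chi_one {x : X.Pt} (u v w : X.Tangent x) : chi (1 : Matrix m m X.reg) u v w = 0 := by
  rw [chi, mcL_one, Matrix.zero_mul, Matrix.trace_zero, mul_zero]

theorem isUnit_list_prod {R : Type} [CommRing R] {L : List (Matrix m m R)}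
    (h : ∀ F ∈ L, IsUnit F) : IsUnit L.prod := by
  induction L with
  | nil => simp
  | cons F L ih =>
    rw [List.prod_cons]
    exact (h F (by simp)).mul (ih fun G hG => h G (by simp [hG]))

/-- The two-factor identity telescopes: fusing `F` in front of `L.prod` adds the difference between
the three-forms of `F * L.prod`, `F` and `L.prod`. -/
theorem hasExtDeriv_fusionTerms (L : List (Matrix m m X.reg)) (h : ∀ F ∈ L, IsUnit F) :
    Form.HasExtDeriv (X := X) (fun _ v w => -(1 / 2 : ℂ) * fusionTerms v w L)
      (fun _ u v w => chi L.prod u v w - (L.map fun F => chi F u v w).sum) := by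
  induction L with
  | nil =>
    exact Form.hasExtDeriv_zero.congr (fun _ _ _ => by simp [fusionTerms])
      (fun _ _ _ _ => by simp [chi_one])
  | cons F L ih =>
    have hL : ∀ G ∈ L, IsUnit G := fun G hG => h G (by simp [hG])
    refine ((hasExtDeriv_fusion (h F (by simp)) (isUnit_list_prod hL)).add (ih hL)).congr
      (fun x v w => ?_) fun x u v w => ?_
    · rw [fusionTerms]; ring
    · rw [List.map_cons, List.sum_cons, List.prod_cons]; ring

end Mc

end FunSpace

end FissionVar

end

noncomputable section

namespace FissionVar

namespace FunSpace

/-! ### Functions with matrix values and entries in a given algebra of functions -/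

/-- The entries of the matrix valued function `F` lie in the algebra `S` of functions. -/
def EntriesIn {P : Type} (S : Subalgebra ℂ (P → ℂ)) {m n : Type} (F : P → Matrix m n ℂ) : Prop :=
  ∀ i j, (fun p => F p i j) ∈ S

namespace EntriesIn

variable {P : Type} {S : Subalgebra ℂ (P → ℂ)} {l m n k : Type}

theorem mul [Fintype m] {F : P → Matrix l m ℂ} {G : P → Matrix m n ℂ} (hF : EntriesIn S F)
    (hG : EntriesIn S G) : EntriesIn S fun p => F p * G p := by
  intro i j
  have h : (fun p => (F p * G p) i j) = ∑ k, (fun p => F p i k) * fun p => G p k j := by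
    funext p
    simp [Matrix.mul_apply]
  rw [h]
  exact S.sum_mem fun k _ => S.mul_mem (hF i k) (hG k j)

theorem const (A : Matrix m n ℂ) : EntriesIn S fun _ => A :=
  fun i j => S.algebraMap_mem (A i j)

theorem add {F G : P → Matrix m n ℂ} (hF : EntriesIn S F) (hG : EntriesIn S G) :
    EntriesIn S fun p => F p + G p := fun i j => S.add_mem (hF i j) (hG i j)

theorem neg {F : P → Matrix m n ℂ} (hF : EntriesIn S F) :
    EntriesIn S fun p => -F p := fun i j => S.neg_mem (hF i j)

theorem fromBlocks {A : P → Matrix m n ℂ} {B : P → Matrix m l ℂ} {C : P → Matrix k n ℂ}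
    {D : P → Matrix k l ℂ} (hA : EntriesIn S A) (hB : EntriesIn S B) (hC : EntriesIn S C)
    (hD : EntriesIn S D) : EntriesIn S fun p => Matrix.fromBlocks (A p) (B p) (C p) (D p) := by
  rintro (i | i) (j | j)
  · exact hA i j
  · exact hB i j
  · exact hC i j
  · exact hD i j

theorem reindex {F : P → Matrix m n ℂ} (hF : EntriesIn S F) (e : m ≃ l) (e' : n ≃ k) :
    EntriesIn S fun p => Matrix.reindex e e' (F p) := fun i j => hF (e.symm i) (e'.symm j)

/-- A function with entries in the regular functions, as a matrix of regular functions. -/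
def toMat {X : FunSpace} {F : X.Pt → Matrix m n ℂ} (hF : EntriesIn X.reg F) :
    Matrix m n X.reg := fun i j => ⟨fun x => F x i j, hF i j⟩

end EntriesIn

theorem comp_mem_of_adjoin {P Q : Type} {s : Set (P → ℂ)} {T : Subalgebra ℂ (Q → ℂ)} {φ : Q → P}
    (h : ∀ f ∈ s, f ∘ φ ∈ T) {f : P → ℂ} (hf : f ∈ Algebra.adjoin ℂ s) : f ∘ φ ∈ T := by
  induction hf using Algebra.adjoin_induction with
  | mem f hf => exact h f hf
  | algebraMap r => exact T.algebraMap_mem r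
  | add f g _ _ hf hg => exact T.add_mem hf hg
  | mul f g _ _ hf hg => exact T.mul_mem hf hg

theorem Hom.isIso_of_adjoin {X Y : FunSpace} {φ : Hom X Y} (hb : Function.Bijective φ)
    {s : Set (X.Pt → ℂ)} (hs : X.reg = Algebra.adjoin ℂ s) (h : ∀ F ∈ s, ∃ f ∈ Y.reg, F = f ∘ φ) :
    φ.IsIso := by
  refine ⟨hb, fun F hF => ?_⟩
  rw [hs] at hF
  induction hF using Algebra.adjoin_induction with
  | mem f hf => exact h f hf
  | algebraMap r => exact ⟨_, Y.reg.algebraMap_mem r, rfl⟩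
  | add f g _ _ hf hg =>
    obtain ⟨f', hf', rfl⟩ := hf
    obtain ⟨g', hg', rfl⟩ := hg
    exact ⟨f' + g', Y.reg.add_mem hf' hg', rfl⟩
  | mul f g _ _ hf hg =>
    obtain ⟨f', hf', rfl⟩ := hf
    obtain ⟨g', hg', rfl⟩ := hg
    exact ⟨f' * g', Y.reg.mul_mem hf' hg', rfl⟩

/-- The identity map. -/
def Hom.id (X : FunSpace) : Hom X X := ⟨fun x => x, fun _ h => h⟩

theorem Hom.id_isIso (X : FunSpace) : (Hom.id X).IsIso :=
  ⟨Function.bijective_id, fun F hF => ⟨F, hF, rfl⟩⟩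

/-- Composition of regular maps. -/
def Hom.comp {X Y Z : FunSpace} (ψ : Hom Y Z) (φ : Hom X Y) : Hom X Z :=
  ⟨fun x => ψ (φ x), fun f hf => φ.regular _ (ψ.regular f hf)⟩

/-- The inverse of an isomorphism. -/
def Hom.inv {X Y : FunSpace} {φ : Hom X Y} (h : φ.IsIso) : Hom Y X where
  toFun := (Equiv.ofBijective φ h.1).symm
  regular F hF := by
    obtain ⟨f, hf, rfl⟩ := h.2 F hF
    convert hf using 1
    funext y
    exact congrArg f (Equiv.ofBijective_apply_symm_apply φ h.1 y)

theorem Hom.inv_apply {X Y : FunSpace} {φ : Hom X Y} (h : φ.IsIso) (x : X.Pt) :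
    Hom.inv h (φ x) = x := Equiv.ofBijective_symm_apply_apply φ h.1 x

theorem Hom.apply_inv {X Y : FunSpace} {φ : Hom X Y} (h : φ.IsIso) (y : Y.Pt) :
    φ (Hom.inv h y) = y := Equiv.ofBijective_apply_symm_apply φ h.1 y

/-! ### Affine varieties given by generators -/

theorem algHom_ext_of_adjoin {X : FunSpace} {A : Type} [Semiring A] [Algebra ℂ A]
    {s : Set (X.Pt → ℂ)} (hs : X.reg = Algebra.adjoin ℂ s) {χ χ' : X.reg →ₐ[ℂ] A}
    (h : ∀ f : X.reg, f.1 ∈ s → χ f = χ' f) : χ = χ' := by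
  apply AlgHom.ext
  rintro ⟨f, hf⟩
  have hf' := hf
  rw [hs] at hf'
  induction hf' using Algebra.adjoin_induction with
  | mem f hf' => exact h _ hf'
  | algebraMap r => exact (χ.commutes r).trans (χ'.commutes r).symm
  | add f g hf' hg' hf₁ hg₁ =>
    rw [← hs] at hf' hg'
    have e : (⟨f + g, hf⟩ : X.reg) = ⟨f, hf'⟩ + ⟨g, hg'⟩ := rfl
    rw [e, map_add, map_add, hf₁, hg₁]
  | mul f g hf' hg' hf₁ hg₁ =>
    rw [← hs] at hf' hg'
    have e : (⟨f * g, hf⟩ : X.reg) = ⟨f, hf'⟩ * ⟨g, hg'⟩ := rfl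
    rw [e, map_mul, map_mul, hf₁, hg₁]

theorem tangent_ext_of_adjoin {X : FunSpace} {s : Set (X.Pt → ℂ)}
    (hs : X.reg = Algebra.adjoin ℂ s) {x : X.Pt} {v w : X.Tangent x}
    (h : ∀ f : X.reg, f.1 ∈ s → v.1 f = w.1 f) : v = w := by
  apply Subtype.ext
  apply LinearMap.ext
  rintro ⟨f, hf⟩
  have hf' := hf
  rw [hs] at hf'
  induction hf' using Algebra.adjoin_induction with
  | mem f hf' => exact h _ hf'
  | algebraMap r => exact (tangent_algebraMap v r).trans (tangent_algebraMap w r).symm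
  | add f g hf' hg' hf₁ hg₁ =>
    rw [← hs] at hf' hg'
    have e : (⟨f + g, hf⟩ : X.reg) = ⟨f, hf'⟩ + ⟨g, hg'⟩ := rfl
    rw [e, map_add, map_add, hf₁, hg₁]
  | mul f g hf' hg' hf₁ hg₁ =>
    rw [← hs] at hf' hg'
    have e : (⟨f * g, hf⟩ : X.reg) = ⟨f, hf'⟩ * ⟨g, hg'⟩ := rfl
    rw [e, tangent_mul, tangent_mul, hf₁, hg₁]

theorem isAffine_of_adjoin {X : FunSpace} {s : Set (X.Pt → ℂ)} (hfin : s.Finite)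
    (hs : X.reg = Algebra.adjoin ℂ s)
    (hinj : ∀ x y : X.Pt, (∀ f ∈ s, f x = f y) → x = y)
    (h : ∀ χ : X.reg →ₐ[ℂ] ℂ, ∃ x : X.Pt, ∀ f : X.reg, f.1 ∈ s → χ f = f.1 x) : X.IsAffine := by
  refine ⟨Subalgebra.fg_def.2 ⟨s, hfin, hs.symm⟩, fun χ => ?_⟩
  obtain ⟨x, hx⟩ := h χ
  have e : χ = X.evalAt x := algHom_ext_of_adjoin hs hx
  refine ⟨x, e, fun y hy => ?_⟩
  refine hinj y x fun f hf => ?_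
  have hf' : f ∈ X.reg := hs ▸ Algebra.subset_adjoin hf
  have := DFunLike.congr_fun (hy.symm.trans e) ⟨f, hf'⟩
  exact this

theorem finite_entries {P m n : Type} [Finite m] [Finite n] (F : P → Matrix m n ℂ) :
    {f : P → ℂ | ∃ i j, f = fun p => F p i j}.Finite := by
  have : {f : P → ℂ | ∃ i j, f = fun p => F p i j} =
      Set.range fun q : m × n => fun p => F p q.1 q.2 := by
    ext f
    simp [eq_comm]
  rw [this]
  exact Set.finite_range _

/-! ### Basic open subsets of affine spaces -/

/-- The functions `c` identify `X` with the basic open set `f ≠ 0` of an affine space. -/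
structure IsBasicOpen (X : FunSpace) {σ : Type} (f : MvPolynomial σ ℂ) (c : σ → X.reg) : Prop where
  inj : ∀ x y : X.Pt, (∀ s, (c s).1 x = (c s).1 y) → x = y
  surj : ∀ p : σ → ℂ, MvPolynomial.eval p f ≠ 0 → ∃ x : X.Pt, ∀ s, (c s).1 x = p s
  unit : IsUnit (MvPolynomial.aeval c f)
  gen : ∀ F : X.reg, ∃ (g : MvPolynomial σ ℂ) (n : ℕ),
    F * MvPolynomial.aeval c f ^ n = MvPolynomial.aeval c g

theorem aeval_apply {X : FunSpace} {σ : Type} (c : σ → X.reg) (g : MvPolynomial σ ℂ) (x : X.Pt) :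
    (MvPolynomial.aeval c g).1 x = MvPolynomial.eval (fun s => (c s).1 x) g := by
  have h : (X.evalAt x).comp (MvPolynomial.aeval c) =
      MvPolynomial.aeval (fun s => (c s).1 x) :=
    MvPolynomial.algHom_ext fun s => by
      simp only [AlgHom.comp_apply, MvPolynomial.aeval_X]; rfl
  have := DFunLike.congr_fun h g
  rwa [MvPolynomial.aeval_eq_eval] at this

/-- Fractions whose denominators are powers of `f` are closed under sums and products, so it
suffices to clear denominators on generators. -/
theorem gen_of_adjoin {X : FunSpace} {σ : Type} {f : MvPolynomial σ ℂ} {c : σ → X.reg}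
    {s : Set (X.Pt → ℂ)} (hs : X.reg = Algebra.adjoin ℂ s)
    (h : ∀ F : X.reg, F.1 ∈ s → ∃ (g : MvPolynomial σ ℂ) (n : ℕ),
      F * MvPolynomial.aeval c f ^ n = MvPolynomial.aeval c g) (F : X.reg) :
    ∃ (g : MvPolynomial σ ℂ) (n : ℕ),
      F * MvPolynomial.aeval c f ^ n = MvPolynomial.aeval c g := by
  obtain ⟨F, hF⟩ := F
  have hF' := hF
  rw [hs] at hF'
  induction hF' using Algebra.adjoin_induction with
  | mem F hF' => exact h _ hF'
  | algebraMap r =>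
    refine ⟨MvPolynomial.C r, 0, ?_⟩
    rw [pow_zero, mul_one, MvPolynomial.aeval_C]
    rfl
  | add F G hF' hG' hF₁ hG₁ =>
    rw [← hs] at hF' hG'
    obtain ⟨g, n, e⟩ := hF₁ hF'
    obtain ⟨g', n', e'⟩ := hG₁ hG'
    refine ⟨g * f ^ n' + g' * f ^ n, n + n', ?_⟩
    have e₁ : (⟨F + G, hF⟩ : X.reg) = ⟨F, hF'⟩ + ⟨G, hG'⟩ := rfl
    rw [e₁, map_add, map_mul, map_mul, map_pow, map_pow, ← e, ← e']
    ring
  | mul F G hF' hG' hF₁ hG₁ =>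
    rw [← hs] at hF' hG'
    obtain ⟨g, n, e⟩ := hF₁ hF'
    obtain ⟨g', n', e'⟩ := hG₁ hG'
    refine ⟨g * g', n + n', ?_⟩
    have e₁ : (⟨F * G, hF⟩ : X.reg) = ⟨F, hF'⟩ * ⟨G, hG'⟩ := rfl
    rw [e₁, map_mul, ← e, ← e']
    ring

namespace IsBasicOpen

variable {X : FunSpace} {σ : Type} {f : MvPolynomial σ ℂ} {c : σ → X.reg}

/-- The only non-formal point is the kernel: two polynomials that agree on `X` agree wherever `f ≠
0`, hence agree everywhere after multiplication by `f`. -/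
theorem isLocalization (h : IsBasicOpen X f c) :
    let := (MvPolynomial.aeval c : MvPolynomial σ ℂ →ₐ[ℂ] X.reg).toAlgebra
    IsLocalization.Away f X.reg := by
  let := (MvPolynomial.aeval c : MvPolynomial σ ℂ →ₐ[ℂ] X.reg).toAlgebra
  refine (isLocalization_iff (Submonoid.powers f) X.reg).2 ⟨?_, fun z => ?_, fun {p q} hpq => ?_⟩
  · rintro ⟨_, n, rfl⟩
    change IsUnit (MvPolynomial.aeval c (f ^ n))
    rw [map_pow]
    exact h.unit.pow n
  · obtain ⟨g, n, e⟩ := h.gen z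
    refine ⟨(g, ⟨f ^ n, n, rfl⟩), ?_⟩
    change z * MvPolynomial.aeval c (f ^ n) = MvPolynomial.aeval c g
    rw [map_pow, e]
  · refine ⟨⟨f, 1, pow_one f⟩, ?_⟩
    change MvPolynomial.aeval c p = MvPolynomial.aeval c q at hpq
    refine MvPolynomial.funext fun t => ?_
    change MvPolynomial.eval t (f * p) = MvPolynomial.eval t (f * q)
    rw [map_mul, map_mul]
    by_cases h0 : MvPolynomial.eval t f = 0
    · rw [h0, zero_mul, zero_mul]
    · obtain ⟨x, hx⟩ := h.surj t h0
      obtain rfl : (fun s => (c s).1 x) = t := funext hx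
      rw [← aeval_apply c p, ← aeval_apply c q, hpq]

theorem smooth [Finite σ] (h : IsBasicOpen X f c) : Algebra.Smooth ℂ X.reg := by
  let := (MvPolynomial.aeval c : MvPolynomial σ ℂ →ₐ[ℂ] X.reg).toAlgebra
  have : IsScalarTower ℂ (MvPolynomial σ ℂ) X.reg :=
    IsScalarTower.of_algebraMap_eq fun r =>
      (AlgHom.commutes (MvPolynomial.aeval c : MvPolynomial σ ℂ →ₐ[ℂ] X.reg) r).symm
  have := h.isLocalization
  have : Algebra.Smooth (MvPolynomial σ ℂ) X.reg := Algebra.Smooth.of_isLocalization_Away f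
  have : Algebra.Smooth ℂ (MvPolynomial σ ℂ) := ⟨inferInstance, inferInstance⟩
  exact Algebra.Smooth.comp ℂ (MvPolynomial σ ℂ) X.reg

/-- A tangent vector is a homomorphism to the dual numbers. Sending each coordinate to `c s + ε t s`
defines one on polynomials. It extends to the localization because the image of `f` has invertible
constant term, and its `ε`-part is the derivation. -/
theorem exists_tangent (h : IsBasicOpen X f c) (x : X.Pt) (t : σ → ℂ) :
    ∃ v : X.Tangent x, ∀ s, v.1 (c s) = t s := by
  let := (MvPolynomial.aeval c : MvPolynomial σ ℂ →ₐ[ℂ] X.reg).toAlgebra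
  have := h.isLocalization
  let g : MvPolynomial σ ℂ →ₐ[ℂ] DualNumber ℂ :=
    MvPolynomial.aeval fun s => TrivSqZeroExt.inl ((c s).1 x) + TrivSqZeroExt.inr (t s)
  have hfst : ∀ p, (g p).fst = (MvPolynomial.aeval c p).1 x := by
    intro p
    have e : (TrivSqZeroExt.fstHom ℂ ℂ ℂ).comp g = (X.evalAt x).comp (MvPolynomial.aeval c) :=
      MvPolynomial.algHom_ext fun s => by
        simp only [AlgHom.comp_apply, g, MvPolynomial.aeval_X]
        simp only [TrivSqZeroExt.fstHom_apply, TrivSqZeroExt.fst_add, TrivSqZeroExt.fst_inl,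
          TrivSqZeroExt.fst_inr, add_zero]
        rfl
    exact DFunLike.congr_fun e p
  have hu : IsUnit ((g : MvPolynomial σ ℂ →+* DualNumber ℂ) f) := by
    rw [TrivSqZeroExt.isUnit_iff_isUnit_fst]
    exact (hfst f).symm ▸ h.unit.map (X.evalAt x)
  let ψ : X.reg →+* DualNumber ℂ := IsLocalization.Away.lift f hu
  have hψ : ∀ p, ψ (MvPolynomial.aeval c p) = g p := IsLocalization.Away.lift_eq f hu
  have hψ1 : ∀ F, (ψ F).fst = F.1 x := by
    intro F
    have e : (TrivSqZeroExt.fstHom ℂ ℂ ℂ : DualNumber ℂ →+* ℂ).comp ψ = (X.evalAt x : X.reg →+* ℂ) :=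
      IsLocalization.ringHom_ext (Submonoid.powers f) (RingHom.ext fun p => by
        change (ψ (MvPolynomial.aeval c p)).fst = (MvPolynomial.aeval c p).1 x
        rw [hψ, hfst])
    exact DFunLike.congr_fun e F
  have hψC : ∀ r : ℂ, ψ (algebraMap ℂ X.reg r) = TrivSqZeroExt.inl r := by
    intro r
    have := hψ (MvPolynomial.C r)
    rwa [MvPolynomial.aeval_C, MvPolynomial.aeval_C] at this
  refine ⟨⟨{ toFun := fun F => (ψ F).snd, map_add' := fun F G => ?_, map_smul' := fun r F => ?_ },
    fun F G => ?_⟩, fun s => ?_⟩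
  · rw [map_add, TrivSqZeroExt.snd_add]
  · rw [Algebra.smul_def, map_mul, TrivSqZeroExt.snd_mul, hψC]
    simp
  · change (ψ (F * G)).snd = F.1 x * (ψ G).snd + G.1 x * (ψ F).snd
    rw [map_mul, TrivSqZeroExt.snd_mul, hψ1, hψ1]
    simp [mul_comm]
  · change (ψ (c s)).snd = t s
    have := hψ (MvPolynomial.X s)
    rw [MvPolynomial.aeval_X, MvPolynomial.aeval_X] at this
    rw [this]
    simp

theorem tangent_ext (h : IsBasicOpen X f c) {x : X.Pt} {v w : X.Tangent x}
    (hvw : ∀ s, v.1 (c s) = w.1 (c s)) : v = w := by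
  have hp : ∀ p : MvPolynomial σ ℂ, v.1 (MvPolynomial.aeval c p) = w.1 (MvPolynomial.aeval c p) := by
    intro p
    induction p using MvPolynomial.induction_on with
    | C r => rw [MvPolynomial.aeval_C, tangent_algebraMap, tangent_algebraMap]
    | add p q hp hq => rw [map_add, map_add, map_add, hp, hq]
    | mul_X p s hp =>
      rw [map_mul, MvPolynomial.aeval_X, tangent_mul, tangent_mul, hp, hvw]
  apply Subtype.ext
  apply LinearMap.ext
  intro F
  obtain ⟨g, n, e⟩ := h.gen F
  have h1 := tangent_mul v F (MvPolynomial.aeval c f ^ n)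
  have h2 := tangent_mul w F (MvPolynomial.aeval c f ^ n)
  rw [e, ← map_pow, hp] at h1
  rw [e, ← map_pow, h1, hp (f ^ n), add_right_inj] at h2
  have hu : (MvPolynomial.aeval c (f ^ n)).1 x ≠ 0 := by
    rw [map_pow]
    exact ((h.unit.pow n).map (X.evalAt x)).ne_zero
  exact mul_left_cancel₀ hu h2

end IsBasicOpen

end FunSpace

end FissionVar

end

noncomputable section

namespace FissionVar

open FunSpace

/-! ### One-parameter groups and fundamental vector fields -/

section Exp

variable {I : Type} {n : I → ℕ}

open NormedSpace in
theorem hasDerivAt_exp_smul {m : ℕ} (A : Matrix (Fin m) (Fin m) ℂ) :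
    ∀ a b, HasDerivAt (fun t : ℂ => exp (t • A) a b) (A a b) 0 := by
  intro a b
  -- The derivative of the exponential needs a normed algebra; any norm serves, since only the
  -- entries are differentiated in the end.
  let : NormedRing (Matrix (Fin m) (Fin m) ℂ) := Matrix.linftyOpNormedRing
  let : NormedAlgebra ℂ (Matrix (Fin m) (Fin m) ℂ) := Matrix.linftyOpNormedAlgebra
  have h : HasDerivAt (fun t : ℂ => exp (t • A)) (exp ((0 : ℂ) • A) * A) 0 :=
    hasDerivAt_exp_smul_const A 0
  rw [zero_smul, exp_zero, one_mul] at h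
  exact (Matrix.entryLinearMap ℂ ℂ a b).toContinuousLinearMap.hasFDerivAt.comp_hasDerivAt 0 h

theorem expG_val (A : ∀ i, Matrix (Fin (n i)) (Fin (n i)) ℂ) (i : I) :
    (expG A i).val = NormedSpace.exp (A i) := rfl

theorem expG_zero_smul (A : ∀ i, Matrix (Fin (n i)) (Fin (n i)) ℂ) :
    expG ((0 : ℂ) • A) = 1 := by
  funext i
  apply Units.ext
  rw [expG_val, zero_smul, Pi.zero_apply, NormedSpace.exp_zero]
  rfl

theorem expG_inv_val (A : ∀ i, Matrix (Fin (n i)) (Fin (n i)) ℂ) (t : ℂ) (i : I) :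
    ((expG (t • A) i)⁻¹).val = NormedSpace.exp (t • -A i) := by
  rw [smul_neg, Matrix.exp_neg]
  exact Matrix.coe_units_inv _

theorem hasDerivAt_expG (A : ∀ i, Matrix (Fin (n i)) (Fin (n i)) ℂ) (i : I) (a b) :
    HasDerivAt (fun t : ℂ => (expG (t • A) i).val a b) (A i a b) 0 :=
  hasDerivAt_exp_smul (A i) a b

theorem hasDerivAt_expG_inv (A : ∀ i, Matrix (Fin (n i)) (Fin (n i)) ℂ) (i : I) (a b) :
    HasDerivAt (fun t : ℂ => ((expG (t • A) i)⁻¹).val a b) (-A i a b) 0 := by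
  simp only [expG_inv_val]
  exact hasDerivAt_exp_smul (-A i) a b

/-- This is where algebraicity of the action is used: regular functions pulled back along a
one-parameter group are polynomial in the entries of `exp(tA)` and `exp(-tA)`. -/
theorem differentiableAt_regGLProd {X : FunSpace} (A : ∀ i, Matrix (Fin (n i)) (Fin (n i)) ℂ)
    (x : X.Pt) {F : GLProd n × X.Pt → ℂ} (hF : F ∈ regGLProd n X) :
    DifferentiableAt ℂ (fun t : ℂ => F (expG (t • A), x)) 0 := by
  induction hF using Algebra.adjoin_induction with
  | mem F hF =>
    rcases hF with (⟨i, a, b, rfl⟩ | ⟨i, a, b, rfl⟩) | ⟨f, _, rfl⟩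
    · exact (hasDerivAt_expG A i a b).differentiableAt
    · exact (hasDerivAt_expG_inv A i a b).differentiableAt
    · exact differentiableAt_const (f x)
  | algebraMap r => exact differentiableAt_const r
  | add F G _ _ hF hG => exact hF.add hG
  | mul F G _ _ hF hG => exact hF.mul hG

end Exp

namespace QHDatum

variable {I J : Type} {n : I → ℕ} {m : J → ℕ}

/-- Differentiation along the orbit of the one-parameter group is a point derivation at `x`, because
the group starts at the identity. The minus sign is the convention for fundamental fields. -/
theorem exists_fundamental (M : QHDatum I n) (A : ∀ i, Matrix (Fin (n i)) (Fin (n i)) ℂ)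
    (x : M.X.Pt) : ∃ v : M.X.Tangent x, M.IsFundamental A v := by
  have hd : ∀ f : M.X.reg,
      HasDerivAt (fun t : ℂ => f.1 (M.act (expG (t • A)) x))
        (deriv (fun t : ℂ => f.1 (M.act (expG (t • A)) x)) 0) 0 := fun f =>
    (differentiableAt_regGLProd A x (M.act_regular f.1 f.2)).hasDerivAt
  have h0 : ∀ f : M.X.reg, f.1 (M.act (expG ((0 : ℂ) • A)) x) = f.1 x := fun f => by
    rw [expG_zero_smul, M.act_one]
  refine ⟨⟨{ toFun := fun f => -deriv (fun t : ℂ => f.1 (M.act (expG (t • A)) x)) 0,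
             map_add' := fun f g => ?_, map_smul' := fun r f => ?_ }, fun f g => ?_⟩, fun f => ?_⟩
  · rw [← neg_add, neg_inj]
    exact ((hd f).add (hd g)).deriv
  · rw [RingHom.id_apply, smul_neg, neg_inj]
    exact ((hd f).const_mul r).deriv
  · have h := ((hd f).mul (hd g)).deriv
    rw [h0, h0] at h
    change -deriv (fun t : ℂ => f.1 (M.act (expG (t • A)) x) * g.1 (M.act (expG (t • A)) x)) 0 =
      f.1 x * -deriv (fun t : ℂ => g.1 (M.act (expG (t • A)) x)) 0 +
      g.1 x * -deriv (fun t : ℂ => f.1 (M.act (expG (t • A)) x)) 0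
    refine (congrArg Neg.neg h).trans ?_
    ring
  · change HasDerivAt _ (-(-deriv (fun t : ℂ => f.1 (M.act (expG (t • A)) x)) 0)) 0
    rw [neg_neg]
    exact hd f

theorem IsFundamental.unique {M : QHDatum I n} {A : ∀ i, Matrix (Fin (n i)) (Fin (n i)) ℂ}
    {x : M.X.Pt} {v w : M.X.Tangent x} (hv : M.IsFundamental A v) (hw : M.IsFundamental A w) :
    v = w := by
  apply Subtype.ext
  apply LinearMap.ext
  intro f
  exact neg_injective ((hv f).unique (hw f))

/-- Differentiating `exp(tA_i) F exp(-tA_j)` gives `A_i F - F A_j`; the sign convention for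
fundamental fields reverses it. -/
theorem IsFundamental.der_of_val_act {M : QHDatum I n}
    {A : ∀ i, Matrix (Fin (n i)) (Fin (n i)) ℂ} {x : M.X.Pt} {v : M.X.Tangent x}
    (hv : M.IsFundamental A v) {i j : I} {F : Matrix (Fin (n i)) (Fin (n j)) M.X.reg}
    (hF : ∀ g, val (M.act g x) F = (g i).val * val x F * ((g j)⁻¹).val) :
    der v F = val x F * A j - A i * val x F := by
  ext a b
  have h1 := hv (F a b)
  have h2 : HasDerivAt (fun t : ℂ => ∑ p, (∑ q, (expG (t • A) i).val a q * val x F q p) *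
      ((expG (t • A) j)⁻¹).val p b)
      (∑ p, ((∑ q, A i a q * val x F q p) * (1 : Matrix (Fin (n j)) (Fin (n j)) ℂ) p b +
        (∑ q, (1 : Matrix (Fin (n i)) (Fin (n i)) ℂ) a q * val x F q p) * (-A j p b))) 0 := by
    refine HasDerivAt.fun_sum fun p _ => ?_
    have e1 : HasDerivAt (fun t : ℂ => ∑ q, (expG (t • A) i).val a q * val x F q p)
        (∑ q, A i a q * val x F q p) 0 :=
      HasDerivAt.fun_sum fun q _ => (hasDerivAt_expG A i a q).mul_const _
    refine (e1.fun_mul (hasDerivAt_expG_inv A j p b)).congr_deriv ?_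
    rw [expG_zero_smul]
    simp
  have h3 : (fun t : ℂ => (F a b).1 (M.act (expG (t • A)) x)) =
      fun t : ℂ => ∑ p, (∑ q, (expG (t • A) i).val a q * val x F q p) *
      ((expG (t • A) j)⁻¹).val p b := by
    funext t
    have := congrFun (congrFun (hF (expG (t • A))) a) b
    rw [val_apply] at this
    rw [this, Matrix.mul_apply]
    simp only [Matrix.mul_apply]
  rw [h3] at h1
  have h4 := h1.unique h2
  have h5 : ∑ p, ((∑ q, A i a q * val x F q p) *
      (1 : Matrix (Fin (n j)) (Fin (n j)) ℂ) p b +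
        (∑ q, (1 : Matrix (Fin (n i)) (Fin (n i)) ℂ) a q * val x F q p) * (-A j p b)) =
      (A i * val x F * (1 : Matrix (Fin (n j)) (Fin (n j)) ℂ) +
        (1 : Matrix (Fin (n i)) (Fin (n i)) ℂ) * val x F * (-A j)) a b := by
    rw [Matrix.add_apply, Matrix.mul_apply, Matrix.mul_apply, ← Finset.sum_add_distrib]
    simp only [Matrix.mul_apply, Matrix.neg_apply]
  rw [h5, Matrix.mul_one, Matrix.one_mul, Matrix.mul_neg] at h4
  rw [der_apply, ← neg_neg (v.1 (F a b)), h4]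
  simp only [Matrix.add_apply, Matrix.neg_apply, Matrix.sub_apply]
  ring

theorem IsFundamental.der_μ {M : QHDatum I n} {A : ∀ i, Matrix (Fin (n i)) (Fin (n i)) ℂ}
    {x : M.X.Pt} {v : M.X.Tangent x} (hv : M.IsFundamental A v) (i : I) :
    der v (M.μ i) = val x (M.μ i) * A i - A i * val x (M.μ i) :=
  hv.der_of_val_act fun g => M.μ_act g x i

theorem QH2.eq [Fintype I] {M : QHDatum I n} (h : M.QH2)
    {A : ∀ i, Matrix (Fin (n i)) (Fin (n i)) ℂ} {x : M.X.Pt} {v : M.X.Tangent x}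
    (hv : M.IsFundamental A v) (w : M.X.Tangent x) :
    M.ω x v w = (1 / 2 : ℂ) * ∑ i, ((mcL (M.μ i) w + mcR (M.μ i) w) * A i).trace := by
  obtain ⟨v', hv', h'⟩ := h x A
  rw [hv.unique hv', h']

/-- Skew-symmetry is not a field of the structure; it comes from any presentation of a regular
two-form. -/
theorem ω_swap (M : QHDatum I n) (x : M.X.Pt) (v w : M.X.Tangent x) :
    M.ω x w v = -M.ω x v w := by
  obtain ⟨N, a, b, c, h⟩ := M.ω_regular
  rw [h, h, ← Finset.sum_neg_distrib]
  exact Finset.sum_congr rfl fun k _ => by ring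

/-! ### Changing the factors of the group -/

/-- The homomorphism `∏ j, GL_{m j} → ∏ i, GL_{n i}` given by a map of index sets. -/
def pullGL (f : I → J) (hf : ∀ i, n i = m (f i)) (g : GLProd m) : GLProd n :=
  fun i => (Units.mapEquiv (Matrix.reindexAlgEquiv ℂ ℂ (finCongr (hf i).symm)).toMulEquiv) (g (f i))

theorem pullGL_comp (f : I → J) (g : GLProd m) :
    pullGL (n := fun i => m (f i)) f (fun _ => rfl) g = fun i => g (f i) := by
  funext i
  apply Units.ext
  rfl

theorem pullGL_val (f : I → J) (hf : ∀ i, n i = m (f i)) (g : GLProd m) (i : I) :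
    (pullGL f hf g i).val = castMat (hf i).symm (g (f i)).val := rfl

theorem pullGL_inv_val (f : I → J) (hf : ∀ i, n i = m (f i)) (g : GLProd m) (i : I) :
    ((pullGL f hf g i)⁻¹).val = castMat (hf i).symm ((g (f i))⁻¹).val := rfl

theorem pullGL_one (f : I → J) (hf : ∀ i, n i = m (f i)) : pullGL f hf (1 : GLProd m) = 1 := by
  funext i
  exact map_one _

theorem pullGL_mul (f : I → J) (hf : ∀ i, n i = m (f i)) (g g' : GLProd m) :
    pullGL f hf (g * g') = pullGL f hf g * pullGL f hf g' := by
  funext i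
  exact map_mul _ _ _

theorem pullGL_expG (f : I → J) (hf : ∀ i, n i = m (f i))
    (A : ∀ j, Matrix (Fin (m j)) (Fin (m j)) ℂ) :
    pullGL f hf (expG A) = expG fun i => castMat (hf i).symm (A (f i)) := by
  obtain rfl : n = fun i => m (f i) := funext hf
  rw [pullGL_comp]
  rfl

/-- The datum with a new moment map and two-form, and the action pulled back along a map of index
sets. -/
def regroup (M : QHDatum I n) (f : I → J) (hf : ∀ i, n i = m (f i))
    (μ' : ∀ j, Matrix (Fin (m j)) (Fin (m j)) M.X.reg) (μ'_unit : ∀ j, IsUnit (μ' j))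
    (μ'_act : ∀ (g : GLProd m) x j,
      val (M.act (pullGL f hf g) x) (μ' j) = (g j).val * val x (μ' j) * ((g j)⁻¹).val)
    (ω' : M.X.Form) (ω'_regular : ω'.IsRegular)
    (ω'_act : ∀ (g : GLProd n) x (v w : M.X.Tangent x), (∃ g' : GLProd m, g = pullGL f hf g') →
      ω' (M.act g x) ((M.act g).push v) ((M.act g).push w) = ω' x v w) :
    QHDatum J m where
  X := M.X
  affine := M.affine
  act g := M.act (pullGL f hf g)
  act_one x := by rw [pullGL_one, M.act_one]
  act_mul g g' x := by rw [pullGL_mul, M.act_mul]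
  act_regular F hF := by
    have h := M.act_regular F hF
    refine comp_mem_of_adjoin (P := GLProd n × M.X.Pt) (Q := GLProd m × M.X.Pt)
      (φ := fun p => (pullGL f hf p.1, p.2)) ?_ h
    rintro _ ((⟨i, a, b, rfl⟩ | ⟨i, a, b, rfl⟩) | ⟨f', hf', rfl⟩)
    · exact Algebra.subset_adjoin (Or.inl (Or.inl ⟨f i, _, _, rfl⟩))
    · exact Algebra.subset_adjoin (Or.inl (Or.inr ⟨f i, _, _, rfl⟩))
    · exact Algebra.subset_adjoin (Or.inr ⟨f', hf', rfl⟩)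
  μ := μ'
  μ_unit := μ'_unit
  μ_act := μ'_act
  ω := ω'
  ω_regular := ω'_regular
  ω_act g x v w := ω'_act _ x v w ⟨g, rfl⟩

theorem isFundamental_regroup {M : QHDatum I n} {f : I → J} {hf : ∀ i, n i = m (f i)}
    {μ' μ'_unit μ'_act ω' ω'_regular ω'_act}
    {A : ∀ j, Matrix (Fin (m j)) (Fin (m j)) ℂ} {x : M.X.Pt} {v : M.X.Tangent x} :
    (M.regroup f hf μ' μ'_unit μ'_act ω' ω'_regular ω'_act).IsFundamental A v ↔
      M.IsFundamental (fun i => castMat (hf i).symm (A (f i))) v := by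
  refine forall_congr' fun F => ?_
  have h : ∀ t : ℂ, pullGL f hf (expG (t • A)) =
      expG (t • fun i => castMat (hf i).symm (A (f i))) := fun t => by
    rw [pullGL_expG]
    rfl
  simp only [← h]
  rfl

end QHDatum

end FissionVar

end

/-! ### Constant matrices, equivariance of the Maurer-Cartan forms and relabelling -/

noncomputable section

namespace FissionVar

open FunSpace

namespace FunSpace

variable {X : FunSpace} {k l m n : Type}

/-- A constant matrix of regular functions. -/
def constMat (X : FunSpace) (A : Matrix m n ℂ) : Matrix m n X.reg := A.map (algebraMap ℂ X.reg)

theorem val_constMat (x : X.Pt) (A : Matrix m n ℂ) : val x (X.constMat A) = A := rfl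

theorem der_constMat {x : X.Pt} (v : X.Tangent x) (A : Matrix m n ℂ) :
    der v (X.constMat A) = 0 := by
  ext i j
  exact tangent_algebraMap v _

theorem der_of_val_eq [Fintype l] [Fintype m] {x : X.Pt} (v : X.Tangent x)
    {F' : Matrix k n X.reg} {F : Matrix l m X.reg} {P : Matrix k l ℂ} {Q : Matrix m n ℂ}
    (h : ∀ y, val y F' = P * val y F * Q) : der v F' = P * der v F * Q := by
  have e : F' = X.constMat P * F * X.constMat Q :=
    ext_val fun y => by rw [h, val_mul, val_mul, val_constMat, val_constMat]
  rw [e, der_mul, der_mul, der_constMat, der_constMat, Matrix.mul_zero, Matrix.zero_mul, zero_add,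
    add_zero, val_constMat, val_constMat]

end FunSpace

namespace QHDatum

variable {I J : Type} {n : I → ℕ} {m : J → ℕ}

theorem eq_zero_of_castMat {a b : ℕ} (h : a = b) {F : Matrix (Fin a) (Fin a) ℂ}
    (hF : castMat h F = 0) : F = 0 := by subst h; exact hF

theorem pullGL_eq_of_castMat {f : I → J} {hf : ∀ i, n i = m (f i)} {g : GLProd n} {g' : GLProd m}
    (h : ∀ i, (g' (f i)).val = castMat (hf i) (g i).val) : pullGL f hf g' = g := by
  -- Once the equality of sizes is eliminated, all the casts along `hf` become identities.
  obtain rfl : n = fun i => m (f i) := funext hf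
  funext i
  apply Units.ext
  rw [pullGL_comp, h]
  rfl

theorem mcL_act (M : QHDatum I n) (g : GLProd n) (i : I) {x : M.X.Pt} (v : M.X.Tangent x) :
    mcL (M.μ i) ((M.act g).push v) = (g i).val * mcL (M.μ i) v * ((g i)⁻¹).val := by
  have h1 : der ((M.act g).push v) (M.μ i) = (g i).val * der v (M.μ i) * ((g i)⁻¹).val :=
    der_of_val_eq v fun y => M.μ_act g y i
  have h2 : ((g i)⁻¹).val * (g i).val = 1 := Units.inv_mul _
  rw [mcL, h1, M.μ_act, inv_mul_rev, inv_mul_rev, ← Matrix.coe_units_inv, ← Matrix.coe_units_inv,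
    inv_inv, mcL]
  calc _ = (g i).val * (val x (M.μ i))⁻¹ * (((g i)⁻¹).val * (g i).val) * der v (M.μ i) *
        ((g i)⁻¹).val := by noncomm_ring
    _ = _ := by rw [h2]; noncomm_ring

theorem mcR_act (M : QHDatum I n) (g : GLProd n) (i : I) {x : M.X.Pt} (v : M.X.Tangent x) :
    mcR (M.μ i) ((M.act g).push v) = (g i).val * mcR (M.μ i) v * ((g i)⁻¹).val := by
  have h1 : der ((M.act g).push v) (M.μ i) = (g i).val * der v (M.μ i) * ((g i)⁻¹).val :=
    der_of_val_eq v fun y => M.μ_act g y i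
  have h2 : ((g i)⁻¹).val * (g i).val = 1 := Units.inv_mul _
  rw [mcR, h1, M.μ_act, inv_mul_rev, inv_mul_rev, ← Matrix.coe_units_inv, ← Matrix.coe_units_inv,
    inv_inv, mcR]
  calc _ = (g i).val * der v (M.μ i) * (((g i)⁻¹).val * (g i).val) * (val x (M.μ i))⁻¹ *
        ((g i)⁻¹).val := by noncomm_ring
    _ = _ := by rw [h2]; noncomm_ring

section Relabel

variable (M : QHDatum I n) (e : I ≃ J) (he : ∀ i, n i = m (e i))

/-- The moment map after a relabelling of the factors. -/
def relabelμ (j : J) : Matrix (Fin (m j)) (Fin (m j)) M.X.reg :=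
  castMat ((he (e.symm j)).trans (congrArg m (e.apply_symm_apply j))) (M.μ (e.symm j))

theorem relabelμ_apply (i : I) : M.relabelμ e he (e i) = castMat (he i) (M.μ i) := by
  obtain rfl : n = fun i => m (e i) := funext he
  exact castMat_family (m := fun i => m (e i)) M.μ (e.symm_apply_apply i)

/-- Relabelling of the factors of the group. -/
def relabel : QHDatum J m :=
  M.regroup e he (M.relabelμ e he) (fun j => castMat_isUnit _ (M.μ_unit _))
    (fun g x j => by
      obtain ⟨i, rfl⟩ := e.surjective j
      obtain rfl : n = fun i => m (e i) := funext he
      rw [relabelμ_apply]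
      exact M.μ_act _ x i)
    M.ω M.ω_regular (fun g x v w _ => M.ω_act g x v w)

theorem relabel_μ (i : I) : (M.relabel e he).μ (e i) = castMat (he i) (M.μ i) :=
  M.relabelμ_apply e he i

theorem isRelabelling_relabel : M.IsRelabelling e he (M.relabel e he) := by
  refine ⟨Hom.id M.X, Hom.id_isIso _, fun g g' h x => ?_, fun x i => ?_, fun x v w => rfl⟩
  · change M.act g x = M.act (pullGL e he g') x
    rw [pullGL_eq_of_castMat h]
  · exact congrArg (val x) (M.relabel_μ e he i)

theorem chi_castMat {X : FunSpace} {a b : ℕ} (h : a = b) (F : Matrix (Fin a) (Fin a) X.reg)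
    {x : X.Pt} (u v w : X.Tangent x) : chi (castMat h F) u v w = chi F u v w := by
  subst h; rfl

theorem IsQuasiHamiltonian.relabel [Fintype I] [Fintype J] {M : QHDatum I n}
    (hM : M.IsQuasiHamiltonian) : (M.relabel e he).IsQuasiHamiltonian := by
  obtain ⟨h0, h1, h2, h3⟩ := hM
  refine ⟨h0, ?_, ?_, ?_⟩
  · refine Form.HasExtDeriv.congr h1 (fun _ _ _ => rfl) fun x u v w => ?_
    rw [← e.sum_comp]
    congr 1
    refine Finset.sum_congr rfl fun i _ => ?_
    rw [relabel_μ]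
    obtain rfl : n = fun i => m (e i) := funext he
    rfl
  · intro x A
    obtain ⟨v, hv, h⟩ := h2 x fun i => castMat (he i).symm (A (e i))
    refine ⟨v, isFundamental_regroup.2 hv, fun w => (h w).trans ?_⟩
    congr 1
    rw [← e.sum_comp]
    refine Finset.sum_congr rfl fun i _ => ?_
    obtain rfl : n = fun i => m (e i) := funext he
    rw [relabel_μ]
    rfl
  · intro x v hv hμ
    refine h3 x v hv fun i => ?_
    have := hμ (e i)
    rw [relabel_μ] at this
    obtain rfl : n = fun i => m (e i) := funext he
    exact this

end Relabel

/-! ### Fusion -/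

/-- The map of index sets `f` identifies `i₁` and `i₂` and nothing else. -/
structure IsFusionMap (f : I → J) (i₁ i₂ : I) : Prop where
  ne : i₁ ≠ i₂
  eq : f i₂ = f i₁
  surj : Function.Surjective f
  inj : ∀ i i', f i = f i' → i = i' ∨ (i = i₁ ∧ i' = i₂) ∨ (i = i₂ ∧ i' = i₁)

/-- Away from `i₂` the map `f` is a bijection onto `J`. Hence a sum over the new factors is the old
sum with the terms of `i₁` and `i₂` replaced by the one of the fused factor. -/
theorem IsFusionMap.sum_eq {f : I → J} {i₁ i₂ : I} (h : IsFusionMap f i₁ i₂) [Fintype I]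
    [Fintype J] (c : I → ℂ) (c' : J → ℂ) (hc : ∀ i, i ≠ i₁ → i ≠ i₂ → c' (f i) = c i) :
    ∑ j, c' j = ∑ i, c i - c i₁ - c i₂ + c' (f i₁) := by
  classical
  have h1 : ∑ i ∈ Finset.univ.erase i₂, c' (f i) = ∑ j, c' j := by
    refine Finset.sum_nbij f (fun _ _ => Finset.mem_univ _) ?_ ?_ fun _ _ => rfl
    · intro i hi i' hi' hii
      have hi := (Finset.mem_erase.1 hi).1
      have hi' := (Finset.mem_erase.1 hi').1
      rcases h.inj i i' hii with h' | h' | h'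
      · exact h'
      · exact absurd h'.2 hi'
      · exact absurd h'.1 hi
    · intro j _
      obtain ⟨i, rfl⟩ := h.surj j
      by_cases hi : i = i₂
      · exact ⟨i₁, by simp [h.ne], by rw [hi, h.eq]⟩
      · exact ⟨i, by simp [hi], rfl⟩
  have hm : i₁ ∈ Finset.univ.erase i₂ := by simp [h.ne]
  rw [← h1, ← Finset.add_sum_erase _ _ hm,
    ← Finset.add_sum_erase Finset.univ c (Finset.mem_univ i₂), ← Finset.add_sum_erase _ c hm]
  have h2 : ∑ i ∈ (Finset.univ.erase i₂).erase i₁, c' (f i) =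
      ∑ i ∈ (Finset.univ.erase i₂).erase i₁, c i :=
    Finset.sum_congr rfl fun i hi => by
      rw [Finset.mem_erase, Finset.mem_erase] at hi
      exact hc i hi.1 hi.2.1
  rw [h2]
  ring

section Fuse

variable (M : QHDatum I n) (f : I → J) (hf : ∀ i, n i = m (f i)) (i₁ i₂ : I)

open Classical in
/-- The moment map after the fusion of the factors `i₁` and `i₂`. -/
def fuseμ (h : IsFusionMap f i₁ i₂) (j : J) : Matrix (Fin (m j)) (Fin (m j)) M.X.reg :=
  if hj : f i₁ = j then
    castMat (congrArg m hj) (castMat (hf i₁) (M.μ i₁) *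
      castMat ((hf i₂).trans (congrArg m h.eq)) (M.μ i₂))
  else castMat ((hf _).trans (congrArg m (Function.surjInv_eq h.surj j)))
    (M.μ (Function.surjInv h.surj j))

variable {f i₁ i₂} (h : IsFusionMap f i₁ i₂)

theorem fuseμ_fused : M.fuseμ f hf i₁ i₂ h (f i₁) = castMat (hf i₁) (M.μ i₁) *
      castMat ((hf i₂).trans (congrArg m h.eq)) (M.μ i₂) := by
  rw [fuseμ, dif_pos rfl, castMat_rfl]

theorem fuseμ_of_ne {i : I} (hi₁ : i ≠ i₁) (hi₂ : i ≠ i₂) :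
    M.fuseμ f hf i₁ i₂ h (f i) = castMat (hf i) (M.μ i) := by
  have hi : f i₁ ≠ f i := fun hi => by
    rcases h.inj _ _ hi with h' | h' | h'
    · exact hi₁ h'.symm
    · exact hi₂ h'.2
    · exact h.ne h'.1
  rw [fuseμ, dif_neg hi]
  have e : Function.surjInv h.surj (f i) = i := by
    rcases h.inj _ _ (Function.surjInv_eq h.surj (f i)) with h' | h' | h'
    · exact h'
    · exact absurd h'.2 hi₂
    · exact absurd h'.2 hi₁
  obtain rfl : n = fun i => m (f i) := funext hf
  exact castMat_family (m := fun i => m (f i)) M.μ e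

theorem IsFusionMap.cases (h : IsFusionMap f i₁ i₂) {P : J → Prop} (h₁ : P (f i₁)) (h₂ : ∀ i, i ≠ i₁ → i ≠ i₂ → P (f i)) (j : J) :
    P j := by
  obtain ⟨i, rfl⟩ := h.surj j
  by_cases hi₁ : i = i₁
  · rwa [hi₁]
  by_cases hi₂ : i = i₂
  · rwa [hi₂, h.eq]
  exact h₂ i hi₁ hi₂

/-- The fusion term of the two-form. -/
def fuseω : M.X.Form := fun x v w =>
  M.ω x v w - (1 / 2 : ℂ) * wedgeTr (fun u : M.X.Tangent x => castMat (hf i₁) (mcL (M.μ i₁) u))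
        (fun u => castMat ((hf i₂).trans (congrArg m h.eq)) (mcR (M.μ i₂) u)) v w

/-- Fusion of the factors `i₁` and `i₂` of the group. -/
def fuse : QHDatum J m :=
  M.regroup f hf (M.fuseμ f hf i₁ i₂ h)
    (fun j => h.cases (P := fun j => IsUnit (M.fuseμ f hf i₁ i₂ h j))
      (by
        rw [fuseμ_fused]
        exact (castMat_isUnit _ (M.μ_unit i₁)).mul (castMat_isUnit _ (M.μ_unit i₂)))
      (fun i hi₁ hi₂ => by
        rw [fuseμ_of_ne M hf h hi₁ hi₂]
        exact castMat_isUnit _ (M.μ_unit i)) j)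
    (fun g x j => h.cases (P := fun j => val (M.act (pullGL f hf g) x) (M.fuseμ f hf i₁ i₂ h j) =
        (g j).val * val x (M.fuseμ f hf i₁ i₂ h j) * ((g j)⁻¹).val)
      (by
        obtain rfl : n = fun i => m (f i) := funext hf
        rw [fuseμ_fused, val_mul, val_mul, val_castMat, val_castMat, val_castMat, val_castMat,
          M.μ_act, M.μ_act, castMat_mul, castMat_mul, castMat_mul, castMat_mul, pullGL_val,
          pullGL_val, pullGL_inv_val, pullGL_inv_val]
        simp only [castMat_rfl]
        rw [castMat_family (fun j => (g j).val) h.eq, castMat_family (fun j => ((g j)⁻¹).val) h.eq]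
        simp only [Matrix.mul_assoc, Units.inv_mul_cancel_left])
      (fun i hi₁ hi₂ => by
        obtain rfl : n = fun i => m (f i) := funext hf
        rw [fuseμ_of_ne M _ h hi₁ hi₂]
        exact M.μ_act _ x i) j)
    (M.fuseω hf h)
    (by
      refine M.ω_regular.sub (Form.IsRegular.smul _ ?_)
      simp only [← mcL_castMat, ← mcR_castMat]
      exact isRegular_wedgeTr (isRegularMat_mcL (castMat_isUnit _ (M.μ_unit i₁)))
        (isRegularMat_mcR (castMat_isUnit _ (M.μ_unit i₂))))
    (fun g x v w hg => by
      obtain ⟨g, rfl⟩ := hg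
      obtain rfl : n = fun i => m (f i) := funext hf
      rw [fuseω, fuseω, M.ω_act]
      congr 2
      refine wedgeTr_conj (P := ((g (f i₁))⁻¹).val) (Q := (g (f i₁)).val) (Units.inv_mul _)
        ?_ ?_ ?_ ?_
      · exact M.mcL_act _ i₁ v
      · exact M.mcL_act _ i₁ w
      · rw [M.mcR_act _ i₂ v, castMat_mul, castMat_mul, pullGL_val, pullGL_inv_val, castMat_rfl,
          castMat_rfl, castMat_family (fun j => (g j).val) h.eq,
          castMat_family (fun j => ((g j)⁻¹).val) h.eq]
      · rw [M.mcR_act _ i₂ w, castMat_mul, castMat_mul, pullGL_val, pullGL_inv_val, castMat_rfl,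
          castMat_rfl, castMat_family (fun j => (g j).val) h.eq,
          castMat_family (fun j => ((g j)⁻¹).val) h.eq])

theorem isFusion_fuse : M.IsFusion f hf i₁ i₂ (M.fuse hf h) := by
  refine ⟨h.ne, h.eq, h.surj, h.inj, Hom.id M.X, Hom.id_isIso _, fun g g' hg x => ?_,
    fun x i hi₁ hi₂ => ?_, fun x => ?_, fun x v w => rfl⟩
  · change M.act g x = M.act (pullGL f hf g') x
    rw [pullGL_eq_of_castMat hg]
  · exact congrArg (val x) (M.fuseμ_of_ne hf h hi₁ hi₂)
  · exact (congrArg (val x) (M.fuseμ_fused hf h)).trans (val_mul _ _ _)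

end Fuse

/-! ### Fusion of quasi-Hamiltonian spaces -/

section FusionLocal

variable {X : FunSpace} {k : Type} [Fintype k] [DecidableEq k] {F G : Matrix k k X.reg} {x : X.Pt}

theorem mcL_of_der {F : Matrix k k X.reg} (hF : IsUnit F) {A : Matrix k k ℂ} {v : X.Tangent x}
    (h : der v F = val x F * A - A * val x F) :
    mcL F v = A - (val x F)⁻¹ * A * val x F := by
  have h1 := isUnit_inv_mul (isUnit_val hF x)
  rw [mcL, h, Matrix.mul_sub, ← Matrix.mul_assoc, h1, Matrix.one_mul, ← Matrix.mul_assoc]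

theorem mcR_of_der {F : Matrix k k X.reg} (hF : IsUnit F) {A : Matrix k k ℂ} {v : X.Tangent x}
    (h : der v F = val x F * A - A * val x F) :
    mcR F v = val x F * A * (val x F)⁻¹ - A := by
  have h1 := isUnit_mul_inv (isUnit_val hF x)
  rw [mcR, h, Matrix.sub_mul, Matrix.mul_assoc A, h1, Matrix.mul_one]

/-- The core of (QH2) for a fusion. Along the fundamental field of `A`, the defect of additivity of
`(θ + θ̄, A)` on a product is exactly the contraction of the fusion term. -/
theorem trace_mc_mul (hF : IsUnit F) (hG : IsUnit G) {A : Matrix k k ℂ} {v : X.Tangent x}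
    (hvF : der v F = val x F * A - A * val x F) (hvG : der v G = val x G * A - A * val x G)
    (w : X.Tangent x) :
    ((mcL (F * G) w + mcR (F * G) w) * A).trace =
      ((mcL F w + mcR F w) * A).trace + ((mcL G w + mcR G w) * A).trace -
        wedgeTr (fun u : X.Tangent x => mcL F u) (fun u => mcR G u) v w := by
  have hc : ∀ P Q R : Matrix k k ℂ, (P * Q * R).trace = (R * P * Q).trace :=
    fun P Q R => Matrix.trace_mul_cycle P Q R
  rw [mcL_mul w hF hG, mcR_mul w hF hG, mcR_eq w hF, mcL_eq w hG, wedgeTr,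
    mcL_of_der hF hvF, mcR_of_der hG hvG]
  simp only [Matrix.add_mul, Matrix.mul_add, Matrix.sub_mul, Matrix.mul_sub, Matrix.trace_add,
    Matrix.trace_sub]
  have e1 : ((val x G)⁻¹ * mcL F w * val x G * A).trace =
      (mcL F w * (val x G * A * (val x G)⁻¹)).trace := by
    rw [Matrix.mul_assoc, hc, ← Matrix.mul_assoc, hc]
  have e2 : (val x F * mcR G w * (val x F)⁻¹ * A).trace =
      ((val x F)⁻¹ * A * val x F * mcR G w).trace := by
    rw [Matrix.mul_assoc, Matrix.mul_assoc, Matrix.trace_mul_comm]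
    simp only [Matrix.mul_assoc]
    rw [Matrix.trace_mul_comm]
    simp only [Matrix.mul_assoc]
  rw [e1, e2, Matrix.trace_mul_comm A (mcR G w)]
  ring

/-- The core of (QH3) for a fusion. The hypothesis `h` is the vanishing of the fused form against
the fundamental field of `B` in the first factor only. Since `F * G` is stationary along `v`, `mcL F
v = -mcR G v`, and the condition collapses to `-2 Tr(mcR G v * B) = 0` for every `B`. -/
theorem mcR_eq_zero_of_fusion (hF : IsUnit F) (hG : IsUnit G) {v : X.Tangent x}
    (hv : der v (F * G) = 0)
    (h : ∀ B : Matrix k k ℂ, ((mcL F v + mcR F v) * B).trace +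
      (mcL F v * 0 - (B - (val x F)⁻¹ * B * val x F) * mcR G v).trace = 0) : mcR G v = 0 := by
  have h1 := mcL_mul v hF hG
  rw [mcL, hv, Matrix.mul_zero] at h1
  have hg := isUnit_mul_inv (isUnit_val hG x)
  have hL : mcL F v = -mcR G v := by
    have h2 : val x G * ((val x G)⁻¹ * (mcL F v + mcR G v) * val x G) * (val x G)⁻¹ =
        mcL F v + mcR G v := by
      calc _ = (val x G * (val x G)⁻¹) * (mcL F v + mcR G v) * (val x G * (val x G)⁻¹) := by
            noncomm_ring
        _ = _ := by rw [hg, Matrix.one_mul, Matrix.mul_one]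
    rw [← h1, Matrix.mul_zero, Matrix.zero_mul] at h2
    exact eq_neg_of_add_eq_zero_left h2.symm
  refine Matrix.ext_iff_trace_mul_right.2 fun B => ?_
  have hB := h B
  rw [mcR_eq v hF, hL] at hB
  have hc : ((val x F)⁻¹ * B * val x F * mcR G v).trace =
      (val x F * mcR G v * (val x F)⁻¹ * B).trace := by
    rw [Matrix.mul_assoc, Matrix.trace_mul_comm]
    simp only [Matrix.mul_assoc]
  simp only [Matrix.add_mul, Matrix.neg_mul, Matrix.mul_neg, Matrix.sub_mul, Matrix.mul_zero,
    Matrix.trace_add, Matrix.trace_sub, Matrix.trace_neg, Matrix.trace_zero, hc,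
    Matrix.trace_mul_comm B (mcR G v)] at hB
  rw [Matrix.zero_mul, Matrix.trace_zero]
  linear_combination (-1 / 2 : ℂ) * hB

end FusionLocal

/-- The variety is unchanged, so smoothness is inherited. The axioms follow from
`hasExtDeriv_fusion`, `trace_mc_mul` and `mcR_eq_zero_of_fusion`. In (QH3) the last of these shows
that the two old moment maps are separately stationary, whence the fusion term disappears and the
old axiom applies. -/
theorem IsQuasiHamiltonian.fuse [Fintype I] [Fintype J] {M : QHDatum I n} {f : I → J}
    (hf : ∀ i, n i = m (f i)) {i₁ i₂ : I} (h : IsFusionMap f i₁ i₂)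
    (hM : M.IsQuasiHamiltonian) : (M.fuse hf h).IsQuasiHamiltonian := by
  classical
  obtain ⟨h0, h1, h2, h3⟩ := hM
  obtain rfl : n = fun i => m (f i) := funext hf
  have hμ : ∀ i, i ≠ i₁ → i ≠ i₂ → M.fuseμ f hf i₁ i₂ h (f i) = M.μ i := fun i => M.fuseμ_of_ne hf h
  have hμ' : M.fuseμ f hf i₁ i₂ h (f i₁) = M.μ i₁ * castMat (congrArg m h.eq) (M.μ i₂) :=
    M.fuseμ_fused hf h
  have hF := M.μ_unit i₁
  have hG : IsUnit (castMat (congrArg m h.eq) (M.μ i₂)) := castMat_isUnit _ (M.μ_unit i₂)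
  have hω : ∀ x (v w : M.X.Tangent x), M.fuseω hf h x v w = M.ω x v w -
      (1 / 2 : ℂ) * wedgeTr (fun u : M.X.Tangent x => mcL (M.μ i₁) u)
        (fun u => mcR (castMat (congrArg m h.eq) (M.μ i₂)) u) v w := by
    intro x v w
    simp only [mcR_castMat]
    rfl
  refine ⟨h0, ?_, ?_, ?_⟩
  · refine Form.HasExtDeriv.congr (X := M.X) (h1.add (hasExtDeriv_fusion hF hG))
      (fun x v w => (hω x v w).trans (by ring)) fun (x : M.X.Pt) (u v w : M.X.Tangent x) => ?_
    have := h.sum_eq (fun i => chi (M.μ i) u v w) (fun j => chi (M.fuseμ f hf i₁ i₂ h j) u v w)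
      (fun i hi₁ hi₂ => by rw [hμ i hi₁ hi₂])
    simp only [chi, ← Finset.mul_sum] at this
    refine this.trans ?_
    rw [hμ', chi_castMat, chi, chi, chi]
    ring
  · intro (x : M.X.Pt) A
    obtain ⟨v, hv⟩ := M.exists_fundamental (fun i => A (f i)) x
    refine ⟨v, isFundamental_regroup.2 hv, fun (w : M.X.Tangent x) => ?_⟩
    change M.fuseω hf h x v w = _
    have := h.sum_eq (fun i => ((mcL (M.μ i) w + mcR (M.μ i) w) * A (f i)).trace)
      (fun j => ((mcL (M.fuseμ f hf i₁ i₂ h j) w + mcR (M.fuseμ f hf i₁ i₂ h j) w) * A j).trace)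
      (fun i hi₁ hi₂ => by rw [hμ i hi₁ hi₂])
    refine Eq.trans ?_ (congrArg ((1 / 2 : ℂ) * ·) this.symm)
    have hvF := hv.der_μ i₁
    have hvG : der v (castMat (congrArg m h.eq) (M.μ i₂)) =
        val x (castMat (congrArg m h.eq) (M.μ i₂)) * A (f i₁) -
          A (f i₁) * val x (castMat (congrArg m h.eq) (M.μ i₂)) := by
      rw [der_castMat, hv.der_μ i₂, ← castMat_family A h.eq, val_castMat, ← castMat_mul,
        ← castMat_mul]
      rfl
    have h4 : ((mcL (M.μ i₂) w + mcR (M.μ i₂) w) * A (f i₂)).trace =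
        ((mcL (castMat (congrArg m h.eq) (M.μ i₂)) w +
          mcR (castMat (congrArg m h.eq) (M.μ i₂)) w) * A (f i₁)).trace := by
      rw [mcL_castMat, mcR_castMat, ← castMat_family A h.eq,
        ← castMat_trace (congrArg m h.eq), castMat_mul]
      rfl
    rw [hω, h2.eq hv w, hμ', trace_mc_mul hF hG hvF hvG w, h4]
    ring
  · intro (x : M.X.Pt) (v : M.X.Tangent x) (hv : ∀ w : M.X.Tangent x, M.fuseω hf h x v w = 0)
      (hdv : ∀ j, der v (M.fuseμ f hf i₁ i₂ h j) = 0)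
    have hz : mcR (castMat (congrArg m h.eq) (M.μ i₂)) v = 0 := by
      refine mcR_eq_zero_of_fusion hF hG (by rw [← hμ']; exact hdv (f i₁)) fun B => ?_
      -- The test vector moves only the factor `i₁`, not the diagonal of the fused pair; the second
      -- moment map is stationary along it.
      obtain ⟨w, hw⟩ := M.exists_fundamental (Function.update 0 i₁ B) x
      have e1 := hv w
      have hwF := hw.der_μ i₁
      rw [Function.update_self] at hwF
      have hwG : mcR (castMat (congrArg m h.eq) (M.μ i₂)) w = 0 := by
        have := hw.der_μ i₂
        rw [Function.update_of_ne h.ne.symm, Pi.zero_apply, Matrix.mul_zero, Matrix.zero_mul,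
          sub_zero] at this
        rw [mcR_castMat, mcR, this, Matrix.zero_mul]
        rfl
      rw [hω, M.ω_swap, h2.eq hw v, Finset.sum_eq_single i₁
        (fun i _ hi => by rw [Function.update_of_ne hi, Pi.zero_apply, Matrix.mul_zero,
          Matrix.trace_zero])
        (fun hi => absurd (Finset.mem_univ _) hi), Function.update_self, wedgeTr, hwG,
        mcL_of_der hF hwF, ← Matrix.trace_sub] at e1
      linear_combination (-2 : ℂ) * e1
    have hG0 : der v (castMat (congrArg m h.eq) (M.μ i₂)) = 0 := by
      rw [der_eq_mcR_mul v hG, hz, Matrix.zero_mul]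
    have hF0 : der v (M.μ i₁) = 0 := by
      have e := hdv (f i₁)
      rw [hμ', der_mul, hG0, Matrix.mul_zero, zero_add] at e
      have e' := congrArg (· * (val x (castMat (congrArg m h.eq) (M.μ i₂)))⁻¹) e
      simpa only [Matrix.mul_assoc, isUnit_mul_inv (isUnit_val hG x), Matrix.mul_one,
        Matrix.zero_mul] using e'
    refine h3 x v (fun w => ?_) fun i => ?_
    · have e1 := hv w
      rw [hω, wedgeTr, hz, mcL, hF0] at e1
      simpa using e1
    · by_cases hi₁ : i = i₁
      · rw [hi₁, hF0]
      by_cases hi₂ : i = i₂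
      · rw [hi₂]
        exact eq_zero_of_castMat _ hG0
      · rw [← hμ i hi₁ hi₂]
        exact hdv (f i)

end QHDatum

end FissionVar

end

noncomputable section

namespace FissionVar

namespace FunSpace

/-! ### Finite products of varieties -/

/-- Tangent vectors at propositionally equal points have different types, so they are compared
through their underlying linear functionals. -/
theorem Form.congr_point {X : FunSpace} (ω : X.Form) {x x' : X.Pt} (h : x = x')
    {v w : X.Tangent x} {v' w' : X.Tangent x'} (hv : v.1 = v'.1) (hw : w.1 = w'.1) :
    ω x v w = ω x' v' w' := by
  subst h
  rw [Subtype.ext hv, Subtype.ext hw]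

section Pi

variable {A : Type}

/-- The product of a family of varieties. -/
def pi (X : A → FunSpace) : FunSpace where
  Pt := ∀ a, (X a).Pt
  reg := Algebra.adjoin ℂ {F | ∃ a, ∃ f ∈ (X a).reg, F = fun x => f (x a)}

/-- The projections of a product. -/
def proj (X : A → FunSpace) (a : A) : Hom (pi X) (X a) where
  toFun x := x a
  regular f hf := by
    have h : (fun x : ∀ a, (X a).Pt => f (x a)) ∈ Algebra.adjoin ℂ
        {F : (∀ a, (X a).Pt) → ℂ | ∃ a, ∃ f ∈ (X a).reg, F = fun x => f (x a)} :=
      Algebra.subset_adjoin ⟨a, f, hf, rfl⟩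
    exact h

variable (X : A → FunSpace)

theorem pi_reg_eq {s : ∀ a, Set ((X a).Pt → ℂ)} (hs : ∀ a, (X a).reg = Algebra.adjoin ℂ (s a)) :
    (pi X).reg = Algebra.adjoin ℂ (⋃ a, (fun f (x : (pi X).Pt) => f (x a)) '' s a) := by
  refine le_antisymm (Algebra.adjoin_le ?_) (Algebra.adjoin_le ?_)
  · rintro _ ⟨a, f, hf, rfl⟩
    rw [hs] at hf
    refine comp_mem_of_adjoin (Q := (pi X).Pt) (φ := fun x => x a) (fun f hf => ?_) hf
    have hm : (fun x : (pi X).Pt => f (x a)) ∈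
        ⋃ a, (fun f (x : (pi X).Pt) => f (x a)) '' s a := Set.mem_iUnion.2 ⟨a, f, hf, rfl⟩
    exact Algebra.subset_adjoin hm
  · intro F hF
    obtain ⟨a, f, hf, rfl⟩ := Set.mem_iUnion.1 hF
    refine (proj X a).regular f ?_
    rw [hs]
    exact Algebra.subset_adjoin hf

theorem isAffine_pi [Finite A] (h : ∀ a, (X a).IsAffine) : (pi X).IsAffine := by
  choose s hs hs' using fun a => Subalgebra.fg_def.1 (h a).1
  refine isAffine_of_adjoin (Set.finite_iUnion fun a => (hs a).image _)
    (pi_reg_eq X fun a => (hs' a).symm) (fun x y hxy => ?_) fun χ => ?_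
  · funext a
    obtain ⟨z, -, hz⟩ := (h a).2 ((X a).evalAt (x a))
    rw [hz (x a) rfl, hz (y a)]
    refine algHom_ext_of_adjoin (hs' a).symm fun f hf => ?_
    exact hxy _ (Set.mem_iUnion.2 ⟨a, f.1, hf, rfl⟩)
  · choose x hx _ using fun a => (h a).2 (χ.comp (proj X a).pull)
    refine ⟨x, fun F hF => ?_⟩
    obtain ⟨a, f, hf, e⟩ := Set.mem_iUnion.1 hF
    have hf' : f ∈ (X a).reg := hs' a ▸ Algebra.subset_adjoin hf
    have e' : F = (proj X a).pull ⟨f, hf'⟩ := Subtype.ext e.symm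
    rw [e']
    exact DFunLike.congr_fun (hx a) ⟨f, hf'⟩

theorem isBasicOpen_pi [Fintype A] {σ : A → Type} {f : ∀ a, MvPolynomial (σ a) ℂ}
    {c : ∀ a, σ a → (X a).reg} (h : ∀ a, IsBasicOpen (X a) (f a) (c a)) :
    IsBasicOpen (pi X) (∏ a, MvPolynomial.rename (Sigma.mk a) (f a))
      (fun p : Σ a, σ a => (proj X p.1).pull (c p.1 p.2)) := by
  classical
  have hr : ∀ a (g : MvPolynomial (σ a) ℂ),
      MvPolynomial.aeval (fun p : Σ a, σ a => (proj X p.1).pull (c p.1 p.2))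
        (MvPolynomial.rename (Sigma.mk a) g) = (proj X a).pull (MvPolynomial.aeval (c a) g) := by
    intro a g
    rw [MvPolynomial.aeval_rename]
    have := MvPolynomial.comp_aeval (c a) (proj X a).pull
    exact (DFunLike.congr_fun this g).symm
  have hf : MvPolynomial.aeval (fun p : Σ a, σ a => (proj X p.1).pull (c p.1 p.2))
      (∏ a, MvPolynomial.rename (Sigma.mk a) (f a)) =
      ∏ a, (proj X a).pull (MvPolynomial.aeval (c a) (f a)) := by
    rw [map_prod]
    exact Finset.prod_congr rfl fun a _ => hr a (f a)
  refine ⟨fun x y hxy => ?_, fun p hp => ?_, ?_, ?_⟩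
  · funext a
    exact (h a).inj _ _ fun s => hxy ⟨a, s⟩
  · rw [map_prod, Finset.prod_ne_zero_iff] at hp
    have : ∀ a, ∃ x : (X a).Pt, ∀ s, (c a s).1 x = p ⟨a, s⟩ := fun a => by
      refine (h a).surj (fun s => p ⟨a, s⟩) ?_
      have := hp a (Finset.mem_univ a)
      rwa [MvPolynomial.eval_rename] at this
    choose x hx using this
    exact ⟨x, fun q => hx q.1 q.2⟩
  · rw [hf]
    have hu : ∀ a, IsUnit ((proj X a).pull (MvPolynomial.aeval (c a) (f a))) :=
      fun a => (h a).unit.map _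
    exact Finset.prod_induction _ IsUnit (fun _ _ => IsUnit.mul) isUnit_one fun a _ => hu a
  · refine gen_of_adjoin rfl ?_
    rintro ⟨_, hF⟩ ⟨a, F, hF', rfl⟩
    obtain ⟨g, k, e⟩ := (h a).gen ⟨F, hF'⟩
    -- The denominator is now the product of all the `f b`, so the numerator from the factor `a` is
    -- multiplied by the matching power of the other ones.
    refine ⟨MvPolynomial.rename (Sigma.mk a) g *
      (∏ b ∈ Finset.univ.erase a, MvPolynomial.rename (Sigma.mk b) (f b)) ^ k, k, ?_⟩
    change (proj X a).pull ⟨F, hF'⟩ * _ = _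
    rw [hf, map_mul, hr, ← e, map_pow, map_prod, map_mul, map_pow,
      ← Finset.mul_prod_erase _ _ (Finset.mem_univ a), mul_pow, ← mul_assoc]
    congr 2
    exact Finset.prod_congr rfl fun b _ => (hr b (f b)).symm

variable {X}

open Classical in
/-- The point of a product with one coordinate replaced. -/
def replaceAt (x : (pi X).Pt) (a : A) (y : (X a).Pt) : (pi X).Pt :=
  fun b => if h : b = a then h ▸ y else x b

theorem replaceAt_self (x : (pi X).Pt) (a : A) (y : (X a).Pt) : replaceAt x a y a = y := by
  simp [replaceAt]

theorem replaceAt_of_ne (x : (pi X).Pt) {a b : A} (h : b ≠ a) (y : (X a).Pt) :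
    replaceAt x a y b = x b := by
  simp [replaceAt, h]

/-- The inclusion of a factor through a given point of a product. -/
def slice (x : (pi X).Pt) (a : A) : Hom (X a) (pi X) where
  toFun := replaceAt x a
  regular f hf := by
    refine comp_mem_of_adjoin (P := (pi X).Pt) ?_ hf
    rintro _ ⟨b, f, hf, rfl⟩
    by_cases hb : b = a
    · subst hb
      convert hf using 1
      funext y
      exact congrArg f (replaceAt_self x b y)
    · convert (X a).reg.algebraMap_mem (f (x b)) using 1
      funext y
      exact congrArg f (replaceAt_of_ne x hb y)

theorem slice_apply (x : (pi X).Pt) (a : A) : slice x a (x a) = x := by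
  funext b
  by_cases hb : b = a
  · subst hb
    exact replaceAt_self x b (x b)
  · exact replaceAt_of_ne x hb (x a)

/-- The vector is pushed forward along the inclusion of the factor through `x`; the other
projections are constant on this slice. -/
theorem exists_tangent_pi (x : (pi X).Pt) (a : A) (w : (X a).Tangent (x a)) :
    ∃ w' : (pi X).Tangent x, (proj X a).push w' = w ∧ ∀ b, b ≠ a → (proj X b).push w' = 0 := by
  classical
  refine ⟨⟨w.1.comp (slice x a).pull.toLinearMap, fun f g => ?_⟩, ?_, fun b hb => ?_⟩
  · have h := w.2 ((slice x a).pull f) ((slice x a).pull g)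
    rw [← map_mul] at h
    refine h.trans ?_
    change f.1 (slice x a (x a)) * _ + g.1 (slice x a (x a)) * _ = _
    rw [slice_apply]
    rfl
  · apply Subtype.ext
    apply LinearMap.ext
    intro f
    change w.1 ((slice x a).pull ((proj X a).pull f)) = w.1 f
    congr 1
    apply Subtype.ext
    funext y
    exact congrArg f.1 (replaceAt_self x a y)
  · apply Subtype.ext
    apply LinearMap.ext
    intro f
    change w.1 ((slice x a).pull ((proj X b).pull f)) = 0
    have e : (slice x a).pull ((proj X b).pull f) = algebraMap ℂ (X a).reg (f.1 (x b)) := by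
      apply Subtype.ext
      funext y
      exact congrArg f.1 (replaceAt_of_ne x hb y)
    rw [e, tangent_algebraMap]

theorem tangent_pi_ext {x : (pi X).Pt} {v w : (pi X).Tangent x}
    (h : ∀ a, (proj X a).push v = (proj X a).push w) : v = w := by
  refine tangent_ext_of_adjoin rfl ?_
  rintro ⟨_, hF⟩ ⟨a, f, hf, rfl⟩
  exact DFunLike.congr_fun (congrArg Subtype.val (h a)) ⟨f, hf⟩

end Pi

end FunSpace

open FunSpace

/-! ### Finite products of quasi-Hamiltonian data -/

section RegGLProd

variable {I : Type} (n : I → ℕ) (X : FunSpace)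

theorem regGLProd_val (i : I) (a b : Fin (n i)) :
    (fun p : GLProd n × X.Pt => (p.1 i).val a b) ∈ regGLProd n X :=
  Algebra.subset_adjoin (Or.inl (Or.inl ⟨i, a, b, rfl⟩))

theorem regGLProd_inv_val (i : I) (a b : Fin (n i)) :
    (fun p : GLProd n × X.Pt => ((p.1 i)⁻¹).val a b) ∈ regGLProd n X :=
  Algebra.subset_adjoin (Or.inl (Or.inr ⟨i, a, b, rfl⟩))

theorem regGLProd_comp_snd {f : X.Pt → ℂ} (hf : f ∈ X.reg) :
    (fun p : GLProd n × X.Pt => f p.2) ∈ regGLProd n X :=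
  Algebra.subset_adjoin (Or.inr ⟨f, hf, rfl⟩)

end RegGLProd

namespace QHDatum

variable {A : Type} {I : A → Type} {n : ∀ a, I a → ℕ}

theorem ω_zero_right {I : Type} {n : I → ℕ} (M : QHDatum I n) (x : M.X.Pt) (v : M.X.Tangent x) :
    M.ω x v 0 = 0 := by
  obtain ⟨N, a, b, c, h⟩ := M.ω_regular
  rw [h]
  refine Finset.sum_eq_zero fun k _ => ?_
  have h0 : ∀ f : M.X.reg, (0 : M.X.Tangent x).1 f = 0 := fun _ => rfl
  rw [h0, h0, mul_zero, zero_mul, sub_zero, mul_zero]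

variable [Fintype A] (M : ∀ a, QHDatum (I a) (n a))

/-- The product of a finite family of data. -/
def pi : QHDatum (Σ a, I a) (fun p => n p.1 p.2) where
  X := FunSpace.pi fun a => (M a).X
  affine := isAffine_pi _ fun a => (M a).affine
  act g :=
    { toFun := fun x a => (M a).act (fun i => g ⟨a, i⟩) (x a)
      regular := fun f hf => by
        refine comp_mem_of_adjoin (P := (FunSpace.pi fun a => (M a).X).Pt) ?_ hf
        rintro _ ⟨a, f, hf, rfl⟩
        exact (proj (fun a => (M a).X) a).regular _ (((M a).act (fun i => g ⟨a, i⟩)).regular f hf) }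
  act_one x := funext fun a => (M a).act_one (x a)
  act_mul g g' x := funext fun a => (M a).act_mul (fun i => g ⟨a, i⟩) (fun i => g' ⟨a, i⟩) (x a)
  act_regular f hf := by
    refine comp_mem_of_adjoin (P := (FunSpace.pi fun a => (M a).X).Pt)
      (φ := fun p : GLProd (fun p : Σ a, I a => n p.1 p.2) × (FunSpace.pi fun a => (M a).X).Pt =>
        fun a => (M a).act (fun i => p.1 ⟨a, i⟩) (p.2 a)) ?_ hf
    rintro _ ⟨a, f, hf, rfl⟩
    refine comp_mem_of_adjoin (P := GLProd (n a) × (M a).X.Pt)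
      (φ := fun p : GLProd (fun p : Σ a, I a => n p.1 p.2) × (FunSpace.pi fun a => (M a).X).Pt =>
        (fun i => p.1 ⟨a, i⟩, p.2 a)) ?_ ((M a).act_regular f hf)
    rintro _ ((⟨i, b, c, rfl⟩ | ⟨i, b, c, rfl⟩) | ⟨f', hf', rfl⟩)
    · exact regGLProd_val (fun p : Σ a, I a => n p.1 p.2) _ (Sigma.mk a i) b c
    · exact regGLProd_inv_val (fun p : Σ a, I a => n p.1 p.2) _ (Sigma.mk a i) b c
    · exact regGLProd_comp_snd (fun p : Σ a, I a => n p.1 p.2) _ ((proj (fun a => (M a).X) a).regular f' hf')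
  μ p := ((M p.1).μ p.2).map (proj (fun a => (M a).X) p.1).pull
  μ_unit p := ((M p.1).μ_unit p.2).map (proj (fun a => (M a).X) p.1).pull.mapMatrix
  μ_act g x p := (M p.1).μ_act (fun i => g ⟨p.1, i⟩) (x p.1) p.2
  ω x v w := ∑ a, (M a).ω (x a) ((proj (fun a => (M a).X) a).push v)
    ((proj (fun a => (M a).X) a).push w)
  ω_regular := Form.IsRegular.sum _ fun a => by
    obtain ⟨η, h⟩ := (M a).ω_regular.exists_hasExtDeriv
    exact (h.pullback (proj (fun a => (M a).X) a)).isRegular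
  ω_act g x v w := Finset.sum_congr rfl fun a _ =>
    (M a).ω_act (fun i => g ⟨a, i⟩) (x a) ((proj (fun a => (M a).X) a).push v)
    ((proj (fun a => (M a).X) a).push w)

variable {M}

theorem IsFundamental.pi {B : ∀ p : Σ a, I a, Matrix (Fin (n p.1 p.2)) (Fin (n p.1 p.2)) ℂ}
    {x : (pi M).X.Pt} {v : (pi M).X.Tangent x} (h : (pi M).IsFundamental B v) (a : A) :
    (M a).IsFundamental (fun i => B ⟨a, i⟩) (x := x a) ((proj (fun a => (M a).X) a).push v) :=
  fun f => h ((proj (fun a => (M a).X) a).pull f)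

/-- Smoothness is a hypothesis, to be supplied by a description of the product as a basic open set.
Nondegeneracy is tested one factor at a time, with tangent vectors of that factor extended by zero.
-/
theorem isQuasiHamiltonian_pi [∀ a, Fintype (I a)] (hs : Algebra.Smooth ℂ (pi M).X.reg)
    (hM : ∀ a, (M a).IsQuasiHamiltonian) : (pi M).IsQuasiHamiltonian := by
  refine ⟨hs, ?_, ?_, ?_⟩
  · refine (Form.HasExtDeriv.sum Finset.univ fun a =>
      (hM a).2.1.pullback (proj (fun a => (M a).X) a)).congr (fun _ _ _ => rfl) fun x u v w => ?_
    rw [Fintype.sum_sigma, Finset.mul_sum]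
    rfl
  · intro x B
    obtain ⟨v, hv⟩ := (pi M).exists_fundamental B x
    refine ⟨v, hv, fun w => ?_⟩
    rw [Fintype.sum_sigma, Finset.mul_sum]
    exact Finset.sum_congr rfl fun a _ =>
      (hM a).2.2.1.eq (hv.pi a) ((proj (fun a => (M a).X) a).push w)
  · intro x v hv hμ
    refine tangent_pi_ext fun a => ?_
    refine (hM a).2.2.2 (x a) _ (fun w => ?_) fun i => hμ ⟨a, i⟩
    obtain ⟨w', hw, hw'⟩ := exists_tangent_pi x a w
    have h := hv w'
    have h' : ∑ b, (M b).ω (x b) ((proj (fun a => (M a).X) b).push v)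
        ((proj (fun a => (M a).X) b).push w') = 0 := h
    rw [Finset.sum_eq_single a (fun b _ hb => by rw [hw' b hb]; exact ω_zero_right _ _ _)
      (fun ha => absurd (Finset.mem_univ a) ha), hw] at h'
    exact h'

end QHDatum

end FissionVar

end

noncomputable section

namespace FissionVar

open FunSpace

/-! ### The one-point spaces -/

/-- The one-point variety. -/
def onePt : FunSpace where
  Pt := Unit
  reg := Algebra.adjoin ℂ ∅

theorem onePt_isAffine : onePt.IsAffine :=
  isAffine_of_adjoin (X := onePt) Set.finite_empty rfl (fun _ _ _ => rfl)
    fun _ => ⟨(), fun _ hf => absurd hf (Set.notMem_empty _)⟩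

theorem onePt_isBasicOpen : IsBasicOpen onePt (σ := Empty) 1 (fun _ => 0) where
  inj _ _ _ := rfl
  surj _ _ := ⟨(), fun s => s.elim⟩
  unit := by rw [map_one]; exact isUnit_one
  gen := gen_of_adjoin (X := onePt) rfl fun _ hF => absurd hF (Set.notMem_empty _)

theorem onePt_tangent_eq_zero {x : onePt.Pt} (v : onePt.Tangent x) : v = 0 :=
  tangent_ext_of_adjoin (X := onePt) rfl fun _ hf => absurd hf (Set.notMem_empty _)

/-- The scalar matrix `c`. -/
def scalarGL (m : ℕ) (c : ℂˣ) : GL (Fin m) ℂ :=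
  Units.map (algebraMap ℂ (Matrix (Fin m) (Fin m) ℂ)).toMonoidHom c

theorem scalarGL_comm (m : ℕ) (c : ℂˣ) (A : Matrix (Fin m) (Fin m) ℂ) :
    A * (scalarGL m c).val = (scalarGL m c).val * A :=
  (Algebra.commutes (c : ℂ) A).symm

namespace QHDatum

/-- The conjugacy class of a scalar matrix. -/
def scalarClass (m : ℕ) (c : ℂˣ) : QHDatum Unit (fun _ => m) where
  X := onePt
  affine := onePt_isAffine
  act _ := Hom.id onePt
  act_one _ := rfl
  act_mul _ _ _ := rfl
  act_regular _ hf := regGLProd_comp_snd _ _ hf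
  μ _ := onePt.constMat (scalarGL m c).val
  μ_unit _ := (scalarGL m c).isUnit.map (algebraMap ℂ onePt.reg).mapMatrix
  μ_act g x i := by
    rw [val_constMat, val_constMat, scalarGL_comm, Matrix.mul_assoc, Units.mul_inv,
      Matrix.mul_one]
  ω _ _ _ := 0
  ω_regular := Form.hasExtDeriv_zero.isRegular
  ω_act _ _ _ _ := rfl

/-- A scalar is central, so its class is one point, and the prescribed form vanishes because `Tr(AB)
= Tr(BA)`. -/
theorem isConjugacyClass_scalarClass (m : ℕ) (c : ℂˣ) :
    (scalarClass m c).IsConjugacyClass (scalarGL m c) := by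
  have hk : ∀ k : GL (Fin m) ℂ, k.val * (scalarGL m c).val * (k⁻¹).val = (scalarGL m c).val :=
    fun k => by rw [scalarGL_comm, Matrix.mul_assoc, Units.mul_inv, Matrix.mul_one]
  refine ⟨fun _ _ _ => rfl, fun g => ⟨?_, ?_⟩, ?_, ?_⟩
  · rintro ⟨x, rfl⟩
    exact ⟨1, (hk 1).symm⟩
  · rintro ⟨k, rfl⟩
    exact ⟨(), (hk k).symm⟩
  · refine eq_top_iff.2 fun f _ => ?_
    have : f = algebraMap ℂ onePt.reg (f.1 ()) := rfl
    rw [this]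
    exact Subalgebra.algebraMap_mem _ _
  · intro x A B v w _ _
    change (0 : ℂ) = (1 / 2 : ℂ) *
      ((A () * ((scalarGL m c).val * B () * (scalarGL m c).val⁻¹)).trace -
        (B () * ((scalarGL m c).val * A () * (scalarGL m c).val⁻¹)).trace)
    rw [← scalarGL_comm, ← scalarGL_comm, Matrix.mul_assoc (B ()), Matrix.mul_assoc (A ()),
      isUnit_mul_inv (scalarGL m c).isUnit, Matrix.mul_one, Matrix.mul_one,
      Matrix.trace_mul_comm, sub_self, mul_zero]

theorem isQuasiHamiltonian_scalarClass (m : ℕ) (c : ℂˣ) :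
    (scalarClass m c).IsQuasiHamiltonian := by
  have h0 : ∀ (x : onePt.Pt) (v : onePt.Tangent x),
      mcL (onePt.constMat (scalarGL m c).val) v = 0 := fun x v => by
    rw [mcL, der_constMat, Matrix.mul_zero]
  have h0' : ∀ (x : onePt.Pt) (v : onePt.Tangent x),
      mcR (onePt.constMat (scalarGL m c).val) v = 0 := fun x v => by
    rw [mcR, der_constMat, Matrix.zero_mul]
  refine ⟨onePt_isBasicOpen.smooth, ?_, ?_, fun x v _ _ => onePt_tangent_eq_zero v⟩
  · refine Form.hasExtDeriv_zero.congr (X := onePt) (fun _ _ _ => rfl) fun x u v w => ?_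
    refine mul_eq_zero_of_right _ (Finset.sum_eq_zero fun i _ => ?_)
    have h : mcL ((scalarClass m c).μ i) u = 0 := h0 x u
    rw [h, Matrix.zero_mul, Matrix.trace_zero]
  · intro x A
    obtain ⟨v, hv⟩ := (scalarClass m c).exists_fundamental A x
    refine ⟨v, hv, fun w => (mul_eq_zero_of_right _ (Finset.sum_eq_zero fun i _ => ?_)).symm⟩
    have h : mcL ((scalarClass m c).μ i) w = 0 := h0 x w
    have h' : mcR ((scalarClass m c).μ i) w = 0 := h0' x w
    rw [h, h', add_zero, Matrix.zero_mul, Matrix.trace_zero]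

/-! ### Products of spaces built from fission spaces and conjugacy classes -/

variable {I J : Type} {n : I → ℕ} {m : J → ℕ}

theorem isRelabelling_symm_relabel (M : QHDatum I n) (e : I ≃ J) (he : ∀ i, n i = m (e i))
    (he' : ∀ j, m j = n (e.symm j)) : (M.relabel e he).IsRelabelling e.symm he' M := by
  refine ⟨Hom.id M.X, Hom.id_isIso _, fun g g' h x => ?_, fun x j => ?_, fun x v w => rfl⟩
  · change M.act (pullGL e he g) x = M.act g' x
    congr 2
    obtain rfl : n = fun i => m (e i) := funext he
    funext i
    apply Units.ext
    have h1 := h (e i)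
    have h2 := castMat_family (m := fun i => m (e i)) (fun i => (g' i).val)
      (e.symm_apply_apply i)
    rw [pullGL_val, castMat_rfl, ← h2, h1, castMat_trans, castMat_rfl]
  · obtain ⟨i, rfl⟩ := e.surjective j
    obtain rfl : n = fun i => m (e i) := funext he
    rw [relabel_μ, castMat_rfl]
    have h2 := castMat_family (m := fun i => m (e i)) (fun i => val (X := M.X) x (M.μ i))
      (e.symm_apply_apply i).symm
    exact h2.symm

end QHDatum

open QHDatum

theorem FissionBuilt.of_relabel {I J : Type} {n : I → ℕ} {m : J → ℕ} {M : QHDatum I n}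
    {e : I ≃ J} {he : ∀ i, n i = m (e i)} (h : FissionBuilt (M.relabel e he)) :
    FissionBuilt M := by
  have he' : ∀ j, m j = n (e.symm j) := fun j => by rw [he, e.apply_symm_apply]
  exact FissionBuilt.relabel e.symm he' _ _ h (M.isRelabelling_symm_relabel e he he')

theorem FissionBuilt.relabelled {I J : Type} {n : I → ℕ} {m : J → ℕ} {M : QHDatum I n}
    (h : FissionBuilt M) (e : I ≃ J) (he : ∀ i, n i = m (e i)) : FissionBuilt (M.relabel e he) :=
  FissionBuilt.relabel e he _ _ h (M.isRelabelling_relabel e he)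

theorem FissionBuilt.fused {I J : Type} {n : I → ℕ} {m : J → ℕ} {M : QHDatum I n}
    (h : FissionBuilt M) {f : I → J} (hf : ∀ i, n i = m (f i)) {i₁ i₂ : I}
    (hi : IsFusionMap f i₁ i₂) : FissionBuilt (M.fuse hf hi) :=
  FissionBuilt.fusion f hf i₁ i₂ _ _ h (M.isFusion_fuse hf hi)

/-- The empty product is not one of the generators of the class. It arises as the reduction of the
identity class of `GL₀` by that trivial group, where the moment map condition is an equation between
empty matrices. -/
theorem fissionBuilt_pi_of_isEmpty {A : Type} [Fintype A] [IsEmpty A] {I : A → Type}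
    {n : ∀ a, I a → ℕ} (M : ∀ a, QHDatum (I a) (n a)) : FissionBuilt (QHDatum.pi M) := by
  let n' : Unit ⊕ (Σ a, I a) → ℕ := Sum.elim (fun _ => 0) (fun p => n p.1 p.2)
  let P : QHDatum (Unit ⊕ (Σ a, I a)) n' :=
    (scalarClass 0 1).relabel (Equiv.sumEmpty Unit (Σ a, I a)).symm (fun _ => rfl)
  have hP : FissionBuilt P :=
    (FissionBuilt.conj _ _ (isConjugacyClass_scalarClass 0 1)).relabelled _ _
  refine FissionBuilt.reduction P (QHDatum.pi M) hP ?_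
  have hs : Algebra.Smooth ℂ (QHDatum.pi M).X.reg :=
    (isBasicOpen_pi (fun a => (M a).X) (σ := fun _ => Empty) (f := fun _ => 1)
      (c := fun a => isEmptyElim a) fun a => isEmptyElim a).smooth
  have hsub : Subsingleton (QHDatum.pi M).X.Pt :=
    ⟨fun x y => funext fun a => isEmptyElim a⟩
  have hv : ∀ {x : (QHDatum.pi M).X.Pt} (v : (QHDatum.pi M).X.Tangent x), v = 0 := fun v =>
    tangent_pi_ext fun a => isEmptyElim a
  refine ⟨hs, ⟨fun _ a => isEmptyElim a, fun f hf => ?_⟩, ⟨(QHDatum.pi M).affine,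
    fun _ _ _ => rfl, fun F hF _ => ?_⟩, fun y => ?_, fun z z' _ => ?_, fun g z z' _ => ?_,
    fun z j => isEmptyElim j.1, fun z v w => ?_⟩
  · exact Subalgebra.algebraMap_mem _ (f fun a => isEmptyElim a)
  · obtain ⟨f, hf, hF⟩ := hF
    refine ⟨algebraMap ℂ _ (f ()), funext fun z => hF z, fun f' hf' => ?_⟩
    apply Subtype.ext
    funext x
    have h1 : ∀ k, val (X := P.X) () (P.μ (Sum.inl k)) = 1 := fun k => by
      ext a b
      exact a.elim0
    have := congrFun hf' ⟨(), h1⟩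
    rw [hF] at this
    rw [Subsingleton.elim x fun a => isEmptyElim a]
    exact this.symm
  · have h1 : ∀ k, val (X := P.X) () (P.μ (Sum.inl k)) = 1 := fun k => by
      ext a b
      exact a.elim0
    exact ⟨⟨(), h1⟩, Subsingleton.elim _ _⟩
  · exact ⟨1, fun _ => rfl, rfl⟩
  · exact Subsingleton.elim _ _
  · rw [hv (Hom.push _ w), ω_zero_right]
    rfl

/-- The index set of a product over `Option A`. -/
def sigmaOptionEquiv {A : Type} (I : Option A → Type) :
    (Σ t, I t) ≃ I none ⊕ (Σ a, I (some a)) where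
  toFun
    | ⟨none, i⟩ => Sum.inl i
    | ⟨some a, i⟩ => Sum.inr ⟨a, i⟩
  invFun
    | Sum.inl i => ⟨none, i⟩
    | Sum.inr p => ⟨some p.1, p.2⟩
  left_inv := by rintro ⟨_ | a, i⟩ <;> rfl
  right_inv := by rintro (i | ⟨a, i⟩) <;> rfl

theorem isProduct_pi_option {A : Type} [Fintype A] {I : Option A → Type}
    {n : ∀ a, I a → ℕ} (M : ∀ a, QHDatum (I a) (n a))
    (he : ∀ p : Σ t, I t, n p.1 p.2 = Sum.elim (n none)
      (fun p : Σ a, I (some a) => n (some p.1) p.2) (sigmaOptionEquiv I p)) :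
    IsProduct (M none) (QHDatum.pi fun a => M (some a))
      ((QHDatum.pi M).relabel (sigmaOptionEquiv I) he) := by
  let p₁ : Hom (QHDatum.pi M).X (M none).X := proj (fun a => (M a).X) none
  let p₂ : Hom (QHDatum.pi M).X (QHDatum.pi fun a => M (some a)).X :=
    { toFun := fun x a => x (some a)
      regular := fun f hf => by
        refine comp_mem_of_adjoin (P := (FunSpace.pi fun a => (M (some a)).X).Pt) ?_ hf
        rintro _ ⟨a, f, hf, rfl⟩
        exact (proj (fun a => (M a).X) (some a)).regular f hf }
  have hμ : ∀ p, ((QHDatum.pi M).relabel (sigmaOptionEquiv I) he).μ (sigmaOptionEquiv I p) =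
      castMat (he p) ((QHDatum.pi M).μ p) := fun p => (QHDatum.pi M).relabel_μ _ he p
  refine ⟨p₁, p₂, ⟨fun x y h => ?_, fun y => ?_⟩, ?_, fun g x => ?_, fun g x => ?_,
    fun x i => ?_, fun x j => ?_, fun x v w => ?_⟩
  · funext t
    cases t with
    | none => exact congrArg Prod.fst h
    | some a => exact congrFun (congrArg Prod.snd h) a
  · refine ⟨fun t => match t with
      | none => y.1
      | some a => y.2 a, rfl⟩
  · refine eq_top_iff.2 ?_
    rintro ⟨F, hF⟩ -
    have hF' : F ∈ Algebra.adjoin ℂ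
      {F : (QHDatum.pi M).X.Pt → ℂ | ∃ a, ∃ f ∈ (M a).X.reg, F = fun x => f (x a)} := hF
    induction hF' using Algebra.adjoin_induction with
    | mem F hF' =>
      obtain ⟨t, f, hf, rfl⟩ := hF'
      cases t with
      | none => exact Algebra.mem_sup_left ⟨⟨f, hf⟩, rfl⟩
      | some a =>
        exact Algebra.mem_sup_right
          ⟨(proj (fun a => (M (some a)).X) a).pull ⟨f, hf⟩, rfl⟩
    | algebraMap r => exact Subalgebra.algebraMap_mem _ r
    | add f g hf hg hf' hg' => exact Subalgebra.add_mem _ (hf' hf) (hg' hg)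
    | mul f g hf hg hf' hg' => exact Subalgebra.mul_mem _ (hf' hf) (hg' hg)
  · rfl
  · rfl
  · exact congrArg (val (X := (QHDatum.pi M).X) x) (hμ ⟨none, i⟩)
  · exact congrArg (val (X := (QHDatum.pi M).X) x) (hμ ⟨some j.1, j.2⟩)
  · exact Fintype.sum_option _

theorem isRelabelling_pi_equiv {A B : Type} [Fintype A] [Fintype B] (e : A ≃ B) {I : B → Type}
    {n : ∀ a, I a → ℕ} (M : ∀ a, QHDatum (I a) (n a)) :
    (QHDatum.pi fun a => M (e a)).IsRelabelling
      (Equiv.sigmaCongrLeft (β := I) e) (fun _ => rfl) (QHDatum.pi M) := by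
  let E : (∀ a, (M (e a)).X.Pt) ≃ ∀ b, (M b).X.Pt := Equiv.piCongrLeft (fun b => (M b).X.Pt) e
  have hE : ∀ x a, E x (e a) = x a := Equiv.piCongrLeft_apply_apply (fun b => (M b).X.Pt) e
  let φ : Hom (QHDatum.pi fun a => M (e a)).X (QHDatum.pi M).X :=
    { toFun := E
      regular := fun f hf => by
        refine comp_mem_of_adjoin (P := (FunSpace.pi fun a => (M a).X).Pt) ?_ hf
        rintro _ ⟨b, f, hf, rfl⟩
        obtain ⟨a, rfl⟩ := e.surjective b
        have h : (fun x : (FunSpace.pi fun a => (M (e a)).X).Pt => f (E x (e a))) =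
            fun x => f (x a) := funext fun x => congrArg f (hE x a)
        exact (congrArg (· ∈ (FunSpace.pi fun a => (M (e a)).X).reg) h).mpr
          ((proj (fun a => (M (e a)).X) a).regular f hf) }
  refine ⟨φ, Hom.isIso_of_adjoin (φ := φ) E.bijective rfl ?_, fun g g' hg x => ?_, fun x p => ?_,
    fun x v w => ?_⟩
  · rintro _ ⟨a, f, hf, rfl⟩
    refine ⟨_, (proj (fun a => (M a).X) (e a)).regular f hf, ?_⟩
    funext x
    exact (congrArg f (hE x a)).symm
  · funext b
    obtain ⟨a, rfl⟩ := e.surjective b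
    have h1 : (fun i => g' ⟨e a, i⟩) = fun i => g ⟨a, i⟩ :=
      funext fun i => Units.ext (hg ⟨a, i⟩)
    refine (hE _ a).trans ?_
    change _ = (M (e a)).act (fun i => g' ⟨e a, i⟩) (E x (e a))
    rw [h1]
    exact (congrArg (fun y => (M (e a)).act (fun i => g ⟨a, i⟩) y) (hE x a)).symm
  · exact congrArg (fun y => val y ((M (e p.1)).μ p.2)) (hE x p.1)
  · refine (e.sum_comp _).symm.trans (Finset.sum_congr rfl fun a _ => ?_)
    have hp : ∀ u : (QHDatum.pi fun a => M (e a)).X.Tangent x,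
        ((proj (fun a => (M a).X) (e a)).push (φ.push u)).1 =
        ((proj (fun a => (M (e a)).X) a).push u).1 := by
      intro u
      apply LinearMap.ext
      intro f
      refine congrArg u.1 (Subtype.ext (funext fun y => ?_))
      exact congrArg f.1 (hE y a)
    exact Form.congr_point _ (hE x a) (hp v) (hp w)

/-- `FissionBuilt` provides binary products only. Finite families follow by induction on the index
type: transport along a bijection, the empty type, and the adjunction of one element with `Option`.
-/
theorem fissionBuilt_pi {A : Type} [Fintype A] {I : A → Type} {n : ∀ a, I a → ℕ}
    {M : ∀ a, QHDatum (I a) (n a)} (hM : ∀ a, FissionBuilt (M a)) :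
    FissionBuilt (QHDatum.pi M) := by
  have key : ∀ (A : Type) [Finite A], ∀ [Fintype A] (I : A → Type) (n : ∀ a, I a → ℕ)
      (M : ∀ a, QHDatum (I a) (n a)), (∀ a, FissionBuilt (M a)) → FissionBuilt (QHDatum.pi M) := by
    intro A _
    refine Finite.induction_empty_option (P := fun A => ∀ [Fintype A] (I : A → Type)
      (n : ∀ a, I a → ℕ) (M : ∀ a, QHDatum (I a) (n a)), (∀ a, FissionBuilt (M a)) →
      FissionBuilt (QHDatum.pi M)) ?_ ?_ ?_ A
    · intro A B e h _ I n M hM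
      have : Fintype A := Fintype.ofEquiv B e.symm
      exact FissionBuilt.relabel _ _ _ _ (h _ _ (fun a => M (e a)) fun a => hM (e a))
        (isRelabelling_pi_equiv e M)
    · intro _ I n M _
      exact fissionBuilt_pi_of_isEmpty M
    · intro A _ h _ I n M hM
      have he : ∀ p : Σ t, I t, n p.1 p.2 = Sum.elim (n none)
          (fun p : Σ a, I (some a) => n (some p.1) p.2) (sigmaOptionEquiv I p) := by
        rintro ⟨_ | a, i⟩ <;> rfl
      have hp := isProduct_pi_option M he
      have hb := FissionBuilt.prod _ _ _ (hM none)
        (h _ _ (fun a => M (some a)) fun a => hM (some a)) hp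
      have := FissionBuilt.of_relabel hb
      -- The two sides differ in the `Fintype` structure on `Option A`.
      convert this
  exact key A I n M hM

end FissionVar

end

noncomputable section

namespace FissionVar

open FunSpace

/-! ### Matrices with two by two blocks -/

section Blocks

variable (d : Fin 2 → ℕ)

/-- The index set of a block matrix with two blocks. -/
def blkEquiv : Fin (d 0) ⊕ Fin (d 1) ≃ Fin (∑ i, d i) :=
  Equiv.trans
    { toFun := Sum.elim (fun a => (⟨0, a⟩ : Σ i : Fin 2, Fin (d i))) (fun a => ⟨1, a⟩)
      invFun := fun p => match p with
        | ⟨0, a⟩ => Sum.inl a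
        | ⟨1, a⟩ => Sum.inr a
      left_inv := by rintro (a | a) <;> rfl
      right_inv := by
        rintro ⟨i, a⟩
        fin_cases i <;> rfl }
    finSigmaFinEquiv

theorem blkEquiv_inl (a : Fin (d 0)) : blkEquiv d (Sum.inl a) = finSigmaFinEquiv ⟨0, a⟩ := rfl

theorem blkEquiv_inr (a : Fin (d 1)) : blkEquiv d (Sum.inr a) = finSigmaFinEquiv ⟨1, a⟩ := rfl

theorem blk_inl (a : Fin (d 0)) : blk d (blkEquiv d (Sum.inl a)) = 0 := by
  rw [blk, blkEquiv_inl, Equiv.symm_apply_apply]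

theorem blk_inr (a : Fin (d 1)) : blk d (blkEquiv d (Sum.inr a)) = 1 := by
  rw [blk, blkEquiv_inr, Equiv.symm_apply_apply]

/-- The matrix with the given blocks. -/
def blocks {R : Type} (A : Matrix (Fin (d 0)) (Fin (d 0)) R) (B : Matrix (Fin (d 0)) (Fin (d 1)) R)
    (C : Matrix (Fin (d 1)) (Fin (d 0)) R) (D : Matrix (Fin (d 1)) (Fin (d 1)) R) :
    Matrix (Fin (∑ i, d i)) (Fin (∑ i, d i)) R :=
  Matrix.reindex (blkEquiv d) (blkEquiv d) (Matrix.fromBlocks A B C D)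

variable {d} {R S : Type} {A A' : Matrix (Fin (d 0)) (Fin (d 0)) R}
  {B B' : Matrix (Fin (d 0)) (Fin (d 1)) R} {C C' : Matrix (Fin (d 1)) (Fin (d 0)) R}
  {D D' : Matrix (Fin (d 1)) (Fin (d 1)) R}

theorem blocks_apply (i j : Fin (d 0) ⊕ Fin (d 1)) :
    blocks d A B C D (blkEquiv d i) (blkEquiv d j) = Matrix.fromBlocks A B C D i j := by
  simp [blocks]

theorem blocks_map (f : R → S) :
    (blocks d A B C D).map f = blocks d (A.map f) (B.map f) (C.map f) (D.map f) := by
  rw [blocks, blocks, ← Matrix.fromBlocks_map]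
  rfl

theorem blocks_inj : blocks d A B C D = blocks d A' B' C' D' ↔
    A = A' ∧ B = B' ∧ C = C' ∧ D = D' := by
  rw [blocks, blocks, (Matrix.reindex _ _).apply_eq_iff_eq, Matrix.fromBlocks_inj]

theorem exists_eq_blocks (F : Matrix (Fin (∑ i, d i)) (Fin (∑ i, d i)) R) :
    ∃ A B C D, F = blocks d A B C D := by
  let G := (Matrix.reindex (blkEquiv d) (blkEquiv d)).symm F
  exact ⟨G.toBlocks₁₁, G.toBlocks₁₂, G.toBlocks₂₁, G.toBlocks₂₂, by
    rw [blocks, Matrix.fromBlocks_toBlocks, Equiv.apply_symm_apply]⟩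

theorem ext_blkEquiv {F G : Matrix (Fin (∑ i, d i)) (Fin (∑ i, d i)) R}
    (h : ∀ i j, F (blkEquiv d i) (blkEquiv d j) = G (blkEquiv d i) (blkEquiv d j)) : F = G := by
  ext i j
  obtain ⟨i, rfl⟩ := (blkEquiv d).surjective i
  obtain ⟨j, rfl⟩ := (blkEquiv d).surjective j
  exact h i j

theorem blockDiag_eq_blocks [Zero R] (h : ∀ i, Matrix (Fin (d i)) (Fin (d i)) R) :
    blockDiag d h = blocks d (h 0) 0 0 (h 1) := by
  refine ext_blkEquiv fun i j => ?_
  rw [blocks_apply]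
  rcases i with i | i <;> rcases j with j | j <;>
    simp [blockDiag, blkEquiv_inl, blkEquiv_inr, Matrix.blockDiagonal'_apply]

variable [CommRing R]

theorem blocks_mul : blocks d A B C D * blocks d A' B' C' D' =
    blocks d (A * A' + B * C') (A * B' + B * D') (C * A' + D * C') (C * B' + D * D') := by
  rw [blocks, blocks, blocks, ← Matrix.fromBlocks_multiply]
  exact (Matrix.reindexLinearEquiv_mul R R _ _ _ _ _)

theorem blocks_one : blocks d 1 0 0 1 = (1 : Matrix (Fin (∑ i, d i)) (Fin (∑ i, d i)) R) := by
  rw [blocks, Matrix.fromBlocks_one]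
  simp

theorem blocks_add : blocks d A B C D + blocks d A' B' C' D' =
    blocks d (A + A') (B + B') (C + C') (D + D') := by
  rw [blocks, blocks, blocks, ← Matrix.fromBlocks_add]
  rfl

theorem blocks_sub : blocks d A B C D - blocks d A' B' C' D' =
    blocks d (A - A') (B - B') (C - C') (D - D') := by
  refine ext_blkEquiv fun i j => ?_
  rw [Matrix.sub_apply, blocks_apply, blocks_apply, blocks_apply]
  rcases i with i | i <;> rcases j with j | j <;> rfl

theorem blocks_trace : (blocks d A B C D).trace = A.trace + D.trace := by
  rw [Matrix.trace, ← (blkEquiv d).sum_comp, Fintype.sum_sum_type]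
  simp only [Matrix.diag_apply, blocks_apply]
  rfl

theorem isUpper_blocks (B : Matrix (Fin (d 0)) (Fin (d 1)) ℂ) : IsUpper d (blocks d 1 B 0 1) := by
  intro a b h
  obtain ⟨a, rfl⟩ := (blkEquiv d).surjective a
  obtain ⟨b, rfl⟩ := (blkEquiv d).surjective b
  rw [← blocks_one, blocks_apply, blocks_apply]
  rcases a with a | a <;> rcases b with b | b <;> try rfl
  rw [blk_inl, blk_inr] at h
  exact absurd h (by decide)

theorem isLower_blocks (C : Matrix (Fin (d 1)) (Fin (d 0)) ℂ) : IsLower d (blocks d 1 0 C 1) := by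
  intro a b h
  obtain ⟨a, rfl⟩ := (blkEquiv d).surjective a
  obtain ⟨b, rfl⟩ := (blkEquiv d).surjective b
  rw [← blocks_one, blocks_apply, blocks_apply]
  rcases a with a | a <;> rcases b with b | b <;> try rfl
  rw [blk_inl, blk_inr] at h
  exact absurd h (by decide)

theorem IsUpper.exists_eq {F : Matrix (Fin (∑ i, d i)) (Fin (∑ i, d i)) ℂ} (h : IsUpper d F) :
    ∃ B, F = blocks d 1 B 0 1 := by
  obtain ⟨A, B, C, D, rfl⟩ := exists_eq_blocks F
  refine ⟨B, ext_blkEquiv fun a b => ?_⟩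
  have h1 := h (blkEquiv d a) (blkEquiv d b)
  rw [← blocks_one, blocks_apply, blocks_apply] at h1
  rw [blocks_apply, blocks_apply]
  rcases a with a | a <;> rcases b with b | b
  · exact h1 (by rw [blk_inl, blk_inl])
  · rfl
  · exact h1 (by rw [blk_inl, blk_inr]; decide)
  · exact h1 (by rw [blk_inr, blk_inr])

theorem IsLower.exists_eq {F : Matrix (Fin (∑ i, d i)) (Fin (∑ i, d i)) ℂ} (h : IsLower d F) :
    ∃ C, F = blocks d 1 0 C 1 := by
  obtain ⟨A, B, C, D, rfl⟩ := exists_eq_blocks F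
  refine ⟨C, ext_blkEquiv fun a b => ?_⟩
  have h1 := h (blkEquiv d a) (blkEquiv d b)
  rw [← blocks_one, blocks_apply, blocks_apply] at h1
  rw [blocks_apply, blocks_apply]
  rcases a with a | a <;> rcases b with b | b
  · exact h1 (by rw [blk_inl, blk_inl])
  · exact h1 (by rw [blk_inl, blk_inr]; decide)
  · rfl
  · exact h1 (by rw [blk_inr, blk_inr])

theorem isUnit_blocks_upper : IsUnit (blocks d (1 : Matrix (Fin (d 0)) (Fin (d 0)) R) B 0 1) :=
  IsUnit.of_mul_eq_one (blocks d 1 (-B) 0 1) (by rw [blocks_mul, ← blocks_one]; simp)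

theorem isUnit_blocks_lower : IsUnit (blocks d (1 : Matrix (Fin (d 0)) (Fin (d 0)) R) 0 C 1) :=
  IsUnit.of_mul_eq_one (blocks d 1 0 (-C) 1) (by rw [blocks_mul, ← blocks_one]; simp)

theorem blocks_upper_inv : (blocks d (1 : Matrix (Fin (d 0)) (Fin (d 0)) R) B 0 1)⁻¹ =
    blocks d 1 (-B) 0 1 :=
  Matrix.inv_eq_right_inv (by rw [blocks_mul, ← blocks_one]; simp)

theorem blocks_lower_inv : (blocks d (1 : Matrix (Fin (d 0)) (Fin (d 0)) R) 0 C 1)⁻¹ =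
    blocks d 1 0 (-C) 1 :=
  Matrix.inv_eq_right_inv (by rw [blocks_mul, ← blocks_one]; simp)

theorem isUnit_blocks_diag (hA : IsUnit A) (hD : IsUnit D) : IsUnit (blocks d A 0 0 D) :=
  IsUnit.of_mul_eq_one (blocks d A⁻¹ 0 0 D⁻¹) (by
    rw [blocks_mul, ← blocks_one]; simp [isUnit_mul_inv hA, isUnit_mul_inv hD])

theorem blocks_diag_inv (hA : IsUnit A) (hD : IsUnit D) :
    (blocks d A 0 0 D)⁻¹ = blocks d A⁻¹ 0 0 D⁻¹ :=
  Matrix.inv_eq_right_inv (by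
    rw [blocks_mul, ← blocks_one]; simp [isUnit_mul_inv hA, isUnit_mul_inv hD])

end Blocks

namespace FunSpace

variable {X : FunSpace} {d : Fin 2 → ℕ} {A : Matrix (Fin (d 0)) (Fin (d 0)) X.reg}
  {B : Matrix (Fin (d 0)) (Fin (d 1)) X.reg} {C : Matrix (Fin (d 1)) (Fin (d 0)) X.reg}
  {D : Matrix (Fin (d 1)) (Fin (d 1)) X.reg} {p : X.Pt} (v w : X.Tangent p)

theorem val_blocks : val p (blocks d A B C D) =
    blocks d (val p A) (val p B) (val p C) (val p D) := blocks_map _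

theorem der_blocks : der v (blocks d A B C D) =
    blocks d (der v A) (der v B) (der v C) (der v D) := blocks_map _

theorem mcL_blocks_upper : mcL (blocks d 1 B 0 1) v = blocks d 0 (der v B) 0 0 := by
  rw [mcL, der_blocks, val_blocks, der_one, der_one, der_zero, val_one, val_one, val_zero,
    blocks_upper_inv, blocks_mul]
  simp

theorem mcR_blocks_upper : mcR (blocks d 1 B 0 1) v = blocks d 0 (der v B) 0 0 := by
  rw [mcR, der_blocks, val_blocks, der_one, der_one, der_zero, val_one, val_one, val_zero,
    blocks_upper_inv, blocks_mul]
  simp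

theorem mcL_blocks_lower : mcL (blocks d 1 0 C 1) v = blocks d 0 0 (der v C) 0 := by
  rw [mcL, der_blocks, val_blocks, der_one, der_one, der_zero, val_one, val_one, val_zero,
    blocks_lower_inv, blocks_mul]
  simp

theorem mcR_blocks_diag (hA : IsUnit A) (hD : IsUnit D) :
    mcR (blocks d A 0 0 D) v = blocks d (mcR A v) 0 0 (mcR D v) := by
  rw [mcR, der_blocks, val_blocks, der_zero, der_zero, val_zero, val_zero,
    blocks_diag_inv (isUnit_val hA p) (isUnit_val hD p), blocks_mul]
  simp [mcR]

/-- Strictly upper triangular two by two block matrices multiply to zero, so the cubic form vanishes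
on them. -/
theorem chi_blocks_upper (u : X.Tangent p) : chi (blocks d 1 B 0 1) u v w = 0 := by
  rw [chi, mcL_blocks_upper, mcL_blocks_upper, mcL_blocks_upper, blocks_mul, blocks_mul, blocks_sub,
    blocks_mul, blocks_trace]
  simp

theorem chi_blocks_lower (u : X.Tangent p) : chi (blocks d 1 0 C 1) u v w = 0 := by
  rw [chi, mcL_blocks_lower, mcL_blocks_lower, mcL_blocks_lower, blocks_mul, blocks_mul, blocks_sub,
    blocks_mul, blocks_trace]
  simp

/-- The Maurer-Cartan form of a block lower triangular matrix is block lower triangular, and the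
trace of a cubic expression in such matrices sees only the diagonal blocks. -/
theorem chi_blocks_lower_mul_diag (hA : IsUnit A) (hD : IsUnit D) (u : X.Tangent p) :
    chi (blocks d 1 0 C 1 * blocks d A 0 0 D) u v w = chi A u v w + chi D u v w := by
  have hH := isUnit_blocks_diag (d := d) hA hD
  rw [chi, mcL_mul u isUnit_blocks_lower hH, mcL_mul v isUnit_blocks_lower hH,
    mcL_mul w isUnit_blocks_lower hH, triTr_conj (isUnit_mul_inv (isUnit_val hH p)),
    mcL_blocks_lower, mcL_blocks_lower, mcL_blocks_lower, mcR_blocks_diag _ hA hD,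
    mcR_blocks_diag _ hA hD, mcR_blocks_diag _ hA hD, blocks_add, blocks_add, blocks_add,
    blocks_mul, blocks_mul, blocks_sub, blocks_mul, blocks_trace, chi_eq_mcR hA, chi_eq_mcR hD]
  simp
  ring

/-! ### The two-form of the Van den Bergh spaces -/

/-- The two-form of the Van den Bergh spaces. -/
def vdbForm {m n : Type} [Fintype m] [DecidableEq m] [Fintype n] [DecidableEq n]
    (x : Matrix n m X.reg) (y : Matrix m n X.reg) {p : X.Pt} (v w : X.Tangent p) : ℂ :=
  (1 / 2 : ℂ) * (((1 + val p x * val p y)⁻¹ * (der v x * der w y - der w x * der v y)).trace -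
    ((1 + val p y * val p x)⁻¹ * (der v y * der w x - der w y * der v x)).trace)

end FunSpace

section OnePlus

variable {m n : Type} [Fintype m] [DecidableEq m] [Fintype n] [DecidableEq n] {R : Type}
  [CommRing R] {x : Matrix n m R} {y : Matrix m n R}

theorem isUnit_one_add_mul_comm (h : IsUnit (1 + x * y)) : IsUnit (1 + y * x) := by
  rw [Matrix.isUnit_iff_isUnit_det, Matrix.det_one_add_mul_comm] at h
  rwa [Matrix.isUnit_iff_isUnit_det]

/-- The push-through identity, from `x(1 + yx) = (1 + xy)x`. With its companion below it drives all
the trace computations for the Van den Bergh form. -/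
theorem mul_inv_one_add (h : IsUnit (1 + x * y)) :
    x * (1 + y * x)⁻¹ = (1 + x * y)⁻¹ * x := by
  have hk := isUnit_mul_inv (isUnit_one_add_mul_comm h)
  have hl := isUnit_inv_mul h
  calc x * (1 + y * x)⁻¹ = ((1 + x * y)⁻¹ * (1 + x * y)) * x * (1 + y * x)⁻¹ := by
        rw [hl, Matrix.one_mul]
    _ = (1 + x * y)⁻¹ * x * ((1 + y * x) * (1 + y * x)⁻¹) := by
        simp only [Matrix.mul_assoc, Matrix.add_mul, Matrix.mul_add, Matrix.one_mul]
    _ = _ := by rw [hk, Matrix.mul_one]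

theorem mul_inv_one_add_mul (h : IsUnit (1 + x * y)) :
    x * (1 + y * x)⁻¹ * y = 1 - (1 + x * y)⁻¹ := by
  have hl := isUnit_inv_mul h
  rw [mul_inv_one_add h, Matrix.mul_assoc, eq_sub_iff_add_eq']
  rw [Matrix.mul_add, Matrix.mul_one] at hl
  exact hl

end OnePlus

/-- `A` and `A'` are the derivatives of `a = -(1 + yx)⁻¹y` along two tangent vectors. The left side
is the fusion terms of the unitriangular matrices with blocks `y, x, a`, and the right side is `-2`
times the Van den Bergh form. After substitution the terms quadratic in the `X`'s or in the `Y`'s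
are symmetric under exchange of the two vectors and cancel; the mixed ones simplify by cyclicity. -/
theorem trace_identity {m n : Type} [Fintype m] [DecidableEq m] [Fintype n] [DecidableEq n]
    {x : Matrix n m ℂ} {y : Matrix m n ℂ} (h : IsUnit (1 + x * y)) (X X' : Matrix n m ℂ)
    (Y Y' A A' : Matrix m n ℂ)
    (hA : A = (1 + y * x)⁻¹ * (Y * x + y * X) * (1 + y * x)⁻¹ * y - (1 + y * x)⁻¹ * Y)
    (hA' : A' = (1 + y * x)⁻¹ * (Y' * x + y * X') * (1 + y * x)⁻¹ * y - (1 + y * x)⁻¹ * Y') :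
    (Y * (X' - x * A' * x)).trace - (Y' * (X - x * A * x)).trace +
      ((X * A').trace - (X' * A).trace) =
    ((1 + y * x)⁻¹ * (Y * X' - Y' * X)).trace - ((1 + x * y)⁻¹ * (X * Y' - X' * Y)).trace := by
  have hk := isUnit_one_add_mul_comm h
  have e1 := mul_inv_one_add h
  have e2 := mul_inv_one_add_mul h
  have e3 := mul_inv_one_add_mul hk
  set k := (1 + y * x)⁻¹
  set l := (1 + x * y)⁻¹
  have e4 : k * y * x = 1 - k := by rw [← mul_inv_one_add hk, e3]
  -- The formula for the derivative of `a`, rewritten with `x k y = 1 - l` so that `X` and `Y` occur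
  -- in separate, balanced terms.
  have hB : ∀ (X : Matrix n m ℂ) (Y : Matrix m n ℂ),
      k * (Y * x + y * X) * k * y - k * Y = k * y * X * k * y - k * Y * l := by
    intro X Y
    have : k * Y * (x * k * y) = k * Y - k * Y * l := by
      rw [e2, Matrix.mul_sub, Matrix.mul_one]
    simp only [Matrix.mul_add, Matrix.add_mul, ← Matrix.mul_assoc] at this ⊢
    rw [this]
    abel
  have hC : ∀ (X : Matrix n m ℂ) (Y : Matrix m n ℂ),
      x * (k * y * X * k * y - k * Y * l) * x =
        (1 - l) * X * (1 - k) - (x * k) * Y * (x * k) := by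
    intro X Y
    have e5 : x * k * Y * (x * k) = x * k * Y * (l * x) := by rw [e1]
    rw [Matrix.mul_sub, Matrix.sub_mul, ← e2, ← e4, e5]
    simp only [Matrix.mul_assoc]
  rw [hB] at hA hA'
  rw [hA, hA', hC, hC]
  have c1 : (Y' * (x * k * Y * (x * k))).trace = (Y * (x * k * Y' * (x * k))).trace := by
    have : ∀ P Q : Matrix m n ℂ, P * (x * k * Q * (x * k)) = P * (x * k) * (Q * (x * k)) :=
      fun P Q => by simp only [Matrix.mul_assoc]
    rw [this, this, Matrix.trace_mul_comm]
  have c2 : (X * (k * y * X' * k * y)).trace = (X' * (k * y * X * k * y)).trace := by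
    have : ∀ P Q : Matrix n m ℂ, P * (k * y * Q * k * y) = P * (k * y) * (Q * (k * y)) :=
      fun P Q => by simp only [Matrix.mul_assoc]
    rw [this, this, Matrix.trace_mul_comm]
  have c3 : ∀ (P : Matrix n m ℂ) (Q : Matrix m n ℂ),
      (P * (k * Q * l)).trace = (Q * (l * P * k)).trace := by
    intro P Q
    have h1 : P * (k * Q * l) = P * k * (Q * l) := by simp only [Matrix.mul_assoc]
    have h2 : Q * (l * P * k) = Q * l * (P * k) := by simp only [Matrix.mul_assoc]
    rw [h1, h2, Matrix.trace_mul_comm]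
  have c4 : ∀ (P : Matrix n m ℂ) (Q : Matrix m n ℂ), (Q * (P * k)).trace = (k * (Q * P)).trace := by
    intro P Q
    rw [← Matrix.mul_assoc, Matrix.trace_mul_comm]
  have c5 : ∀ (P : Matrix n m ℂ) (Q : Matrix m n ℂ), (Q * (l * P)).trace = (l * (P * Q)).trace := by
    intro P Q
    rw [Matrix.trace_mul_comm, Matrix.mul_assoc]
  simp only [Matrix.mul_sub, Matrix.sub_mul, Matrix.one_mul, Matrix.mul_one, Matrix.trace_sub, c1,
    c2, c3, c4, c5]
  ring

namespace FunSpace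

variable {X : FunSpace} {d : Fin 2 → ℕ} {x : Matrix (Fin (d 1)) (Fin (d 0)) X.reg}
  {y : Matrix (Fin (d 0)) (Fin (d 1)) X.reg}

/-- The Maurer-Cartan forms of the three factors are `dy`, `dx`, `da` in one off-diagonal block. The
pairings therefore reduce to traces of single blocks, and `trace_identity` evaluates them. -/
theorem fusionTerms_eq_vdbForm (h : IsUnit (1 + x * y)) {p : X.Pt} (v w : X.Tangent p) :
    -(1 / 2 : ℂ) * fusionTerms v w [blocks d 1 y 0 1, blocks d 1 0 x 1,
      blocks d 1 (-((1 + y * x)⁻¹ * y)) 0 1] = vdbForm x y v w := by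
  have hk := isUnit_one_add_mul_comm h
  set a := -((1 + y * x)⁻¹ * y) with ha
  have hda : ∀ u : X.Tangent p, der u a =
      (1 + val p y * val p x)⁻¹ * (der u y * val p x + val p y * der u x) *
        (1 + val p y * val p x)⁻¹ * val p y - (1 + val p y * val p x)⁻¹ * der u y := by
    intro u
    rw [ha, der_neg, der_mul, der_inv u hk, val_inv hk, val_add, val_mul, val_one, der_add, der_one,
      der_mul, zero_add, add_comm (val p y * der u x), Matrix.neg_mul]
    abel
  have hS2 : IsUnit (blocks d 1 0 x 1) := isUnit_blocks_lower
  have hS1 : IsUnit (blocks d 1 a 0 1) := isUnit_blocks_upper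
  have h21 : ∀ u : X.Tangent p, mcR (blocks d 1 0 x 1 * blocks d 1 a 0 1) u =
      blocks d (-(der u a * val p x)) (der u a) (der u x - val p x * der u a * val p x)
        (val p x * der u a) := by
    intro u
    rw [mcR_mul u hS2 hS1, mcL_blocks_lower, mcR_blocks_upper, val_blocks, val_one, val_one,
      val_zero, blocks_lower_inv, blocks_add, blocks_mul, blocks_mul]
    simp [sub_eq_add_neg]
  have hval : IsUnit (1 + val p x * val p y) := by
    have := isUnit_val h p
    rwa [val_add, val_one, val_mul] at this
  have e := trace_identity hval (der v x) (der w x) (der v y) (der w y) (der v a) (der w a) (hda v)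
    (hda w)
  simp only [fusionTerms, List.prod_cons, List.prod_nil, mul_one, wedgeTr, h21, mcL_blocks_upper,
    mcR_blocks_upper, mcL_blocks_lower, mcR_one, Matrix.mul_zero, Matrix.trace_zero]
  simp only [blocks_mul, blocks_trace, Matrix.zero_mul, Matrix.mul_zero, Matrix.trace_zero,
    add_zero, zero_add, sub_zero]
  rw [vdbForm]
  linear_combination (-1 / 2 : ℂ) * e

end FunSpace

end FissionVar

end

noncomputable section

namespace FissionVar

open FunSpace

namespace FunSpace

/-! ### Inverse matrices on basic open sets -/

namespace IsBasicOpen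

variable {X : FunSpace} {σ : Type} {f : MvPolynomial σ ℂ} {c : σ → X.reg}

/-- A character sends the unit `f` to a nonzero number, so its values on the coordinates are those
of a point of `X`; clearing denominators shows that it is evaluation there. -/
theorem isAffine [Finite σ] (h : IsBasicOpen X f c) : X.IsAffine := by
  obtain ⟨u, hu⟩ := h.unit
  have hu' : ∀ F : X.reg, ∃ (g : MvPolynomial σ ℂ) (n : ℕ),
      F = MvPolynomial.aeval c g * (u⁻¹).val ^ n := fun F => by
    obtain ⟨g, n, e⟩ := h.gen F
    refine ⟨g, n, ?_⟩
    rw [← e, ← hu, mul_assoc, ← mul_pow, Units.mul_inv, one_pow, mul_one]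
  constructor
  · have htop : Algebra.adjoin ℂ (Set.range c ∪ {(u⁻¹).val}) = (⊤ : Subalgebra ℂ X.reg) := by
      refine eq_top_iff.2 fun F _ => ?_
      obtain ⟨g, n, rfl⟩ := hu' F
      have h1 : (u⁻¹).val ∈ Algebra.adjoin ℂ (Set.range c ∪ {(u⁻¹).val}) :=
        Algebra.subset_adjoin (Set.mem_union_right _ rfl)
      refine Subalgebra.mul_mem _ ?_ (Subalgebra.pow_mem _ h1 n)
      refine Algebra.adjoin_mono (Set.subset_union_left (s := Set.range c)) ?_
      rw [Algebra.adjoin_range_eq_range_aeval]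
      exact ⟨g, rfl⟩
    have hfg : (⊤ : Subalgebra ℂ X.reg).FG :=
      Subalgebra.fg_def.2 ⟨_, (Set.finite_range c).union (Set.finite_singleton _), htop⟩
    exact (Subalgebra.fg_top X.reg).1 hfg
  · intro χ
    have hχ : ∀ g, χ (MvPolynomial.aeval c g) = MvPolynomial.eval (fun s => χ (c s)) g := fun g => by
      have e : χ.comp (MvPolynomial.aeval c) = MvPolynomial.aeval fun s => χ (c s) :=
        MvPolynomial.algHom_ext fun s => by
          simp only [AlgHom.comp_apply, MvPolynomial.aeval_X]
      have := DFunLike.congr_fun e g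
      rwa [MvPolynomial.aeval_eq_eval] at this
    have h0 : MvPolynomial.eval (fun s => χ (c s)) f ≠ 0 := by
      rw [← hχ]
      exact (h.unit.map χ).ne_zero
    obtain ⟨x, hx⟩ := h.surj _ h0
    refine ⟨x, AlgHom.ext fun F => ?_, fun y hy => ?_⟩
    · obtain ⟨g, n, e⟩ := h.gen F
      have h1 := congrArg χ e
      have h2 := congrArg (X.evalAt x) e
      rw [map_mul, map_pow, hχ, hχ] at h1
      have h3 : ∀ g, X.evalAt x (MvPolynomial.aeval c g) =
          MvPolynomial.eval (fun s => χ (c s)) g := fun g => by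
        have := aeval_apply c g x
        rw [funext hx] at this
        exact this
      rw [map_mul, map_pow, h3, h3, ← h1] at h2
      exact (mul_right_cancel₀ (pow_ne_zero n h0) h2).symm
    · refine h.inj y x fun s => ?_
      rw [hx, hy]
      rfl

end IsBasicOpen

/-- Cramer's rule. The factor `r` allows `f` to be any multiple of the determinant; its image then
joins the numerator. -/
theorem exists_gen_inv {X : FunSpace} {σ : Type} {c : σ → X.reg} {m : Type} [Fintype m]
    [DecidableEq m] {Φ : Matrix m m (MvPolynomial σ ℂ)} {G : Matrix m m X.reg}
    (hG : Φ.map (MvPolynomial.aeval c) = G) (hu : IsUnit G) {f : MvPolynomial σ ℂ}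
    (r : MvPolynomial σ ℂ) (hf : f = Φ.det * r) (i j : m) :
    ∃ (g : MvPolynomial σ ℂ) (n : ℕ),
      G⁻¹ i j * MvPolynomial.aeval c f ^ n = MvPolynomial.aeval c g := by
  have hd : MvPolynomial.aeval c Φ.det = G.det := by
    rw [← hG]
    exact (MvPolynomial.aeval c : MvPolynomial σ ℂ →ₐ[ℂ] X.reg).map_det Φ
  have ha : MvPolynomial.aeval c (Φ.adjugate i j) = G.adjugate i j := by
    rw [← hG]
    exact congrFun (congrFun
      ((MvPolynomial.aeval c : MvPolynomial σ ℂ →ₐ[ℂ] X.reg).map_adjugate Φ) i) j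
  refine ⟨Φ.adjugate i j * r, 1, ?_⟩
  have hu' := (Matrix.isUnit_iff_isUnit_det G).1 hu
  rw [pow_one, hf, map_mul, map_mul, hd, ha, Matrix.inv_def, Matrix.smul_apply, smul_eq_mul]
  linear_combination (G.adjugate i j * MvPolynomial.aeval c r) * Ring.inverse_mul_cancel _ hu'

theorem comp_mk_mem_of_regGLProd {I : Type} {n : I → ℕ} {X : FunSpace} (g : GLProd n)
    {F : GLProd n × X.Pt → ℂ} (hF : F ∈ regGLProd n X) : (fun x => F (g, x)) ∈ X.reg := by
  refine comp_mem_of_adjoin (φ := fun x : X.Pt => (g, x)) ?_ hF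
  rintro _ ((⟨i, a, b, rfl⟩ | ⟨i, a, b, rfl⟩) | ⟨f', hf', rfl⟩)
  · exact X.reg.algebraMap_mem ((g i).val a b)
  · exact X.reg.algebraMap_mem (((g i)⁻¹).val a b)
  · exact hf'

end FunSpace

/-! ### Identities between traces -/

section TraceIdentities

variable {m n : Type} [Fintype m] [DecidableEq m] [Fintype n]

theorem conj_rect {P' P : Matrix n n ℂ} {R R' : Matrix m m ℂ} (hR : R' * R = 1)
    (A : Matrix n m ℂ) (B : Matrix m n ℂ) : P * A * R' * (R * B * P') = P * (A * B) * P' := by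
  calc P * A * R' * (R * B * P') = P * A * (R' * R) * B * P' := by simp only [Matrix.mul_assoc]
    _ = _ := by rw [hR, Matrix.mul_one, Matrix.mul_assoc P]

variable [DecidableEq n]

theorem trace_conj_vdb {P P' : Matrix n n ℂ} {R R' : Matrix m m ℂ} (hP : P * P' = 1)
    (hR : R' * R = 1) (x X X' : Matrix n m ℂ) (y Y Y' : Matrix m n ℂ) :
    ((1 + P * x * R' * (R * y * P'))⁻¹ *
      (P * X * R' * (R * Y' * P') - P * X' * R' * (R * Y * P'))).trace =
      ((1 + x * y)⁻¹ * (X * Y' - X' * Y)).trace := by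
  have h1 : (1 : Matrix n n ℂ) + P * (x * y) * P' = P * (1 + x * y) * P' := by
    rw [Matrix.mul_add, Matrix.add_mul, Matrix.mul_one, hP]
  rw [conj_rect hR, conj_rect hR, conj_rect hR, h1, inv_mul_rev, inv_mul_rev,
    Matrix.inv_eq_left_inv hP, Matrix.inv_eq_right_inv hP, ← Matrix.sub_mul, ← Matrix.mul_sub,
    ← Matrix.mul_assoc P, conj_mul_conj (mul_eq_one_comm.1 hP), trace_conj (mul_eq_one_comm.1 hP)]

/-- The trace identity behind (QH2). The first vector is the fundamental one, `(xA - Bx, yB - Ay)`,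
and the second, `(X, Y)`, is arbitrary. Each term is rotated until `A` or `B` comes last, with the
push-through identity moving the inverses across. -/
theorem trace_fundamental_vdb {x X : Matrix n m ℂ} {y Y : Matrix m n ℂ} (h : IsUnit (1 + x * y))
    (A : Matrix m m ℂ) (B : Matrix n n ℂ) :
    ((1 + x * y)⁻¹ * ((x * A - B * x) * Y - X * (y * B - A * y))).trace -
      ((1 + y * x)⁻¹ * ((y * B - A * y) * X - Y * (x * A - B * x))).trace =
    (((1 + y * x)⁻¹ * (Y * x + y * X) + (Y * x + y * X) * (1 + y * x)⁻¹) * A).trace -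
      (((1 + x * y)⁻¹ * (X * y + x * Y) + (X * y + x * Y) * (1 + x * y)⁻¹) * B).trace := by
  have hk := isUnit_one_add_mul_comm h
  have e1 := mul_inv_one_add h
  have e2 := mul_inv_one_add hk
  set k := (1 + y * x)⁻¹
  set l := (1 + x * y)⁻¹
  have t1 : (l * (x * (A * Y))).trace = (Y * (x * (k * A))).trace := by
    have e : l * (x * (A * Y)) = l * x * A * Y := by simp only [Matrix.mul_assoc]
    rw [e, Matrix.trace_mul_comm, ← e1]
    simp only [Matrix.mul_assoc]
  have t2 : (l * (X * (A * y))).trace = (k * (y * (X * A))).trace := by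
    have e : l * (X * (A * y)) = l * (X * A) * y := by simp only [Matrix.mul_assoc]
    rw [e, Matrix.trace_mul_comm, ← Matrix.mul_assoc, e2]
    simp only [Matrix.mul_assoc]
  have t3 : (k * (A * (y * X))).trace = (y * (X * (k * A))).trace := by
    have e : k * (A * (y * X)) = k * A * (y * X) := by simp only [Matrix.mul_assoc]
    rw [e, Matrix.trace_mul_comm]
    simp only [Matrix.mul_assoc]
  have t4 : (l * (B * (x * Y))).trace = (x * (Y * (l * B))).trace := by
    have e : l * (B * (x * Y)) = l * B * (x * Y) := by simp only [Matrix.mul_assoc]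
    rw [e, Matrix.trace_mul_comm]
    simp only [Matrix.mul_assoc]
  have t5 : (k * (y * (B * X))).trace = (X * (y * (l * B))).trace := by
    have e : k * (y * (B * X)) = k * y * B * X := by simp only [Matrix.mul_assoc]
    rw [e, Matrix.trace_mul_comm, ← e2]
    simp only [Matrix.mul_assoc]
  have t6 : (k * (Y * (B * x))).trace = (l * (x * (Y * B))).trace := by
    have e : k * (Y * (B * x)) = k * (Y * B) * x := by simp only [Matrix.mul_assoc]
    rw [e, Matrix.trace_mul_comm, ← Matrix.mul_assoc, e1]
    simp only [Matrix.mul_assoc]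
  simp only [Matrix.mul_add, Matrix.add_mul, Matrix.mul_sub, Matrix.sub_mul, Matrix.trace_add,
    Matrix.trace_sub, Matrix.mul_assoc, t1, t2, t3, t4, t5, t6]
  ring

/-- The linear algebra of (QH3): `h1`, `h2` say that `(X, Y)` lies in the kernel of the form, and
`h3`, `h4` that it lies in the kernel of `dμ`. Multiplying out `h1` and inserting the others gives
`2X = 2xYx`, and symmetrically `Y = yXy`. Then `yX(1 + yx) = yX + Yx = 0`, so `yX = 0` and both
vanish. -/
theorem eq_zero_of_vdb {x X : Matrix n m ℂ} {y Y : Matrix m n ℂ} (h : IsUnit (1 + x * y))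
    (h1 : (1 + x * y)⁻¹ * X + X * (1 + y * x)⁻¹ = 0)
    (h2 : (1 + y * x)⁻¹ * Y + Y * (1 + x * y)⁻¹ = 0)
    (h3 : Y * x + y * X = 0) (h4 : X * y + x * Y = 0) : X = 0 ∧ Y = 0 := by
  have key : ∀ {m n : Type} [Fintype m] [DecidableEq m] [Fintype n] [DecidableEq n]
      {x X : Matrix n m ℂ} {y Y : Matrix m n ℂ}, IsUnit (1 + x * y) →
      (1 + x * y)⁻¹ * X + X * (1 + y * x)⁻¹ = 0 → Y * x + y * X = 0 → X * y + x * Y = 0 →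
      X = x * Y * x := by
    intro m n _ _ _ _ x X y Y h h1 h3 h4
    have hk := isUnit_one_add_mul_comm h
    have h5 : X * (1 + y * x) + (1 + x * y) * X = 0 := by
      have e : X * (1 + y * x) + (1 + x * y) * X =
          (1 + x * y) * ((1 + x * y)⁻¹ * X + X * (1 + y * x)⁻¹) * (1 + y * x) := by
        rw [Matrix.mul_add (1 + x * y), ← Matrix.mul_assoc, isUnit_mul_inv h, Matrix.one_mul, Matrix.add_mul X,
          Matrix.mul_assoc (1 + x * y), Matrix.mul_assoc X, isUnit_inv_mul hk, Matrix.mul_one]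
      rw [e, h1, Matrix.mul_zero, Matrix.zero_mul]
    have h6 : X * (y * x) = -(x * Y * x) := by
      rw [← Matrix.mul_assoc, eq_neg_of_add_eq_zero_left h4, Matrix.neg_mul]
    have h7 : x * y * X = -(x * Y * x) := by
      rw [Matrix.mul_assoc, eq_neg_of_add_eq_zero_right h3, Matrix.mul_neg, ← Matrix.mul_assoc]
    rw [Matrix.mul_add, Matrix.add_mul, h6, h7, Matrix.mul_one, Matrix.one_mul] at h5
    have h8 : (2 : ℂ) • (X - x * Y * x) = 0 := by
      rw [two_smul, ← h5]
      abel
    exact sub_eq_zero.1 ((smul_eq_zero.1 h8).resolve_left two_ne_zero)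
  have hk := isUnit_one_add_mul_comm h
  have hX : X = x * Y * x := key h h1 h3 h4
  have hY : Y = y * X * y := key hk h2 h4 h3
  have h5 : y * X * (1 + y * x) = 0 := by
    rw [Matrix.mul_add, Matrix.mul_one, ← Matrix.mul_assoc, ← hY, add_comm, h3]
  have h6 : y * X = 0 := by
    have := congrArg (· * (1 + y * x)⁻¹) h5
    simpa only [Matrix.mul_assoc, isUnit_mul_inv hk, Matrix.mul_one, Matrix.zero_mul] using this
  have hY0 : Y = 0 := by rw [hY, h6, Matrix.zero_mul]
  exact ⟨by rw [hX, hY0, Matrix.mul_zero, Matrix.zero_mul], hY0⟩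

end TraceIdentities

/-! ### The Van den Bergh spaces -/

section Vdb

variable (d : Fin 2 → ℕ)

/-- The points of the Van den Bergh space. -/
abbrev VdbPt : Type :=
  {p : Matrix (Fin (d 1)) (Fin (d 0)) ℂ × Matrix (Fin (d 0)) (Fin (d 1)) ℂ //
    IsUnit (1 + p.1 * p.2)}

/-- The generators of the regular functions on the Van den Bergh space. -/
def vdbGen : Set (VdbPt d → ℂ) :=
  {F | ∃ i j, F = fun p => p.1.1 i j} ∪ {F | ∃ i j, F = fun p => p.1.2 i j} ∪
    {F | ∃ i j, F = fun p =>
      (1 + p.1.1 * p.1.2 : Matrix (Fin (d 1)) (Fin (d 1)) ℂ)⁻¹ i j} ∪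
    {F | ∃ i j, F = fun p =>
      (1 + p.1.2 * p.1.1 : Matrix (Fin (d 0)) (Fin (d 0)) ℂ)⁻¹ i j}

/-- The Van den Bergh space of pairs `(x, y)` with `1 + x y` invertible. -/
def vdbSpace : FunSpace where
  Pt := VdbPt d
  reg := Algebra.adjoin ℂ (vdbGen d)

theorem entriesIn_vdb_x : EntriesIn (vdbSpace d).reg fun p : VdbPt d => p.1.1 :=
  fun i j => Algebra.subset_adjoin (R := ℂ) (A := VdbPt d → ℂ) (Or.inl (Or.inl (Or.inl ⟨i, j, rfl⟩)))

theorem entriesIn_vdb_y : EntriesIn (vdbSpace d).reg fun p : VdbPt d => p.1.2 :=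
  fun i j => Algebra.subset_adjoin (R := ℂ) (A := VdbPt d → ℂ) (Or.inl (Or.inl (Or.inr ⟨i, j, rfl⟩)))

theorem entriesIn_vdb_l : EntriesIn (vdbSpace d).reg fun p : VdbPt d => (1 + p.1.1 * p.1.2)⁻¹ :=
  fun i j => Algebra.subset_adjoin (R := ℂ) (A := VdbPt d → ℂ) (Or.inl (Or.inr ⟨i, j, rfl⟩))

theorem entriesIn_vdb_k : EntriesIn (vdbSpace d).reg fun p : VdbPt d => (1 + p.1.2 * p.1.1)⁻¹ :=
  fun i j => Algebra.subset_adjoin (R := ℂ) (A := VdbPt d → ℂ) (Or.inr ⟨i, j, rfl⟩)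

/-- The coordinate `x`. -/
def vdbX : Matrix (Fin (d 1)) (Fin (d 0)) (vdbSpace d).reg := (entriesIn_vdb_x d).toMat

/-- The coordinate `y`. -/
def vdbY : Matrix (Fin (d 0)) (Fin (d 1)) (vdbSpace d).reg := (entriesIn_vdb_y d).toMat

theorem isUnit_vdb : IsUnit (1 + vdbX d * vdbY d) :=
  isUnit_of_val (X := vdbSpace d) (G := (entriesIn_vdb_l d).toMat) fun p => by
    rw [val_add, val_one, val_mul]
    exact isUnit_mul_inv p.2

theorem isUnit_vdb' : IsUnit (1 + vdbY d * vdbX d) := isUnit_one_add_mul_comm (isUnit_vdb d)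

/-- The coordinates on the Van den Bergh space. -/
def vdbCoord : (Fin (d 1) × Fin (d 0)) ⊕ (Fin (d 0) × Fin (d 1)) → (vdbSpace d).reg :=
  Sum.elim (fun p => vdbX d p.1 p.2) fun p => vdbY d p.1 p.2

/-- The matrix of variables `x`. -/
def vdbVarX : Matrix (Fin (d 1)) (Fin (d 0))
    (MvPolynomial ((Fin (d 1) × Fin (d 0)) ⊕ (Fin (d 0) × Fin (d 1))) ℂ) :=
  fun i j => MvPolynomial.X (Sum.inl (i, j))

/-- The matrix of variables `y`. -/
def vdbVarY : Matrix (Fin (d 0)) (Fin (d 1))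
    (MvPolynomial ((Fin (d 1) × Fin (d 0)) ⊕ (Fin (d 0) × Fin (d 1))) ℂ) :=
  fun i j => MvPolynomial.X (Sum.inr (i, j))

theorem map_vdbVarX {S : Type} [CommRing S] [Algebra ℂ S]
    (t : (Fin (d 1) × Fin (d 0)) ⊕ (Fin (d 0) × Fin (d 1)) → S) :
    (vdbVarX d).map (MvPolynomial.aeval t : _ →ₐ[ℂ] S) = fun i j => t (Sum.inl (i, j)) := by
  ext i j
  exact MvPolynomial.aeval_X t _

theorem map_vdbVarY {S : Type} [CommRing S] [Algebra ℂ S]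
    (t : (Fin (d 1) × Fin (d 0)) ⊕ (Fin (d 0) × Fin (d 1)) → S) :
    (vdbVarY d).map (MvPolynomial.aeval t : _ →ₐ[ℂ] S) = fun i j => t (Sum.inr (i, j)) := by
  ext i j
  exact MvPolynomial.aeval_X t _

theorem map_one_add_mul {m n R S : Type} [Fintype m] [Fintype n] [DecidableEq n] [CommRing R]
    [CommRing S] (φ : R →+* S) (F : Matrix n m R) (G : Matrix m n R) :
    (1 + F * G).map φ = 1 + F.map φ * G.map φ := by
  rw [Matrix.map_add φ (map_add φ), Matrix.map_one φ (map_zero φ) (map_one φ), Matrix.map_mul]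

/-- One determinant is enough for both inverses among the generators, since `det(1 + xy) = det(1 +
yx)`. -/
theorem vdbSpace_isBasicOpen :
    IsBasicOpen (vdbSpace d) (1 + vdbVarX d * vdbVarY d).det (vdbCoord d) where
  inj p p' h := Subtype.ext (Prod.ext (Matrix.ext fun i j => h (Sum.inl (i, j)))
    (Matrix.ext fun i j => h (Sum.inr (i, j))))
  surj t ht := by
    let x : Matrix (Fin (d 1)) (Fin (d 0)) ℂ := fun i j => t (Sum.inl (i, j))
    let y : Matrix (Fin (d 0)) (Fin (d 1)) ℂ := fun i j => t (Sum.inr (i, j))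
    have h : IsUnit (1 + x * y) := by
      rw [Matrix.isUnit_iff_isUnit_det, isUnit_iff_ne_zero]
      convert ht using 1
      rw [← MvPolynomial.aeval_eq_eval, AlgHom.map_det]
      congr 1
      refine Eq.trans ?_ (map_one_add_mul (MvPolynomial.aeval t : _ →ₐ[ℂ] ℂ).toRingHom _ _).symm
      exact congrArg₂ (fun a b => 1 + a * b) (map_vdbVarX d t).symm (map_vdbVarY d t).symm
    exact ⟨⟨(x, y), h⟩, by rintro (s | s) <;> rfl⟩
  unit := by
    rw [AlgHom.map_det]
    refine (Matrix.isUnit_iff_isUnit_det _).1 ?_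
    have e : (MvPolynomial.aeval (vdbCoord d)).mapMatrix (1 + vdbVarX d * vdbVarY d) =
        1 + vdbX d * vdbY d :=
      (map_one_add_mul (MvPolynomial.aeval (vdbCoord d) : _ →ₐ[ℂ] _).toRingHom _ _).trans
        (congrArg₂ (fun a b => 1 + a * b) (map_vdbVarX d _) (map_vdbVarY d _))
    rw [e]
    exact isUnit_vdb d
  gen := by
    refine gen_of_adjoin (s := vdbGen d) rfl fun F hF => ?_
    obtain ⟨F, hF'⟩ := F
    rcases hF with ((⟨i, j, rfl⟩ | ⟨i, j, rfl⟩) | ⟨i, j, rfl⟩) | ⟨i, j, rfl⟩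
    · exact ⟨MvPolynomial.X (Sum.inl (i, j)), 0, by
        rw [pow_zero, mul_one, MvPolynomial.aeval_X]; rfl⟩
    · exact ⟨MvPolynomial.X (Sum.inr (i, j)), 0, by
        rw [pow_zero, mul_one, MvPolynomial.aeval_X]; rfl⟩
    · have e : (1 + vdbVarX d * vdbVarY d).map (MvPolynomial.aeval (vdbCoord d)) =
          1 + vdbX d * vdbY d :=
        (map_one_add_mul (MvPolynomial.aeval (vdbCoord d) : _ →ₐ[ℂ] _).toRingHom _ _).trans
          (congrArg₂ (fun a b => 1 + a * b) (map_vdbVarX d _) (map_vdbVarY d _))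
      obtain ⟨g, n, h⟩ := exists_gen_inv e (isUnit_vdb d) 1 (mul_one _).symm i j
      refine ⟨g, n, ?_⟩
      rw [← h]
      congr 1
      refine Subtype.ext (funext fun p => ?_)
      have h1 := congrFun (congrFun (val_inv (isUnit_vdb d) p) i) j
      rw [val_add, val_one, val_mul] at h1
      exact h1.symm
    · have e : (1 + vdbVarY d * vdbVarX d).map (MvPolynomial.aeval (vdbCoord d)) =
          1 + vdbY d * vdbX d :=
        (map_one_add_mul (MvPolynomial.aeval (vdbCoord d) : _ →ₐ[ℂ] _).toRingHom _ _).trans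
          (congrArg₂ (fun a b => 1 + a * b) (map_vdbVarY d _) (map_vdbVarX d _))
      obtain ⟨g, n, h⟩ := exists_gen_inv e (isUnit_vdb' d)
        (f := (1 + vdbVarX d * vdbVarY d).det) 1
        (by rw [mul_one, Matrix.det_one_add_mul_comm]) i j
      refine ⟨g, n, ?_⟩
      rw [← h]
      congr 1
      refine Subtype.ext (funext fun p => ?_)
      have h1 := congrFun (congrFun (val_inv (isUnit_vdb' d) p) i) j
      rw [val_add, val_one, val_mul] at h1
      exact h1.symm

end Vdb

end FissionVar

end

/-! ### The quasi-Hamiltonian structure of the Van den Bergh spaces -/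

noncomputable section

namespace FissionVar

open FunSpace

section Vdb

variable (d : Fin 2 → ℕ)

theorem one_add_conj_inv {m n : Type} [Fintype m] [DecidableEq m] [Fintype n] [DecidableEq n]
    (P : GL n ℂ) (R : GL m ℂ) (x : Matrix n m ℂ) (y : Matrix m n ℂ) :
    (1 + P.val * x * (R⁻¹).val * (R.val * y * (P⁻¹).val))⁻¹ =
      P.val * (1 + x * y)⁻¹ * (P⁻¹).val := by
  have h1 : (1 : Matrix n n ℂ) + P.val * (x * y) * (P⁻¹).val =
      P.val * (1 + x * y) * (P⁻¹).val := by
    rw [Matrix.mul_add, Matrix.add_mul, Matrix.mul_one, Units.mul_inv]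
  rw [conj_rect (Units.inv_mul R), h1, inv_mul_rev, inv_mul_rev,
    Matrix.inv_eq_left_inv (Units.mul_inv P), Matrix.inv_eq_right_inv (Units.mul_inv P),
    ← Matrix.mul_assoc]

theorem isUnit_one_add_conj {m n : Type} [Fintype m] [DecidableEq m] [Fintype n] [DecidableEq n]
    (P : GL n ℂ) (R : GL m ℂ) {x : Matrix n m ℂ} {y : Matrix m n ℂ} (h : IsUnit (1 + x * y)) :
    IsUnit (1 + P.val * x * (R⁻¹).val * (R.val * y * (P⁻¹).val)) := by
  have h1 : (1 : Matrix n n ℂ) + P.val * (x * y) * (P⁻¹).val =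
      P.val * (1 + x * y) * (P⁻¹).val := by
    rw [Matrix.mul_add, Matrix.add_mul, Matrix.mul_one, Units.mul_inv]
  rw [conj_rect (Units.inv_mul R), h1]
  exact (P.isUnit.mul h).mul (P⁻¹).isUnit

variable {d} in
/-- The action on the points of the Van den Bergh space. -/
def vdbAct (g : GLProd d) (p : VdbPt d) : VdbPt d :=
  ⟨((g 1).val * p.1.1 * ((g 0)⁻¹).val, (g 0).val * p.1.2 * ((g 1)⁻¹).val),
    isUnit_one_add_conj (g 1) (g 0) p.2⟩

theorem vdbAct_regular {f : VdbPt d → ℂ} (hf : f ∈ (vdbSpace d).reg) :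
    (fun p : GLProd d × VdbPt d => f (vdbAct p.1 p.2)) ∈ regGLProd d (vdbSpace d) := by
  have hg : ∀ i, EntriesIn (regGLProd d (vdbSpace d))
      fun p : GLProd d × VdbPt d => (p.1 i).val := fun i => regGLProd_val d (vdbSpace d) i
  have hg' : ∀ i, EntriesIn (regGLProd d (vdbSpace d))
      fun p : GLProd d × VdbPt d => ((p.1 i)⁻¹).val := fun i => regGLProd_inv_val d (vdbSpace d) i
  have hs : ∀ {m n : Type} {F : VdbPt d → Matrix m n ℂ}, EntriesIn (vdbSpace d).reg F →
      EntriesIn (regGLProd d (vdbSpace d)) fun p : GLProd d × VdbPt d => F p.2 :=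
    fun hF i j => regGLProd_comp_snd d (vdbSpace d) (hF i j)
  refine comp_mem_of_adjoin (s := vdbGen d) (φ := fun p : GLProd d × VdbPt d => vdbAct p.1 p.2)
    ?_ hf
  rintro _ (((⟨i, j, rfl⟩ | ⟨i, j, rfl⟩) | ⟨i, j, rfl⟩) | ⟨i, j, rfl⟩)
  · exact ((hg 1).mul (hs (entriesIn_vdb_x d))).mul (hg' 0) i j
  · exact ((hg 0).mul (hs (entriesIn_vdb_y d))).mul (hg' 1) i j
  · exact (congrArg (· ∈ regGLProd d (vdbSpace d)) (funext fun p : GLProd d × VdbPt d =>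
      congrFun (congrFun (one_add_conj_inv (p.1 1) (p.1 0) p.2.1.1 p.2.1.2) i) j)).mpr
      (((hg 1).mul (hs (entriesIn_vdb_l d))).mul (hg' 1) i j)
  · exact (congrArg (· ∈ regGLProd d (vdbSpace d)) (funext fun p : GLProd d × VdbPt d =>
      congrFun (congrFun (one_add_conj_inv (p.1 0) (p.1 1) p.2.1.2 p.2.1.1) i) j)).mpr
      (((hg 0).mul (hs (entriesIn_vdb_k d))).mul (hg' 0) i j)

/-- The action on the Van den Bergh space. -/
def vdbActHom (g : GLProd d) : Hom (vdbSpace d) (vdbSpace d) where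
  toFun := vdbAct g
  regular _ hf := comp_mk_mem_of_regGLProd g (vdbAct_regular d hf)

theorem der_push_vdbX (g : GLProd d) {p : (vdbSpace d).Pt} (v : (vdbSpace d).Tangent p) :
    der ((vdbActHom d g).push v) (vdbX d) = (g 1).val * der v (vdbX d) * ((g 0)⁻¹).val :=
  der_of_val_eq v (F' := (vdbX d).map (vdbActHom d g).pull) fun _ => rfl

theorem der_push_vdbY (g : GLProd d) {p : (vdbSpace d).Pt} (v : (vdbSpace d).Tangent p) :
    der ((vdbActHom d g).push v) (vdbY d) = (g 0).val * der v (vdbY d) * ((g 1)⁻¹).val :=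
  der_of_val_eq v (F' := (vdbY d).map (vdbActHom d g).pull) fun _ => rfl

/-- The moment map of the Van den Bergh space. -/
def vdbμ : ∀ i, Matrix (Fin (d i)) (Fin (d i)) (vdbSpace d).reg
  | 0 => 1 + vdbY d * vdbX d
  | 1 => (1 + vdbX d * vdbY d)⁻¹

/-- Regularity is read off from the expression as fusion terms of invertible matrices. -/
theorem isRegular_vdbForm {X : FunSpace} {d : Fin 2 → ℕ} {x : Matrix (Fin (d 1)) (Fin (d 0)) X.reg}
    {y : Matrix (Fin (d 0)) (Fin (d 1)) X.reg} (h : IsUnit (1 + x * y)) :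
    Form.IsRegular (X := X) fun _ v w => vdbForm x y v w :=
  ((hasExtDeriv_fusionTerms _ (by
    simp only [List.mem_cons, List.not_mem_nil, or_false, forall_eq_or_imp, forall_eq]
    exact ⟨isUnit_blocks_upper, isUnit_blocks_lower, isUnit_blocks_upper⟩)).congr
    (fun _ v w => (fusionTerms_eq_vdbForm h v w).symm) fun _ _ _ _ => rfl).isRegular

/-- The Van den Bergh space. -/
def vdb : QHDatum (Fin 2) d where
  X := vdbSpace d
  affine := (vdbSpace_isBasicOpen d).isAffine
  act := vdbActHom d
  act_one p := Subtype.ext (Prod.ext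
    (by change 1 * p.1.1 * 1 = p.1.1; rw [Matrix.one_mul, Matrix.mul_one])
    (by change 1 * p.1.2 * 1 = p.1.2; rw [Matrix.one_mul, Matrix.mul_one]))
  act_mul g g' p := by
    have e : ∀ i, ((g i * g' i)⁻¹).val = ((g' i)⁻¹).val * ((g i)⁻¹).val := fun i => by
      rw [_root_.mul_inv_rev, Units.val_mul]
    refine Subtype.ext (Prod.ext ?_ ?_)
    · change (g 1 * g' 1).val * p.1.1 * ((g 0 * g' 0)⁻¹).val =
        (g 1).val * ((g' 1).val * p.1.1 * ((g' 0)⁻¹).val) * ((g 0)⁻¹).val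
      rw [e, Units.val_mul]
      simp only [Matrix.mul_assoc]
    · change (g 0 * g' 0).val * p.1.2 * ((g 1 * g' 1)⁻¹).val =
        (g 0).val * ((g' 0).val * p.1.2 * ((g' 1)⁻¹).val) * ((g 1)⁻¹).val
      rw [e, Units.val_mul]
      simp only [Matrix.mul_assoc]
  act_regular _ hf := vdbAct_regular d hf
  μ := vdbμ d
  μ_unit := by
    intro i
    fin_cases i
    · exact isUnit_vdb' d
    · exact isUnit_inv (isUnit_vdb d)
  μ_act g p
    | 0 => by
      have h : ∀ p : (vdbSpace d).Pt, val p (vdbμ d 0) = 1 + val p (vdbY d) * val p (vdbX d) :=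
        fun p => by rw [vdbμ, val_add, val_one, val_mul]
      refine (h _).trans (Eq.trans ?_
        (congrArg (fun F => (g 0).val * F * ((g 0)⁻¹).val) (h p).symm))
      change 1 + (g 0).val * p.1.2 * ((g 1)⁻¹).val * ((g 1).val * p.1.1 * ((g 0)⁻¹).val) =
        (g 0).val * (1 + p.1.2 * p.1.1) * ((g 0)⁻¹).val
      rw [conj_rect (Units.inv_mul (g 1)), Matrix.mul_add, Matrix.add_mul, Matrix.mul_one,
        Units.mul_inv]
    | 1 => by
      have h : ∀ p : (vdbSpace d).Pt, val p (vdbμ d 1) =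
          (1 + val p (vdbX d) * val p (vdbY d))⁻¹ :=
        fun p => by rw [vdbμ, val_inv (isUnit_vdb d), val_add, val_one, val_mul]
      refine (h _).trans (Eq.trans ?_
        (congrArg (fun F => (g 1).val * F * ((g 1)⁻¹).val) (h p).symm))
      exact one_add_conj_inv (g 1) (g 0) _ _
  ω _ v w := vdbForm (vdbX d) (vdbY d) v w
  ω_regular := isRegular_vdbForm (isUnit_vdb d)
  ω_act g p v w := by
    rw [vdbForm, vdbForm, der_push_vdbX, der_push_vdbX, der_push_vdbY, der_push_vdbY]
    have h1 := trace_conj_vdb (Units.mul_inv (g 1)) (Units.inv_mul (g 0)) p.1.1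
      (der v (vdbX d)) (der w (vdbX d)) p.1.2 (der v (vdbY d)) (der w (vdbY d))
    have h2 := trace_conj_vdb (Units.mul_inv (g 0)) (Units.inv_mul (g 1)) p.1.2
      (der v (vdbY d)) (der w (vdbY d)) p.1.1 (der v (vdbX d)) (der w (vdbX d))
    exact congrArg (fun r => (1 / 2 : ℂ) * r) (congrArg₂ (· - ·) h1 h2)

/-- The block `a = -(1 + yx)⁻¹y` is the one that clears the upper right corner of the product,
leaving a block lower triangular matrix. Its last diagonal block is `1 + xa = (1 + xy)⁻¹`. -/
theorem prod_stokes_eq {R : Type} [CommRing R] {d : Fin 2 → ℕ}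
    {x : Matrix (Fin (d 1)) (Fin (d 0)) R} {y : Matrix (Fin (d 0)) (Fin (d 1)) R}
    (h : IsUnit (1 + x * y)) :
    blocks d 1 y 0 1 * (blocks d 1 0 x 1 * blocks d 1 (-((1 + y * x)⁻¹ * y)) 0 1) =
      blocks d 1 0 (x * (1 + y * x)⁻¹) 1 * blocks d (1 + y * x) 0 0 (1 + x * y)⁻¹ := by
  have hk := isUnit_one_add_mul_comm h
  have e1 : (1 + y * x) * ((1 + y * x)⁻¹ * y) = y := by
    rw [← Matrix.mul_assoc, isUnit_mul_inv hk, Matrix.one_mul]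
  have e2 : x * ((1 + y * x)⁻¹ * y) = 1 - (1 + x * y)⁻¹ := by
    rw [← Matrix.mul_assoc, mul_inv_one_add_mul h]
  have e3 : x * (1 + y * x)⁻¹ * (1 + y * x) = x := by
    rw [Matrix.mul_assoc, isUnit_inv_mul hk, Matrix.mul_one]
  rw [← Matrix.mul_assoc, blocks_mul, blocks_mul, blocks_mul, blocks_inj]
  simp only [Matrix.one_mul, Matrix.mul_one, Matrix.zero_mul, Matrix.mul_zero, add_zero, zero_add,
    Matrix.mul_neg, e1, e2, e3]
  exact ⟨trivial, by abel, trivial, by abel⟩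

namespace FunSpace

section

variable {X : FunSpace} {d : Fin 2 → ℕ} {x : Matrix (Fin (d 1)) (Fin (d 0)) X.reg}
  {y : Matrix (Fin (d 0)) (Fin (d 1)) X.reg} {p : X.Pt}

/-- The form consists of fusion terms of unitriangular factors, whose own three-forms vanish. Its
derivative is thus the three-form of their product, which by `prod_stokes_eq` depends only on the
two diagonal blocks, the components of the moment map. -/
theorem hasExtDeriv_vdbForm (hU : IsUnit (1 + x * y)) :
    Form.HasExtDeriv (X := X) (fun _ v w => vdbForm x y v w)
      fun _ u v w => chi (1 + y * x) u v w + chi (1 + x * y)⁻¹ u v w := by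
  refine (hasExtDeriv_fusionTerms [blocks d 1 y 0 1,
      blocks d 1 0 x 1, blocks d 1 (-((1 + y * x)⁻¹ * y)) 0 1] ?_).congr
      (fun p v w => (fusionTerms_eq_vdbForm hU v w).symm) fun p u v w => ?_
  · simp only [List.mem_cons, List.not_mem_nil, or_false, forall_eq_or_imp, forall_eq]
    exact ⟨isUnit_blocks_upper, isUnit_blocks_lower, isUnit_blocks_upper⟩
  · simp only [List.prod_cons, List.prod_nil, mul_one, List.map_cons, List.map_nil,
      List.sum_cons, List.sum_nil, prod_stokes_eq hU, chi_blocks_upper, chi_blocks_lower,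
      add_zero, sub_zero]
    rw [chi_blocks_lower_mul_diag v w (isUnit_one_add_mul_comm hU) (isUnit_inv hU)]

theorem val_one_add_mul {m n : Type} [Fintype m] [Fintype n] [DecidableEq n] (p : X.Pt)
    (x : Matrix n m X.reg) (y : Matrix m n X.reg) :
    val p (1 + x * y) = 1 + val p x * val p y := by
  rw [val_add, val_one, val_mul]

theorem der_one_add_mul {m n : Type} [Fintype m] [Fintype n] [DecidableEq n] (w : X.Tangent p)
    (x : Matrix n m X.reg) (y : Matrix m n X.reg) :
    der w (1 + x * y) = der w x * val p y + val p x * der w y := by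
  rw [der_add, der_one, der_mul, zero_add, add_comm]

theorem mcR_inv {m : Type} [Fintype m] [DecidableEq m] {F : Matrix m m X.reg} (h : IsUnit F)
    (w : X.Tangent p) : mcR F⁻¹ w = -mcL F w := by
  rw [mcR, der_inv w h, val_inv h, inv_inv_of_isUnit (isUnit_val h p), Matrix.neg_mul,
    Matrix.mul_assoc, isUnit_inv_mul (isUnit_val h p), Matrix.mul_one, mcL]

theorem vdbForm_fundamental (hU : IsUnit (1 + x * y)) {v : X.Tangent p} (w : X.Tangent p)
    {A : Matrix (Fin (d 0)) (Fin (d 0)) ℂ} {B : Matrix (Fin (d 1)) (Fin (d 1)) ℂ}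
    (hX : der v x = val p x * A - B * val p x) (hY : der v y = val p y * B - A * val p y) :
    vdbForm x y v w = (1 / 2 : ℂ) * (((mcL (1 + y * x) w + mcR (1 + y * x) w) * A).trace +
      ((mcL (1 + x * y)⁻¹ w + mcR (1 + x * y)⁻¹ w) * B).trace) := by
  have hU0 := isUnit_val hU p
  rw [val_one_add_mul] at hU0
  rw [vdbForm, hX, hY, trace_fundamental_vdb hU0, mcL_inv w hU, mcR_inv hU, mcL, mcL, mcR, mcR,
    val_one_add_mul, val_one_add_mul, der_one_add_mul, der_one_add_mul, ← neg_add, Matrix.neg_mul,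
    Matrix.trace_neg, ← sub_eq_add_neg,
    add_comm ((der w x * val p y + val p x * der w y) * _)]

/-- The hypothesis `hex` says that `dx` and `dy` can be prescribed freely. Testing with one of them
zero and using nondegeneracy of the trace turns the vanishing of the form into two matrix equations.
-/
theorem der_eq_zero_of_vdbForm (hU : IsUnit (1 + x * y)) {v : X.Tangent p}
    (hex : ∀ (X' : Matrix (Fin (d 1)) (Fin (d 0)) ℂ) (Y' : Matrix (Fin (d 0)) (Fin (d 1)) ℂ),
      ∃ w : X.Tangent p, der w x = X' ∧ der w y = Y')
    (hv : ∀ w, vdbForm x y v w = 0) (h0 : der v (1 + y * x) = 0)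
    (h1 : der v (1 + x * y)⁻¹ = 0) : der v x = 0 ∧ der v y = 0 := by
  have hU0 := isUnit_val hU p
  rw [val_one_add_mul] at hU0
  have hω : ∀ (X' : Matrix (Fin (d 1)) (Fin (d 0)) ℂ) (Y' : Matrix (Fin (d 0)) (Fin (d 1)) ℂ),
      ((1 + val p x * val p y)⁻¹ * (der v x * Y' - X' * der v y)).trace -
      ((1 + val p y * val p x)⁻¹ * (der v y * X' - Y' * der v x)).trace = 0 := by
    intro X' Y'
    obtain ⟨w, rfl, rfl⟩ := hex X' Y'
    exact (mul_eq_zero.1 (hv w)).resolve_left (by norm_num)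
  have h1' : (1 + val p x * val p y)⁻¹ * der v x + der v x * (1 + val p y * val p x)⁻¹ = 0 := by
    refine Matrix.ext_iff_trace_mul_right.2 fun Y' => ?_
    have := hω 0 Y'
    rw [Matrix.zero_mul, Matrix.mul_zero, sub_zero, zero_sub, Matrix.mul_neg, Matrix.trace_neg,
      sub_neg_eq_add, ← Matrix.mul_assoc, ← Matrix.mul_assoc,
      Matrix.trace_mul_comm (_ * Y'), ← Matrix.mul_assoc] at this
    rw [Matrix.add_mul, Matrix.trace_add, this, Matrix.zero_mul, Matrix.trace_zero]
  have h2 : (1 + val p y * val p x)⁻¹ * der v y + der v y * (1 + val p x * val p y)⁻¹ = 0 := by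
    refine Matrix.ext_iff_trace_mul_right.2 fun X' => ?_
    have := hω X' 0
    rw [Matrix.zero_mul, Matrix.mul_zero, sub_zero, zero_sub, Matrix.mul_neg, Matrix.trace_neg,
      ← Matrix.mul_assoc, ← Matrix.mul_assoc, Matrix.trace_mul_comm (_ * X'),
      ← Matrix.mul_assoc] at this
    rw [Matrix.add_mul, Matrix.trace_add, Matrix.zero_mul, Matrix.trace_zero]
    linear_combination -this
  have h3 := h0
  rw [der_one_add_mul] at h3
  have h4 : der v (1 + x * y) = 0 := by
    have hd := der_inv v (isUnit_inv hU)
    rwa [inv_inv_of_isUnit hU, h1, Matrix.mul_zero, Matrix.zero_mul, neg_zero] at hd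
  rw [der_one_add_mul] at h4
  exact eq_zero_of_vdb hU0 h1' h2 h3 h4

end

end FunSpace

theorem isQuasiHamiltonian_vdb : (vdb d).IsQuasiHamiltonian := by
  refine ⟨(vdbSpace_isBasicOpen d).smooth, ?_, fun p A => ?_, fun p v hv hμ => ?_⟩
  · refine (hasExtDeriv_vdbForm (isUnit_vdb d)).congr (fun _ _ _ => rfl) fun p u v w => ?_
    rw [Fin.sum_univ_two, mul_add]
    rfl
  · obtain ⟨v, hv⟩ := (vdb d).exists_fundamental A p
    refine ⟨v, hv, fun w => ?_⟩
    rw [Fin.sum_univ_two]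
    exact vdbForm_fundamental (X := vdbSpace d) (isUnit_vdb d) w
      (hv.der_of_val_act (i := 1) (j := 0) (F := vdbX d) fun g => rfl)
      (hv.der_of_val_act (i := 0) (j := 1) (F := vdbY d) fun g => rfl)
  · obtain ⟨hX, hY⟩ := der_eq_zero_of_vdbForm (X := vdbSpace d) (p := p) (isUnit_vdb d) (v := v)
      (fun X' Y' => by
        obtain ⟨w, hw⟩ := (vdbSpace_isBasicOpen d).exists_tangent p
          (Sum.elim (fun q => X' q.1 q.2) fun q => Y' q.1 q.2)
        exact ⟨w, Matrix.ext fun i j => hw (Sum.inl (i, j)),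
          Matrix.ext fun i j => hw (Sum.inr (i, j))⟩) hv (hμ 0) (hμ 1)
    refine (vdbSpace_isBasicOpen d).tangent_ext ?_
    rintro (s | s)
    · exact congrFun (congrFun hX s.1) s.2
    · exact congrFun (congrFun hY s.1) s.2

end Vdb

end FissionVar

end

/-! ### The two-form of the higher fission spaces and its value on the level set -/

noncomputable section

namespace FissionVar

open FunSpace

namespace FunSpace

section FissionForm

variable {X Y : FunSpace} {m : Type} [Fintype m] [DecidableEq m]

theorem mcL_of_val {x : X.Pt} {v : X.Tangent x}
    {F F' : Matrix m m X.reg} {P P' Q Q' : Matrix m m ℂ}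
    (hP : P * P' = 1) (hQ : Q * Q' = 1) (h : ∀ y, val y F' = P * val y F * Q) :
    mcL F' v = Q' * mcL F v * Q := by
  rw [mcL, der_of_val_eq v h, h, inv_mul_rev, inv_mul_rev, Matrix.inv_eq_right_inv hP,
    Matrix.inv_eq_right_inv hQ, mcL]
  calc Q' * ((val x F)⁻¹ * P') * (P * der v F * Q) =
      Q' * (val x F)⁻¹ * (P' * P) * der v F * Q := by simp only [Matrix.mul_assoc]
    _ = _ := by rw [mul_eq_one_comm.1 hP]; simp only [Matrix.mul_one, Matrix.mul_assoc]

theorem mcR_of_val {x : X.Pt} {v : X.Tangent x}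
    {F F' : Matrix m m X.reg} {P P' Q Q' : Matrix m m ℂ}
    (hP : P * P' = 1) (hQ : Q * Q' = 1) (h : ∀ y, val y F' = P * val y F * Q) :
    mcR F' v = P * mcR F v * P' := by
  rw [mcR, der_of_val_eq v h, h, inv_mul_rev, inv_mul_rev, Matrix.inv_eq_right_inv hP,
    Matrix.inv_eq_right_inv hQ, mcR]
  calc P * der v F * Q * (Q' * ((val x F)⁻¹ * P')) =
      P * der v F * (Q * Q') * (val x F)⁻¹ * P' := by simp only [Matrix.mul_assoc]
    _ = _ := by rw [hQ]; simp only [Matrix.mul_one, Matrix.mul_assoc]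

theorem isUnit_stokesProd {R : Type} [CommRing R] {r : ℕ} {S : Fin r → Matrix m m R}
    (h : ∀ j, IsUnit (S j)) (i : ℕ) : IsUnit (stokesProd S i) := by
  induction i with
  | zero => exact isUnit_one
  | succ i ih =>
    rw [stokesProd]
    refine IsUnit.mul ?_ ih
    split_ifs
    exacts [h _, isUnit_one]

theorem stokesProd_map {R T : Type} [CommRing R] [CommRing T] (φ : R →+* T) {r : ℕ}
    (S : Fin r → Matrix m m R) (i : ℕ) :
    (stokesProd S i).map φ = stokesProd (fun j => (S j).map φ) i := by
  induction i with
  | zero => exact Matrix.map_one _ (map_zero φ) (map_one φ)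
  | succ i ih =>
    rw [stokesProd, stokesProd, Matrix.map_mul, ih]
    congr 1
    split_ifs
    exacts [rfl, Matrix.map_one _ (map_zero φ) (map_one φ)]

theorem stokesProd_conj {r : ℕ} {S S' : Fin r → Matrix m m X.reg} {P P' : Matrix m m ℂ}
    (hP : P * P' = 1) {y : X.Pt} (h : ∀ j, val y (S' j) = P * val y (S j) * P') (i : ℕ) :
    val y (stokesProd S' i) = P * val y (stokesProd S i) * P' := by
  induction i with
  | zero => rw [stokesProd, stokesProd, val_one, Matrix.mul_one, hP]
  | succ i ih =>
    rw [stokesProd, stokesProd, val_mul, val_mul, ih, ← conj_mul_conj (mul_eq_one_comm.1 hP)]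
    congr 1
    split_ifs
    · exact h _
    · rw [val_one, Matrix.mul_one, hP]

/-- The two-form of the higher fission spaces, for maps `C`, `S`, `B`. -/
def fissionForm {r : ℕ} (C : Matrix m m X.reg) (S : Fin (2 * r) → Matrix m m X.reg)
    (B : Matrix m m X.reg) {x : X.Pt} (v w : X.Tangent x) : ℂ :=
  (1 / 2 : ℂ) * (wedgeTr (fun u : X.Tangent x => mcR C u)
      (fun u => val x (B * stokesProd S (2 * r)) * mcR C u *
        (val x (B * stokesProd S (2 * r)))⁻¹) v w +
    wedgeTr (fun u : X.Tangent x => mcR C u) (fun u => mcR (B * stokesProd S (2 * r)) u) v w +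
    wedgeTr (fun u : X.Tangent x => mcR (stokesProd S (2 * r) * C) u) (fun u => mcL B u) v w -
    ∑ i ∈ Finset.range (2 * r), wedgeTr (fun u : X.Tangent x => mcL (stokesProd S (i + 1) * C) u)
      (fun u => mcL (stokesProd S i * C) u) v w)

variable {r : ℕ} {C : Matrix m m X.reg} {S : Fin (2 * r) → Matrix m m X.reg}
  {B : Matrix m m X.reg}

theorem isRegular_fissionForm (hC : IsUnit C) (hS : ∀ j, IsUnit (S j)) (hB : IsUnit B) :
    Form.IsRegular (X := X) fun _ v w => fissionForm C S B v w := by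
  have hP := isUnit_stokesProd hS
  refine Form.IsRegular.smul _ (((Form.IsRegular.add ?_ ?_).add ?_).sub
    (Form.IsRegular.sum _ fun i => ?_))
  · refine isRegular_wedgeTr (isRegularMat_mcR hC) ?_
    have h := isRegularMat_val_der_val (B * stokesProd S (2 * r)) C
      (C⁻¹ * (B * stokesProd S (2 * r))⁻¹)
    simpa only [mcR, val_mul _ C⁻¹, val_inv hC, val_inv (hB.mul (hP _)), Matrix.mul_assoc] using h
  · exact isRegular_wedgeTr (isRegularMat_mcR hC) (isRegularMat_mcR (hB.mul (hP _)))
  · exact isRegular_wedgeTr (isRegularMat_mcR ((hP _).mul hC)) (isRegularMat_mcL hB)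
  · exact isRegular_wedgeTr (isRegularMat_mcL ((hP _).mul hC)) (isRegularMat_mcL ((hP _).mul hC))

theorem fissionForm_push {r : ℕ} (φ : Hom X Y) (C : Matrix m m Y.reg)
    (S : Fin (2 * r) → Matrix m m Y.reg) (B : Matrix m m Y.reg) {x : X.Pt} (v w : X.Tangent x) :
    fissionForm C S B (φ.push v) (φ.push w) =
      fissionForm (C.map φ.pull) (fun j => (S j).map φ.pull) (B.map φ.pull) v w := by
  have hL : ∀ (F : Matrix m m Y.reg) (u : X.Tangent x), mcL F (φ.push u) = mcL (F.map φ.pull) u :=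
    fun _ _ => rfl
  have hR : ∀ (F : Matrix m m Y.reg) (u : X.Tangent x), mcR F (φ.push u) = mcR (F.map φ.pull) u :=
    fun _ _ => rfl
  have hm : ∀ F G : Matrix m m Y.reg, (F * G).map φ.pull = F.map φ.pull * G.map φ.pull :=
    fun F G => Matrix.map_mul (f := φ.pull)
  have hs : ∀ i, (stokesProd S i).map φ.pull = stokesProd (fun j => (S j).map φ.pull) i :=
    fun i => stokesProd_map (φ.pull : Y.reg →+* X.reg) S i
  simp only [fissionForm, wedgeTr, hL, hR, val_map, hm, hs]

/-- Under `C ↦ PCQ`, `S ↦ PSP⁻¹`, `B ↦ PBP⁻¹` each partial product `C_i` becomes `P C_i Q`. The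
first three terms are then conjugated by `P`, whereas the left forms `C_i^*θ` in the sum see only
`Q`. -/
theorem fissionForm_conj {C' B' : Matrix m m X.reg} {S' : Fin (2 * r) → Matrix m m X.reg}
    {P P' Q Q' : Matrix m m ℂ} (hP : P * P' = 1) (hQ : Q * Q' = 1)
    (hC : ∀ y, val y C' = P * val y C * Q) (hS : ∀ j y, val y (S' j) = P * val y (S j) * P')
    (hB : ∀ y, val y B' = P * val y B * P') {x : X.Pt} (v w : X.Tangent x) :
    fissionForm C' S' B' v w = fissionForm C S B v w := by
  have hP' := mul_eq_one_comm.1 hP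
  have hs : ∀ i y, val y (stokesProd S' i) = P * val y (stokesProd S i) * P' := fun i y =>
    stokesProd_conj hP (fun j => hS j y) i
  have hb : ∀ i y, val y (B' * stokesProd S' i) = P * val y (B * stokesProd S i) * P' :=
    fun i y => by rw [val_mul, val_mul, hs, hB, conj_mul_conj hP']
  have hc : ∀ i y, val y (stokesProd S' i * C') = P * val y (stokesProd S i * C) * Q :=
    fun i y => by
      rw [val_mul, val_mul, hs, hC]
      calc _ = P * val y (stokesProd S i) * (P' * P) * val y C * Q := by
            simp only [Matrix.mul_assoc]
        _ = _ := by rw [hP', Matrix.mul_one]; simp only [Matrix.mul_assoc]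
  have r1 : ∀ u : X.Tangent x, mcR C' u = P * mcR C u * P' := fun u => mcR_of_val hP hQ hC
  have r2 : ∀ u : X.Tangent x, mcR (B' * stokesProd S' (2 * r)) u =
    P * mcR (B * stokesProd S (2 * r)) u * P' := fun u => mcR_of_val hP hP' (hb _)
  have r3 : ∀ u : X.Tangent x, mcR (stokesProd S' (2 * r) * C') u =
    P * mcR (stokesProd S (2 * r) * C) u * P' := fun u => mcR_of_val hP hQ (hc _)
  have r4 : ∀ u : X.Tangent x, mcL B' u = P * mcL B u * P' := fun u => mcL_of_val hP hP' hB
  have r5 : ∀ i (u : X.Tangent x), mcL (stokesProd S' i * C') u =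
    Q' * mcL (stokesProd S i * C) u * Q := fun i u => mcL_of_val hP hQ (hc i)
  have r6 : ∀ u : X.Tangent x, val x (B' * stokesProd S' (2 * r)) * mcR C' u *
      (val x (B' * stokesProd S' (2 * r)))⁻¹ = P * (val x (B * stokesProd S (2 * r)) * mcR C u *
      (val x (B * stokesProd S (2 * r)))⁻¹) * P' := fun u => by
    rw [r1, hb, inv_mul_rev, inv_mul_rev, Matrix.inv_eq_right_inv hP,
      Matrix.inv_eq_right_inv hP', conj_mul_conj hP']
    generalize (val x (B * stokesProd S (2 * r)))⁻¹ = b'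
    generalize val x (B * stokesProd S (2 * r)) = b
    calc P * (b * mcR C u) * P' * (P * (b' * P')) = P * (b * mcR C u) * (P' * P) * b' * P' := by
          simp only [Matrix.mul_assoc]
      _ = _ := by rw [hP']; simp only [Matrix.mul_assoc, Matrix.one_mul]
  rw [fissionForm, fissionForm]
  exact congrArg (fun z => (1 / 2 : ℂ) * z) (congrArg₂ (· - ·) (congrArg₂ (· + ·)
    (congrArg₂ (· + ·) (wedgeTr_conj hP' (r1 v) (r1 w) (r6 v) (r6 w))
      (wedgeTr_conj hP' (r1 v) (r1 w) (r2 v) (r2 w)))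
    (wedgeTr_conj hP' (r3 v) (r3 w) (r4 v) (r4 w)))
    (Finset.sum_congr rfl fun i _ => wedgeTr_conj hQ (r5 _ v) (r5 _ w) (r5 _ v) (r5 _ w)))

/-- Up to conjugation `(FG)^*θ` is `F^*θ + G^*θ̄`, and the second summand pairs to zero with itself.
This turns the terms `(γ_{i+1}, γ_i)` of the fission form into fusion terms. -/
theorem wedgeTr_mcL_mul {F G : Matrix m m X.reg} (hF : IsUnit F) (hG : IsUnit G) {x : X.Pt}
    (v w : X.Tangent x) :
    wedgeTr (fun u : X.Tangent x => mcL (F * G) u) (fun u => mcL G u) v w =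
      wedgeTr (fun u : X.Tangent x => mcL F u) (fun u => mcR G u) v w := by
  have h := isUnit_mul_inv (isUnit_val hG x)
  rw [wedgeTr_conj h (mcL_mul v hF hG) (mcL_mul w hF hG) (mcL_eq v hG) (mcL_eq w hG)
    (α' := fun u : X.Tangent x => mcL F u + mcR G u) (β' := fun u : X.Tangent x => mcR G u),
    wedgeTr_add_left, wedgeTr_self, add_zero]

/-- Associativity of fusion: appending a factor at the end costs the one term that pairs the product
of the list with it. The cocycle relation between the terms of `F`, `L.prod` and `G` gives the
induction step. -/
theorem fusionTerms_concat (L : List (Matrix m m X.reg)) (hL : ∀ F ∈ L, IsUnit F)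
    {G : Matrix m m X.reg} (hG : IsUnit G) {x : X.Pt} (v w : X.Tangent x) :
    fusionTerms v w (L ++ [G]) = fusionTerms v w L +
      wedgeTr (fun u : X.Tangent x => mcL L.prod u) (fun u => mcR G u) v w := by
  induction L with
  | nil => simp [fusionTerms, wedgeTr, mcL_one, mcR_one]
  | cons F L ih =>
    have hF : IsUnit F := hL F (by simp)
    have hL' : ∀ F ∈ L, IsUnit F := fun H hH => hL H (by simp [hH])
    have hp := isUnit_list_prod hL'
    have h1 : wedgeTr (fun u : X.Tangent x => mcL F u) (fun u => mcR (L.prod * G) u) v w =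
        wedgeTr (fun u : X.Tangent x => mcL F u) (fun u => mcR L.prod u) v w +
        wedgeTr (fun u : X.Tangent x => mcL F u)
          (fun u => val x L.prod * mcR G u * (val x L.prod)⁻¹) v w := by
      rw [← wedgeTr_add_right]
      have : ∀ u : X.Tangent x, mcR (L.prod * G) u =
          mcR L.prod u + val x L.prod * mcR G u * (val x L.prod)⁻¹ := fun u => by
        rw [mcR_mul u hp hG, Matrix.mul_add, Matrix.add_mul, ← mcR_eq u hp]
      exact wedgeTr_congr rfl rfl (this v) (this w)
    have h2 : wedgeTr (fun u : X.Tangent x => mcL (F * L.prod) u) (fun u => mcR G u) v w =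
        wedgeTr (fun u : X.Tangent x => mcL F u)
          (fun u => val x L.prod * mcR G u * (val x L.prod)⁻¹) v w +
        wedgeTr (fun u : X.Tangent x => mcL L.prod u) (fun u => mcR G u) v w := by
      have e : ∀ u : X.Tangent x, mcL (F * L.prod) u =
          (val x L.prod)⁻¹ * mcL F u * val x L.prod + mcL L.prod u := fun u => by
        rw [mcL_mul u hF hp, Matrix.mul_add, Matrix.add_mul, ← mcL_eq u hp]
      have e' : ∀ u : X.Tangent x, mcR G u = (val x L.prod)⁻¹ *
          (val x L.prod * mcR G u * (val x L.prod)⁻¹) * val x L.prod := fun u => by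
        have h := isUnit_inv_mul (isUnit_val hp x)
        calc mcR G u = ((val x L.prod)⁻¹ * val x L.prod) * mcR G u *
              ((val x L.prod)⁻¹ * val x L.prod) := by rw [h, Matrix.one_mul, Matrix.mul_one]
          _ = _ := by simp only [Matrix.mul_assoc]
      rw [wedgeTr_congr (e v) (e w) rfl rfl
        (α' := fun u : X.Tangent x => (val x L.prod)⁻¹ * mcL F u * val x L.prod + mcL L.prod u)
        (β' := fun u : X.Tangent x => mcR G u), wedgeTr_add_left]
      congr 1
      exact wedgeTr_conj (isUnit_mul_inv (isUnit_val hp x)) rfl rfl (e' v) (e' w)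
    rw [List.cons_append, fusionTerms, fusionTerms, ih hL', List.prod_append, List.prod_singleton,
      List.prod_cons, h1, h2]
    ring

/-- With `b = 1` the term with `Ad_b` is the pairing of `C^*θ̄` with itself and the term with
`b^*θ̄` is zero. The sum is the fusion terms of the Stokes factors followed by `C`. Since the
product of the Stokes factors is `B⁻¹`, the contribution of `C` is `(C^*θ̄, B^*θ̄)`, which equals
the remaining third term and cancels it. -/
theorem fissionForm_of_level {S : Fin (2 * 2) → Matrix m m X.reg} (hC : IsUnit C)
    (hS : ∀ j, IsUnit (S j)) (hB : IsUnit B)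
    (hb : B * ([S 3, S 2, S 1, S 0] : List (Matrix m m X.reg)).prod = 1) {x : X.Pt}
    (v w : X.Tangent x) :
    fissionForm C S B v w = -(1 / 2 : ℂ) * fusionTerms v w [S 3, S 2, S 1, S 0] := by
  have s0 : stokesProd S 0 = 1 := rfl
  have s1 : stokesProd S 1 = S 0 * 1 := rfl
  have s2 : stokesProd S 2 = S 1 * (S 0 * 1) := rfl
  have s3 : stokesProd S 3 = S 2 * (S 1 * (S 0 * 1)) := rfl
  have s4 : stokesProd S 4 = S 3 * (S 2 * (S 1 * (S 0 * 1))) := rfl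
  have hL : ∀ F ∈ ([S 3, S 2, S 1, S 0] : List (Matrix m m X.reg)), IsUnit F := by
    simp only [List.mem_cons, List.not_mem_nil, or_false, forall_eq_or_imp, forall_eq]
    exact ⟨hS 3, hS 2, hS 1, hS 0⟩
  have hinv : ([S 3, S 2, S 1, S 0] : List (Matrix m m X.reg)).prod = B⁻¹ :=
    (Matrix.inv_eq_right_inv hb).symm
  have hp : stokesProd S 4 = B⁻¹ := hinv
  have hb' : B * stokesProd S (2 * 2) = 1 := hb
  have h1 := fusionTerms_concat _ hL hC v w
  rw [hinv] at h1
  have t : ∀ F G : Matrix m m X.reg, IsUnit F → IsUnit G →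
      wedgeTr (fun u : X.Tangent x => mcL (F * G * C) u) (fun u => mcL (G * C) u) v w =
        wedgeTr (fun u : X.Tangent x => mcL F u) (fun u => mcR (G * C) u) v w := by
    intro F G hF hG
    rw [Matrix.mul_assoc]
    exact wedgeTr_mcL_mul hF (hG.mul hC) v w
  have u1 : IsUnit (S 0 * 1) := (hS 0).mul isUnit_one
  have hsum : ∑ i ∈ Finset.range (2 * 2),
      wedgeTr (fun u : X.Tangent x => mcL (stokesProd S (i + 1) * C) u)
        (fun u => mcL (stokesProd S i * C) u) v w = fusionTerms v w ([S 3, S 2, S 1, S 0] ++ [C]) := by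
    change ∑ i ∈ Finset.range 4, _ = _
    rw [Finset.sum_range_succ, Finset.sum_range_succ, Finset.sum_range_succ,
      Finset.sum_range_succ, Finset.sum_range_zero, s0, s1, s2, s3, s4, t _ _ (hS 0) isUnit_one,
      t _ _ (hS 1) u1, t _ _ (hS 2) ((hS 1).mul u1), t _ _ (hS 3) ((hS 2).mul ((hS 1).mul u1))]
    simp only [List.cons_append, List.nil_append, fusionTerms, List.prod_cons, List.prod_nil,
      mul_one, one_mul, mul_assoc, mcR_one]
    simp only [wedgeTr, Matrix.mul_zero, Matrix.trace_zero]
    ring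
  have h3 : wedgeTr (fun u : X.Tangent x => mcR (stokesProd S (2 * 2) * C) u)
      (fun u => mcL B u) v w = wedgeTr (fun u : X.Tangent x => mcR C u) (fun u => mcR B u) v w := by
    have e : ∀ u : X.Tangent x, mcR (B⁻¹ * C) u =
        (val x B)⁻¹ * (-mcR B u + mcR C u) * val x B := fun u => by
      rw [mcR_mul u (isUnit_inv hB) hC, mcL_inv u hB, val_inv hB,
        inv_inv_of_isUnit (isUnit_val hB x)]
    change wedgeTr (fun u : X.Tangent x => mcR (stokesProd S 4 * C) u) _ v w = _
    rw [hp, wedgeTr_conj (isUnit_mul_inv (isUnit_val hB x)) (e v) (e w) (mcL_eq v hB) (mcL_eq w hB)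
      (α' := fun u : X.Tangent x => -mcR B u + mcR C u) (β' := fun u : X.Tangent x => mcR B u),
      wedgeTr_add_left, wedgeTr_neg_left, wedgeTr_self, neg_zero, zero_add]
  have h4 : wedgeTr (fun u : X.Tangent x => mcL B⁻¹ u) (fun u => mcR C u) v w =
      wedgeTr (fun u : X.Tangent x => mcR C u) (fun u => mcR B u) v w := by
    rw [wedgeTr_congr (mcL_inv v hB) (mcL_inv w hB) rfl rfl
      (α' := fun u : X.Tangent x => -mcR B u) (β' := fun u : X.Tangent x => mcR C u),
      wedgeTr_neg_left, wedgeTr_swap, neg_neg]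
  rw [fissionForm, hsum, h1, h3, h4, hb', val_one]
  have h5 : wedgeTr (fun u : X.Tangent x => mcR C u) (fun u => 1 * mcR C u * (1 : Matrix m m ℂ)⁻¹)
      v w = 0 := by
    simp only [Matrix.one_mul, inv_one, Matrix.mul_one, wedgeTr_self]
  have h6 : wedgeTr (fun u : X.Tangent x => mcR C u) (fun u => mcR (1 : Matrix m m X.reg) u)
      v w = 0 := by
    simp only [wedgeTr, mcR_one, Matrix.mul_zero, Matrix.trace_zero, sub_zero]
  rw [h5, h6]
  ring

end FissionForm

section FissionVdb

variable {X : FunSpace} {d : Fin 2 → ℕ} {x : Matrix (Fin (d 1)) (Fin (d 0)) X.reg}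
  {y : Matrix (Fin (d 0)) (Fin (d 1)) X.reg}

/-- The first factor has a strictly lower triangular `θ`, and the product of the other three is
block lower triangular by `prod_stokes_eq`. Their pairing has zero trace, and only the three-factor
expression remains. -/
theorem fusionTerms_four_eq_vdbForm (h : IsUnit (1 + x * y)) {p : X.Pt} (v w : X.Tangent p) :
    -(1 / 2 : ℂ) * fusionTerms v w [blocks d 1 0 (-(x * (1 + y * x)⁻¹)) 1, blocks d 1 y 0 1,
      blocks d 1 0 x 1, blocks d 1 (-((1 + y * x)⁻¹ * y)) 0 1] = vdbForm x y v w := by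
  rw [← fusionTerms_eq_vdbForm h v w, fusionTerms]
  have hp : ([blocks d 1 y 0 1, blocks d 1 0 x 1, blocks d 1 (-((1 + y * x)⁻¹ * y)) 0 1] :
      List (Matrix _ _ X.reg)).prod =
      blocks d 1 0 (x * (1 + y * x)⁻¹) 1 * blocks d (1 + y * x) 0 0 (1 + x * y)⁻¹ := by
    rw [← prod_stokes_eq h]
    simp only [List.prod_cons, List.prod_nil, mul_one]
  have hk := isUnit_one_add_mul_comm h
  have hl := isUnit_inv h
  have h0 : wedgeTr (fun u : X.Tangent p => mcL (blocks d 1 0 (-(x * (1 + y * x)⁻¹)) 1) u)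
      (fun u => mcR (blocks d 1 0 (x * (1 + y * x)⁻¹) 1 *
        blocks d (1 + y * x) 0 0 (1 + x * y)⁻¹) u) v w = 0 := by
    rw [wedgeTr]
    simp only [mcR_mul _ isUnit_blocks_lower (isUnit_blocks_diag hk hl), mcL_blocks_lower,
      mcR_blocks_diag _ hk hl, val_blocks, val_one, val_zero, blocks_lower_inv]
    simp only [blocks_add, blocks_mul, blocks_trace]
    simp
  rw [hp, h0, zero_add]

end FissionVdb

end FunSpace

end FissionVar

end

/-! ### The fission space with two blocks and four Stokes factors -/

noncomputable section

namespace FissionVar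

open FunSpace

theorem FunSpace.eq_top_of_adjoin {X : FunSpace} {s : Set (X.Pt → ℂ)}
    (hs : X.reg = Algebra.adjoin ℂ s) {T : Subalgebra ℂ X.reg}
    (h : ∀ f : X.reg, f.1 ∈ s → f ∈ T) : T = ⊤ := by
  refine eq_top_iff.2 ?_
  rintro ⟨f, hf⟩ -
  have hf' := hf
  rw [hs] at hf'
  induction hf' using Algebra.adjoin_induction with
  | mem f hf' => exact h _ hf'
  | algebraMap r => exact T.algebraMap_mem r
  | add f g hf' hg' hf₁ hg₁ =>
    rw [← hs] at hf' hg'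
    exact T.add_mem (hf₁ hf') (hg₁ hg')
  | mul f g hf' hg' hf₁ hg₁ =>
    rw [← hs] at hf' hg'
    exact T.mul_mem (hf₁ hf') (hg₁ hg')

section Fission

variable (d : Fin 2 → ℕ)

/-- The points of the higher fission space with two blocks and four Stokes factors. -/
@[ext]
structure FisPt where
  C : GL (Fin (∑ i, d i)) ℂ
  a : Matrix (Fin (d 0)) (Fin (d 1)) ℂ
  x : Matrix (Fin (d 1)) (Fin (d 0)) ℂ
  y : Matrix (Fin (d 0)) (Fin (d 1)) ℂ
  s : Matrix (Fin (d 1)) (Fin (d 0)) ℂ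
  h : GLProd d

/-- The generators of the regular functions on the fission space. -/
inductive IsFisGen : (FisPt d → ℂ) → Prop
  | C (i j) : IsFisGen fun p => p.C.val i j
  | C' (i j) : IsFisGen fun p => (p.C⁻¹).val i j
  | a (i j) : IsFisGen fun p => p.a i j
  | x (i j) : IsFisGen fun p => p.x i j
  | y (i j) : IsFisGen fun p => p.y i j
  | s (i j) : IsFisGen fun p => p.s i j
  | h (k i j) : IsFisGen fun p => (p.h k).val i j
  | h' (k i j) : IsFisGen fun p => ((p.h k)⁻¹).val i j

/-- The higher fission space with two blocks and four Stokes factors, as a variety. -/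
def fisSpace : FunSpace where
  Pt := FisPt d
  reg := Algebra.adjoin ℂ {F | IsFisGen d F}

theorem IsFisGen.mem {d : Fin 2 → ℕ} {F : FisPt d → ℂ} (h : IsFisGen d F) : F ∈ (fisSpace d).reg :=
  Algebra.subset_adjoin (R := ℂ) (A := FisPt d → ℂ) (s := {F | IsFisGen d F}) h

theorem finite_isFisGen : {F | IsFisGen d F}.Finite := by
  have h := ((((((finite_entries fun p : FisPt d => p.C.val).union
    (finite_entries fun p : FisPt d => (p.C⁻¹).val)).union
    (finite_entries fun p : FisPt d => p.a)).union
    (finite_entries fun p : FisPt d => p.x)).union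
    (finite_entries fun p : FisPt d => p.y)).union
    (finite_entries fun p : FisPt d => p.s)).union
    ((Set.finite_iUnion fun k => finite_entries fun p : FisPt d => (p.h k).val).union
    (Set.finite_iUnion fun k => finite_entries fun p : FisPt d => ((p.h k)⁻¹).val))
  refine h.subset ?_
  rintro _ (⟨i, j⟩ | ⟨i, j⟩ | ⟨i, j⟩ | ⟨i, j⟩ | ⟨i, j⟩ | ⟨i, j⟩ | ⟨k, i, j⟩ | ⟨k, i, j⟩)
  · exact Or.inl (Or.inl (Or.inl (Or.inl (Or.inl (Or.inl ⟨i, j, rfl⟩)))))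
  · exact Or.inl (Or.inl (Or.inl (Or.inl (Or.inl (Or.inr ⟨i, j, rfl⟩)))))
  · exact Or.inl (Or.inl (Or.inl (Or.inl (Or.inr ⟨i, j, rfl⟩))))
  · exact Or.inl (Or.inl (Or.inl (Or.inr ⟨i, j, rfl⟩)))
  · exact Or.inl (Or.inl (Or.inr ⟨i, j, rfl⟩))
  · exact Or.inl (Or.inr ⟨i, j, rfl⟩)
  · exact Or.inr (Or.inl (Set.mem_iUnion.2 ⟨k, i, j, rfl⟩))
  · exact Or.inr (Or.inr (Set.mem_iUnion.2 ⟨k, i, j, rfl⟩))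

/-- The coordinate `C` on the fission space. -/
def fisC : Matrix (Fin (∑ i, d i)) (Fin (∑ i, d i)) (fisSpace d).reg :=
  fun i j => ⟨_, (IsFisGen.C i j).mem⟩

/-- The inverse of the coordinate `C`. -/
def fisC' : Matrix (Fin (∑ i, d i)) (Fin (∑ i, d i)) (fisSpace d).reg :=
  fun i j => ⟨_, (IsFisGen.C' i j).mem⟩

/-- The upper right block of the first Stokes factor. -/
def fisA : Matrix (Fin (d 0)) (Fin (d 1)) (fisSpace d).reg := fun i j => ⟨_, (IsFisGen.a i j).mem⟩

/-- The lower left block of the second Stokes factor. -/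
def fisX : Matrix (Fin (d 1)) (Fin (d 0)) (fisSpace d).reg := fun i j => ⟨_, (IsFisGen.x i j).mem⟩

/-- The upper right block of the third Stokes factor. -/
def fisY : Matrix (Fin (d 0)) (Fin (d 1)) (fisSpace d).reg := fun i j => ⟨_, (IsFisGen.y i j).mem⟩

/-- The lower left block of the fourth Stokes factor. -/
def fisS : Matrix (Fin (d 1)) (Fin (d 0)) (fisSpace d).reg := fun i j => ⟨_, (IsFisGen.s i j).mem⟩

/-- The diagonal blocks of the coordinate `h`. -/
def fisH (k : Fin 2) : Matrix (Fin (d k)) (Fin (d k)) (fisSpace d).reg :=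
  fun i j => ⟨_, (IsFisGen.h k i j).mem⟩

/-- The inverses of the diagonal blocks of the coordinate `h`. -/
def fisH' (k : Fin 2) : Matrix (Fin (d k)) (Fin (d k)) (fisSpace d).reg :=
  fun i j => ⟨_, (IsFisGen.h' k i j).mem⟩

theorem fisC_mul_fisC' : fisC d * fisC' d = 1 :=
  ext_val fun p => by
    rw [val_mul, val_one]
    exact Units.mul_inv p.C

theorem fisH_mul_fisH' (k : Fin 2) : fisH d k * fisH' d k = 1 :=
  ext_val fun p => by
    rw [val_mul, val_one]
    exact Units.mul_inv (p.h k)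

theorem isUnit_fisC : IsUnit (fisC d) := IsUnit.of_mul_eq_one _ (fisC_mul_fisC' d)

theorem isUnit_fisH (k : Fin 2) : IsUnit (fisH d k) := IsUnit.of_mul_eq_one _ (fisH_mul_fisH' d k)

theorem fisC_inv : (fisC d)⁻¹ = fisC' d := Matrix.inv_eq_right_inv (fisC_mul_fisC' d)

theorem fisH_inv (k : Fin 2) : (fisH d k)⁻¹ = fisH' d k := Matrix.inv_eq_right_inv (fisH_mul_fisH' d k)

/-- The Stokes factors. -/
def fisStokes : Fin (2 * 2) → Matrix (Fin (∑ i, d i)) (Fin (∑ i, d i)) (fisSpace d).reg :=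
  ![blocks d 1 (fisA d) 0 1, blocks d 1 0 (fisX d) 1, blocks d 1 (fisY d) 0 1,
    blocks d 1 0 (fisS d) 1]

theorem val_fisStokes (p : (fisSpace d).Pt) (j : Fin (2 * 2)) : val p (fisStokes d j) =
    (![blocks d 1 p.a 0 1, blocks d 1 0 p.x 1, blocks d 1 p.y 0 1, blocks d 1 0 p.s 1] :
      Fin (2 * 2) → Matrix (Fin (∑ i, d i)) (Fin (∑ i, d i)) ℂ) j := by
  have h1 : ∀ B, val p (blocks d 1 B 0 1) = blocks d 1 (val p B) 0 1 := fun B => by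
    rw [val_blocks, val_one, val_one, val_zero]
  have h2 : ∀ B, val p (blocks d 1 0 B 1) = blocks d 1 0 (val p B) 1 := fun B => by
    rw [val_blocks, val_one, val_one, val_zero]
  fin_cases j
  · exact h1 _
  · exact h2 _
  · exact h1 _
  · exact h2 _

theorem isUnit_fisStokes (j : Fin (2 * 2)) : IsUnit (fisStokes d j) := by
  fin_cases j
  · exact isUnit_blocks_upper
  · exact isUnit_blocks_lower
  · exact isUnit_blocks_upper
  · exact isUnit_blocks_lower

theorem isUnit_blockDiag_fisH : IsUnit (blockDiag d (fisH d)) := by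
  rw [blockDiag_eq_blocks]
  exact isUnit_blocks_diag (isUnit_fisH d 0) (isUnit_fisH d 1)

theorem blockDiag_mul {R : Type} [CommRing R] (F G : ∀ i, Matrix (Fin (d i)) (Fin (d i)) R) :
    blockDiag d F * blockDiag d G = blockDiag d fun i => F i * G i := by
  simp [blockDiag_eq_blocks, blocks_mul]

theorem blockDiag_one {R : Type} [CommRing R] :
    blockDiag d (fun i => (1 : Matrix (Fin (d i)) (Fin (d i)) R)) = 1 := by
  rw [blockDiag_eq_blocks, blocks_one]

/-- The block diagonal embedding. -/
def blockDiagGL : GLProd d →* GL (Fin (∑ i, d i)) ℂ where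
  toFun κ := ⟨blockDiag d fun i => (κ i).val, blockDiag d fun i => ((κ i)⁻¹).val,
    by simp only [blockDiag_mul, Units.mul_inv, blockDiag_one],
    by simp only [blockDiag_mul, Units.inv_mul, blockDiag_one]⟩
  map_one' := Units.ext (blockDiag_one d)
  map_mul' κ κ' := Units.ext (blockDiag_mul d _ _).symm

variable {d}

/-- The first component of an element of the group acting on a fission space. -/
def fisNone (g : GLProd (fissionDim d)) : GL (Fin (∑ i, d i)) ℂ := g none

/-- The second component of an element of the group acting on a fission space. -/
def fisSome (g : GLProd (fissionDim d)) : GLProd d := fun i => g (some i)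

theorem fisSome_mul (g g' : GLProd (fissionDim d)) : fisSome (g * g') = fisSome g * fisSome g' := rfl

theorem fisNone_mul (g g' : GLProd (fissionDim d)) : fisNone (g * g') = fisNone g * fisNone g' := rfl

/-- The action on the points of the fission space. -/
def fisAct (g : GLProd (fissionDim d)) (p : FisPt d) : FisPt d where
  C := blockDiagGL d (fisSome g) * p.C * (fisNone g)⁻¹
  a := (fisSome g 0).val * p.a * ((fisSome g 1)⁻¹).val
  x := (fisSome g 1).val * p.x * ((fisSome g 0)⁻¹).val
  y := (fisSome g 0).val * p.y * ((fisSome g 1)⁻¹).val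
  s := (fisSome g 1).val * p.s * ((fisSome g 0)⁻¹).val
  h := fisSome g * p.h * (fisSome g)⁻¹

theorem fisAct_one (p : FisPt d) : fisAct 1 p = p := by
  have h1 : fisSome (1 : GLProd (fissionDim d)) = 1 := rfl
  have h2 : fisNone (1 : GLProd (fissionDim d)) = 1 := rfl
  refine FisPt.ext ?_ ?_ ?_ ?_ ?_ ?_ <;> simp [fisAct, h1, h2]

theorem fisAct_mul (g g' : GLProd (fissionDim d)) (p : FisPt d) :
    fisAct (g * g') p = fisAct g (fisAct g' p) := by
  refine FisPt.ext ?_ ?_ ?_ ?_ ?_ ?_ <;>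
    simp only [fisAct, fisSome_mul, fisNone_mul, map_mul, _root_.mul_inv_rev, Pi.mul_apply,
      Units.val_mul, mul_assoc, Matrix.mul_assoc]

theorem entriesIn_blockDiag {P : Type} {T : Subalgebra ℂ (P → ℂ)}
    {F : P → ∀ i, Matrix (Fin (d i)) (Fin (d i)) ℂ} (hF : ∀ i, EntriesIn T fun p => F p i) :
    EntriesIn T fun p => blockDiag d (F p) := by
  have h := ((hF 0).fromBlocks (EntriesIn.const 0) (EntriesIn.const 0) (hF 1)).reindex
    (blkEquiv d) (blkEquiv d)
  simp only [blockDiag_eq_blocks]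
  exact h

theorem fisAct_regular {f : FisPt d → ℂ} (hf : f ∈ (fisSpace d).reg) :
    (fun p : GLProd (fissionDim d) × FisPt d => f (fisAct p.1 p.2)) ∈
      regGLProd (fissionDim d) (fisSpace d) := by
  have hN : EntriesIn (regGLProd (fissionDim d) (fisSpace d))
      fun p : GLProd (fissionDim d) × FisPt d => (fisNone p.1).val :=
    regGLProd_val (fissionDim d) (fisSpace d) none
  have hN' : EntriesIn (regGLProd (fissionDim d) (fisSpace d))
      fun p : GLProd (fissionDim d) × FisPt d => ((fisNone p.1)⁻¹).val :=
    regGLProd_inv_val (fissionDim d) (fisSpace d) none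
  have hg : ∀ i, EntriesIn (regGLProd (fissionDim d) (fisSpace d))
      fun p : GLProd (fissionDim d) × FisPt d => (fisSome p.1 i).val := fun i =>
    regGLProd_val (fissionDim d) (fisSpace d) (some i)
  have hg' : ∀ i, EntriesIn (regGLProd (fissionDim d) (fisSpace d))
      fun p : GLProd (fissionDim d) × FisPt d => ((fisSome p.1 i)⁻¹).val := fun i =>
    regGLProd_inv_val (fissionDim d) (fisSpace d) (some i)
  have hs : ∀ {m n : Type} {F : FisPt d → Matrix m n ℂ}, (∀ i j, IsFisGen d fun p => F p i j) →
      EntriesIn (regGLProd (fissionDim d) (fisSpace d))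
        fun p : GLProd (fissionDim d) × FisPt d => F p.2 :=
    fun hF i j => regGLProd_comp_snd (fissionDim d) (fisSpace d) (hF i j).mem
  refine comp_mem_of_adjoin (s := {F | IsFisGen d F})
    (φ := fun p : GLProd (fissionDim d) × FisPt d => fisAct p.1 p.2) ?_ hf
  rintro _ (⟨i, j⟩ | ⟨i, j⟩ | ⟨i, j⟩ | ⟨i, j⟩ | ⟨i, j⟩ | ⟨i, j⟩ | ⟨k, i, j⟩ | ⟨k, i, j⟩)
  · exact ((entriesIn_blockDiag hg).mul (hs IsFisGen.C)).mul hN' i j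
  · refine (congrArg (· ∈ regGLProd (fissionDim d) (fisSpace d))
      (funext fun p : GLProd (fissionDim d) × FisPt d => ?_)).mpr
      ((hN.mul (hs IsFisGen.C')).mul (entriesIn_blockDiag hg') i j)
    change ((blockDiagGL d (fisSome p.1) * p.2.C * (fisNone p.1)⁻¹)⁻¹).val i j = _
    rw [_root_.mul_inv_rev, _root_.mul_inv_rev, inv_inv, ← mul_assoc]
    rfl
  · exact ((hg 0).mul (hs IsFisGen.a)).mul (hg' 1) i j
  · exact ((hg 1).mul (hs IsFisGen.x)).mul (hg' 0) i j
  · exact ((hg 0).mul (hs IsFisGen.y)).mul (hg' 1) i j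
  · exact ((hg 1).mul (hs IsFisGen.s)).mul (hg' 0) i j
  · exact ((hg k).mul (hs (IsFisGen.h k))).mul (hg' k) i j
  · refine (congrArg (· ∈ regGLProd (fissionDim d) (fisSpace d))
      (funext fun p : GLProd (fissionDim d) × FisPt d => ?_)).mpr
      (((hg k).mul (hs (IsFisGen.h' k))).mul (hg' k) i j)
    change ((fisSome p.1 k * p.2.h k * (fisSome p.1 k)⁻¹)⁻¹).val i j = _
    rw [_root_.mul_inv_rev, _root_.mul_inv_rev, inv_inv, ← mul_assoc]
    rfl

variable (d)

/-- The action on the fission space. -/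
def fisActHom (g : GLProd (fissionDim d)) : Hom (fisSpace d) (fisSpace d) where
  toFun := fisAct g
  regular _ hf := comp_mk_mem_of_regGLProd g (fisAct_regular hf)

theorem fisSpace_isAffine : (fisSpace d).IsAffine := by
  refine isAffine_of_adjoin (X := fisSpace d) (finite_isFisGen d) rfl (fun p p' h => ?_) fun χ => ?_
  · refine FisPt.ext (Units.ext ?_) ?_ ?_ ?_ ?_ (funext fun k => Units.ext ?_) <;> ext i j
    · exact h _ (IsFisGen.C i j)
    · exact h _ (IsFisGen.a i j)
    · exact h _ (IsFisGen.x i j)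
    · exact h _ (IsFisGen.y i j)
    · exact h _ (IsFisGen.s i j)
    · exact h _ (IsFisGen.h k i j)
  · have hm : ∀ {m : Type} [Fintype m] [DecidableEq m] {F G : Matrix m m (fisSpace d).reg},
        F * G = 1 → F.map χ * G.map χ = 1 := fun h => by
      rw [← Matrix.map_mul, h, Matrix.map_one χ (map_zero χ) (map_one χ)]
    -- The inverses of `C` and `h` are coordinates in their own right, so applying the character to
    -- `C C' = 1` and `h h' = 1` yields invertible matrices.
    let p : FisPt d :=
      { C := ⟨(fisC d).map χ, (fisC' d).map χ, hm (fisC_mul_fisC' d),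
          hm (mul_eq_one_comm.1 (fisC_mul_fisC' d))⟩
        a := (fisA d).map χ
        x := (fisX d).map χ
        y := (fisY d).map χ
        s := (fisS d).map χ
        h := fun k => ⟨(fisH d k).map χ, (fisH' d k).map χ, hm (fisH_mul_fisH' d k),
          hm (mul_eq_one_comm.1 (fisH_mul_fisH' d k))⟩ }
    refine ⟨p, ?_⟩
    rintro ⟨_, _⟩ (⟨i, j⟩ | ⟨i, j⟩ | ⟨i, j⟩ | ⟨i, j⟩ | ⟨i, j⟩ | ⟨i, j⟩ | ⟨k, i, j⟩ | ⟨k, i, j⟩) <;>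
      rfl

/-- The moment map of the fission space. -/
def fisμ : ∀ o, Matrix (Fin (fissionDim d o)) (Fin (fissionDim d o)) (fisSpace d).reg
  | none => ((fisC d)⁻¹ * (blockDiag d (fisH d) * stokesProd (fisStokes d) (2 * 2)) * fisC d :
      Matrix (Fin (∑ i, d i)) (Fin (∑ i, d i)) (fisSpace d).reg)
  | some i => ((fisH d i)⁻¹ : Matrix (Fin (d i)) (Fin (d i)) (fisSpace d).reg)

theorem blockDiag_mul_blocks_mul {R : Type} [CommRing R] (F G : ∀ i, Matrix (Fin (d i)) (Fin (d i)) R)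
    (A B C D) : blockDiag d F * blocks d A B C D * blockDiag d G =
      blocks d (F 0 * A * G 0) (F 0 * B * G 1) (F 1 * C * G 0) (F 1 * D * G 1) := by
  simp [blockDiag_eq_blocks, blocks_mul]

theorem val_fisAct_stokes (g : GLProd (fissionDim d)) (p : (fisSpace d).Pt) (j : Fin (2 * 2)) :
    val (fisActHom d g p) (fisStokes d j) =
      (blockDiagGL d (fisSome g)).val * val p (fisStokes d j) *
        ((blockDiagGL d (fisSome g))⁻¹).val := by
  have h : ∀ A B C D, (blockDiagGL d (fisSome g)).val * blocks d A B C D *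
      ((blockDiagGL d (fisSome g))⁻¹).val = _ := fun A B C D =>
    blockDiag_mul_blocks_mul d (fun i => (fisSome g i).val) (fun i => ((fisSome g i)⁻¹).val) A B C D
  rw [val_fisStokes, val_fisStokes]
  fin_cases j <;> refine Eq.trans ?_ (h _ _ _ _).symm <;> simp [blocks_inj, -Matrix.coe_units_inv] <;> rfl

theorem val_fisAct_blockDiag (g : GLProd (fissionDim d)) (p : (fisSpace d).Pt) :
    val (fisActHom d g p) (blockDiag d (fisH d)) =
      (blockDiagGL d (fisSome g)).val * val p (blockDiag d (fisH d)) *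
        ((blockDiagGL d (fisSome g))⁻¹).val := by
  have h : ∀ A B C D, (blockDiagGL d (fisSome g)).val * blocks d A B C D *
      ((blockDiagGL d (fisSome g))⁻¹).val = _ := fun A B C D =>
    blockDiag_mul_blocks_mul d (fun i => (fisSome g i).val) (fun i => ((fisSome g i)⁻¹).val) A B C D
  rw [blockDiag_eq_blocks, val_blocks, val_blocks, h]
  simp only [val_zero, Matrix.mul_zero, Matrix.zero_mul]
  rfl

theorem val_fisAct_none (g : GLProd (fissionDim d)) (p : (fisSpace d).Pt) :
    val (fisActHom d g p) ((fisC d)⁻¹ * (blockDiag d (fisH d) *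
      stokesProd (fisStokes d) (2 * 2)) * fisC d) = (fisNone g).val * val p ((fisC d)⁻¹ *
      (blockDiag d (fisH d) * stokesProd (fisStokes d) (2 * 2)) * fisC d) *
        ((fisNone g)⁻¹).val := by
  have hv : ∀ p : (fisSpace d).Pt, val p ((fisC d)⁻¹ * (blockDiag d (fisH d) *
      stokesProd (fisStokes d) (2 * 2)) * fisC d) = (p.C⁻¹).val * (val p (blockDiag d (fisH d)) *
        val p (stokesProd (fisStokes d) (2 * 2))) * p.C.val := fun p => by
    rw [val_mul, val_mul, val_mul, fisC_inv]
    rfl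
  refine (hv _).trans (Eq.trans ?_
    (congrArg (fun F => (fisNone g).val * F * ((fisNone g)⁻¹).val) (hv p)).symm)
  have hP : (blockDiagGL d (fisSome g)).val * ((blockDiagGL d (fisSome g))⁻¹).val = 1 :=
    Units.mul_inv _
  have hs := stokesProd_conj (X := fisSpace d) (S := fisStokes d) (S' := fun j =>
    (fisStokes d j).map (fisActHom d g).pull) hP (y := p)
    (fun j => val_fisAct_stokes d g p j) (2 * 2)
  have hs' : val (fisActHom d g p) (stokesProd (fisStokes d) (2 * 2)) = _ :=
    (congrArg (val (X := fisSpace d) p) (stokesProd_map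
      ((fisActHom d g).pull : (fisSpace d).reg →+* (fisSpace d).reg) (fisStokes d) (2 * 2))).trans
      hs
  have hC : (fisActHom d g p).C = blockDiagGL d (fisSome g) * p.C * (fisNone g)⁻¹ := rfl
  change ((fisActHom d g p).C⁻¹).val * (val (fisActHom d g p) (blockDiag d (fisH d)) *
    val (fisActHom d g p) (stokesProd (fisStokes d) (2 * 2))) *
    (fisActHom d g p).C.val = _
  rw [hs', val_fisAct_blockDiag, hC, conj_mul_conj (mul_eq_one_comm.1 hP), _root_.mul_inv_rev,
    _root_.mul_inv_rev, inv_inv]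
  generalize val p (blockDiag d (fisH d)) * val p (stokesProd (fisStokes d) (2 * 2)) = b
  have hP' : ((blockDiagGL d (fisSome g))⁻¹).val * (blockDiagGL d (fisSome g)).val = 1 :=
    Units.inv_mul _
  simp only [Units.val_mul]
  calc _ = (fisNone g).val * (p.C⁻¹).val * (((blockDiagGL d (fisSome g))⁻¹).val *
        (blockDiagGL d (fisSome g)).val) * b * (((blockDiagGL d (fisSome g))⁻¹).val *
        (blockDiagGL d (fisSome g)).val) * p.C.val * ((fisNone g)⁻¹).val := by
        simp only [Matrix.mul_assoc]
    _ = _ := by rw [hP']; simp only [Matrix.mul_assoc, Matrix.one_mul]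

theorem val_fisAct_some (g : GLProd (fissionDim d)) (p : (fisSpace d).Pt) (i : Fin 2) :
    val (fisActHom d g p) (fisH d i)⁻¹ =
      (fisSome g i).val * val p (fisH d i)⁻¹ * ((fisSome g i)⁻¹).val := by
  have hv : ∀ p : (fisSpace d).Pt, val p (fisH d i)⁻¹ = ((p.h i)⁻¹).val := fun p => by
    rw [fisH_inv]
    rfl
  refine (hv _).trans (Eq.trans ?_
    (congrArg (fun F => (fisSome g i).val * F * ((fisSome g i)⁻¹).val) (hv p)).symm)
  change ((fisSome g i * p.h i * (fisSome g i)⁻¹)⁻¹).val = _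
  rw [_root_.mul_inv_rev, _root_.mul_inv_rev, inv_inv, ← mul_assoc]
  rfl

/-- The higher fission space with two blocks and four Stokes factors. -/
def fis : QHDatum (Option (Fin 2)) (fissionDim d) where
  X := fisSpace d
  affine := fisSpace_isAffine d
  act := fisActHom d
  act_one := fisAct_one
  act_mul := fisAct_mul
  act_regular _ hf := fisAct_regular hf
  μ := fisμ d
  μ_unit
    | none => ((isUnit_inv (isUnit_fisC d)).mul ((isUnit_blockDiag_fisH d).mul
        (isUnit_stokesProd (isUnit_fisStokes d) _))).mul (isUnit_fisC d)
    | some i => isUnit_inv (isUnit_fisH d i)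
  μ_act g p
    | none => val_fisAct_none d g p
    | some i => val_fisAct_some d g p i
  ω _ v w := fissionForm (fisC d) (fisStokes d) (blockDiag d (fisH d)) v w
  ω_regular := isRegular_fissionForm (isUnit_fisC d) (isUnit_fisStokes d) (isUnit_blockDiag_fisH d)
  ω_act g p v w := by
    rw [fissionForm_push]
    exact fissionForm_conj (X := fisSpace d) (C := fisC d) (S := fisStokes d)
      (B := blockDiag d (fisH d)) (C' := (fisC d).map (fisActHom d g).pull)
      (S' := fun j => (fisStokes d j).map (fisActHom d g).pull)
      (B' := (blockDiag d (fisH d)).map (fisActHom d g).pull) (Units.mul_inv (blockDiagGL d (fisSome g)))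
      (Units.inv_mul (fisNone g)) (fun _ => rfl) (fun j y => val_fisAct_stokes d g y j)
      (fun y => val_fisAct_blockDiag d g y) v w

end Fission

end FissionVar

end

noncomputable section

namespace FissionVar

open FunSpace

section Fission

variable (d : Fin 2 → ℕ)

theorem isUpper_fisStokes (p : (fisSpace d).Pt) (j : Fin (2 * 2)) (hj : Even j.val) :
    IsUpper d (val p (fisStokes d j)) := by
  rw [val_fisStokes]
  fin_cases j
  · exact isUpper_blocks _
  · exact absurd hj (by decide)
  · exact isUpper_blocks _
  · exact absurd hj (by decide)

theorem isLower_fisStokes (p : (fisSpace d).Pt) (j : Fin (2 * 2)) (hj : Odd j.val) :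
    IsLower d (val p (fisStokes d j)) := by
  rw [val_fisStokes]
  fin_cases j
  · exact absurd hj (by decide)
  · exact isLower_blocks _
  · exact absurd hj (by decide)
  · exact isLower_blocks _

theorem adjoin_fis : Algebra.adjoin ℂ (entries (fisC d) ∪ entries (fisC d)⁻¹ ∪
    (⋃ j, entries (fisStokes d j)) ∪ (⋃ i, entries (fisH d i)) ∪ (⋃ i, entries (fisH d i)⁻¹)) =
    (⊤ : Subalgebra ℂ (fisSpace d).reg) := by
  refine FunSpace.eq_top_of_adjoin (X := fisSpace d) (s := {F | IsFisGen d F}) rfl fun f hf =>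
    Algebra.subset_adjoin ?_
  have hS : ∀ j, f ∈ entries (fisStokes d j) → f ∈ entries (fisC d) ∪ entries (fisC d)⁻¹ ∪
      (⋃ j, entries (fisStokes d j)) ∪ (⋃ i, entries (fisH d i)) ∪ (⋃ i, entries (fisH d i)⁻¹) :=
    fun j hf => Or.inl (Or.inl (Or.inr (Set.mem_iUnion.2 ⟨j, hf⟩)))
  obtain ⟨f, hf'⟩ := f
  change IsFisGen d f at hf
  rcases hf with ⟨i, j⟩ | ⟨i, j⟩ | ⟨i, j⟩ | ⟨i, j⟩ | ⟨i, j⟩ | ⟨i, j⟩ | ⟨k, i, j⟩ | ⟨k, i, j⟩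
  · exact Or.inl (Or.inl (Or.inl (Or.inl ⟨i, j, rfl⟩)))
  · exact Or.inl (Or.inl (Or.inl (Or.inr
      ⟨i, j, (congrFun (congrFun (fisC_inv d) i) j).symm⟩)))
  · exact hS 0 ⟨blkEquiv d (Sum.inl i), blkEquiv d (Sum.inr j), (blocks_apply (A := 1)
      (B := fisA d) (C := 0) (D := 1) (Sum.inl i) (Sum.inr j)).symm⟩
  · exact hS 1 ⟨blkEquiv d (Sum.inr i), blkEquiv d (Sum.inl j), (blocks_apply (A := 1)
      (B := 0) (C := fisX d) (D := 1) (Sum.inr i) (Sum.inl j)).symm⟩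
  · exact hS 2 ⟨blkEquiv d (Sum.inl i), blkEquiv d (Sum.inr j), (blocks_apply (A := 1)
      (B := fisY d) (C := 0) (D := 1) (Sum.inl i) (Sum.inr j)).symm⟩
  · exact hS 3 ⟨blkEquiv d (Sum.inr i), blkEquiv d (Sum.inl j), (blocks_apply (A := 1)
      (B := 0) (C := fisS d) (D := 1) (Sum.inr i) (Sum.inl j)).symm⟩
  · exact Or.inl (Or.inr (Set.mem_iUnion.2 ⟨k, i, j, rfl⟩))
  · exact Or.inr (Set.mem_iUnion.2
      ⟨k, i, j, (congrFun (congrFun (fisH_inv d k) i) j).symm⟩)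

theorem val_fisμ_none (p : (fisSpace d).Pt) : val p ((fisC d)⁻¹ * (blockDiag d (fisH d) *
    stokesProd (fisStokes d) (2 * 2)) * fisC d) = (val p (fisC d))⁻¹ *
      val p (blockDiag d (fisH d) * stokesProd (fisStokes d) (2 * 2)) * val p (fisC d) := by
  rw [val_mul, val_mul, val_inv (isUnit_fisC d)]

theorem two_mul_fissionForm {X : FunSpace} {m : Type} [Fintype m] [DecidableEq m] {r : ℕ}
    (C : Matrix m m X.reg) (S : Fin (2 * r) → Matrix m m X.reg) (B : Matrix m m X.reg) {x : X.Pt}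
    (v w : X.Tangent x) : 2 * fissionForm C S B v w =
    wedgeTr (fun u : X.Tangent x => mcR C u) (fun u => val x (B * stokesProd S (2 * r)) * mcR C u *
        (val x (B * stokesProd S (2 * r)))⁻¹) v w +
    wedgeTr (fun u : X.Tangent x => mcR C u) (fun u => mcR (B * stokesProd S (2 * r)) u) v w +
    wedgeTr (fun u : X.Tangent x => mcR (stokesProd S (2 * r) * C) u) (fun u => mcL B u) v w -
    ∑ i ∈ Finset.range (2 * r), wedgeTr (fun u : X.Tangent x => mcL (stokesProd S (i + 1) * C) u)
      (fun u => mcL (stokesProd S i * C) u) v w := by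
  rw [fissionForm, ← mul_assoc, mul_one_div_cancel two_ne_zero, one_mul]

theorem isFissionSpace_fis : IsFissionSpace d 2 (fis d) := by
  refine ⟨fisC d, fisStokes d, fisH d, fun p => ⟨p.C.isUnit, fun i => (p.h i).isUnit,
    isUpper_fisStokes d p, isLower_fisStokes d p⟩, fun C₀ S₀ h₀ hp => ?_, adjoin_fis d, ?_,
    val_fisμ_none d, fun p i => val_inv (isUnit_fisH d i) p, fun p v w =>
    two_mul_fissionForm (X := fisSpace d) (fisC d) (fisStokes d) (blockDiag d (fisH d)) v w⟩
  · obtain ⟨hC, hh, hU, hL⟩ := hp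
    obtain ⟨a, ha⟩ := (hU 0 (by decide)).exists_eq
    obtain ⟨x, hx⟩ := (hL 1 (by decide)).exists_eq
    obtain ⟨y, hy⟩ := (hU 2 (by decide)).exists_eq
    obtain ⟨s, hs⟩ := (hL 3 (by decide)).exists_eq
    refine ⟨(⟨hC.unit, a, x, y, s, fun i => (hh i).unit⟩ : FisPt d),
      ⟨rfl, fun j => ?_, fun i => rfl⟩, fun p hp => ?_⟩
    · refine (val_fisStokes d _ j).trans ?_
      fin_cases j
      exacts [ha.symm, hx.symm, hy.symm, hs.symm]
    · obtain ⟨h1, h2, h3⟩ := hp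
      have e : ∀ j, _ = S₀ j := fun j => (val_fisStokes d p j).symm.trans (h2 j)
      refine FisPt.ext (Units.ext h1) ?_ ?_ ?_ ?_ (funext fun i => Units.ext (h3 i))
      · exact (blocks_inj.1 ((e 0).trans ha)).2.1
      · exact (blocks_inj.1 ((e 1).trans hx)).2.2.1
      · exact (blocks_inj.1 ((e 2).trans hy)).2.1
      · exact (blocks_inj.1 ((e 3).trans hs)).2.2.1
  · rintro g κ a p rfl hκ
    obtain rfl : (fun i => a (some i)) = κ := funext hκ
    exact ⟨rfl, fun j => val_fisAct_stokes d a p j, fun i => rfl⟩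

/-! ### The Van den Bergh spaces as reductions of fission spaces -/

/-- The factors of the group acting on a fission space. -/
def fisEquiv : Option (Fin 2) ≃ Unit ⊕ Fin 2 :=
  (Equiv.optionEquivSumPUnit (Fin 2)).trans (Equiv.sumComm _ _)

/-- The dimensions of the factors of the group acting on a fission space. -/
def fisDim : Unit ⊕ Fin 2 → ℕ := Sum.elim (fun _ => ∑ i, d i) d

theorem fissionDim_eq (o : Option (Fin 2)) : fissionDim d o = fisDim d (fisEquiv o) := by
  rcases o with _ | i <;> rfl

/-- The fission space with the factors of the group relabelled. -/
def fisSum : QHDatum (Unit ⊕ Fin 2) (fisDim d) := (fis d).relabel fisEquiv (fissionDim_eq d)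

theorem fisSum_μ_inl : (fisSum d).μ (Sum.inl ()) = fisμ d none :=
  QHDatum.relabel_μ (fis d) fisEquiv (fissionDim_eq d) none

theorem fisSum_μ_inr (i : Fin 2) : (fisSum d).μ (Sum.inr i) = fisμ d (some i) :=
  QHDatum.relabel_μ (fis d) fisEquiv (fissionDim_eq d) (some i)

variable {d}

theorem fisNone_pullGL (g : GLProd (fisDim d)) :
    fisNone (QHDatum.pullGL fisEquiv (fissionDim_eq d) g) = g (Sum.inl ()) := Units.ext rfl

theorem fisSome_pullGL (g : GLProd (fisDim d)) :
    fisSome (QHDatum.pullGL fisEquiv (fissionDim_eq d) g) = fun i => g (Sum.inr i) :=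
  funext fun _ => Units.ext rfl

/-- Block elimination. After the product is multiplied out, the first diagonal block gives `H₀(1 +
yx) = 1`. The off-diagonal blocks, freed of the invertible `H₀` and `H₁`, give `a` and `s`, and the
last block gives `H₁(1 + xa) = 1`. -/
theorem blocks_level {R : Type} [CommRing R] {a y : Matrix (Fin (d 0)) (Fin (d 1)) R}
    {x s : Matrix (Fin (d 1)) (Fin (d 0)) R} {H₀ : Matrix (Fin (d 0)) (Fin (d 0)) R}
    {H₁ : Matrix (Fin (d 1)) (Fin (d 1)) R} (h0 : IsUnit H₀) (h1 : IsUnit H₁)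
    (h : blocks d H₀ 0 0 H₁ * (blocks d 1 0 s 1 * (blocks d 1 y 0 1 * (blocks d 1 0 x 1 *
      (blocks d 1 a 0 1 * 1)))) = 1) :
    IsUnit (1 + x * y) ∧ a = -((1 + y * x)⁻¹ * y) ∧ s = -(x * (1 + y * x)⁻¹) ∧
      H₀⁻¹ = 1 + y * x ∧ H₁⁻¹ = (1 + x * y)⁻¹ := by
  have e : blocks d 1 0 s 1 * (blocks d 1 y 0 1 * (blocks d 1 0 x 1 * (blocks d 1 a 0 1 * 1))) =
      blocks d (1 + y * x) ((1 + y * x) * a + y) (s * (1 + y * x) + x)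
        (s * ((1 + y * x) * a + y) + (x * a + 1)) := by
    rw [mul_one, ← mul_assoc (blocks d 1 y 0 1), blocks_mul, blocks_mul, blocks_mul]
    simp
  rw [e, blocks_mul, ← blocks_one, blocks_inj] at h
  simp only [Matrix.zero_mul, add_zero, zero_add] at h
  obtain ⟨e1, e2, e3, e4⟩ := h
  have c0 : ∀ {n : ℕ} {M : Matrix (Fin (d 0)) (Fin n) R}, H₀ * M = 0 → M = 0 := fun h => by
    have := congrArg (H₀⁻¹ * ·) h
    simpa only [← Matrix.mul_assoc, isUnit_inv_mul h0, Matrix.one_mul, Matrix.mul_zero] using this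
  have c1 : ∀ {n : ℕ} {M : Matrix (Fin (d 1)) (Fin n) R}, H₁ * M = 0 → M = 0 := fun h => by
    have := congrArg (H₁⁻¹ * ·) h
    simpa only [← Matrix.mul_assoc, isUnit_inv_mul h1, Matrix.one_mul, Matrix.mul_zero] using this
  have hk : IsUnit (1 + y * x) := IsUnit.of_mul_eq_one _ (mul_eq_one_comm.1 e1)
  have hl := isUnit_one_add_mul_comm hk
  have f2 := c0 e2
  have f3 := c1 e3
  have ha : a = -((1 + y * x)⁻¹ * y) := by
    have := congrArg ((1 + y * x)⁻¹ * ·) (eq_neg_of_add_eq_zero_left f2)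
    simpa only [← Matrix.mul_assoc, isUnit_inv_mul hk, Matrix.one_mul, Matrix.mul_neg] using this
  refine ⟨hl, ha, ?_, Matrix.inv_eq_right_inv e1, ?_⟩
  · have := congrArg (· * (1 + y * x)⁻¹) (eq_neg_of_add_eq_zero_left f3)
    simpa only [Matrix.mul_assoc, isUnit_mul_inv hk, Matrix.mul_one, Matrix.neg_mul] using this
  -- The coefficient of `s` in the last block is the upper right block, which has just been shown to
  -- vanish.
  · rw [f2, Matrix.mul_zero, zero_add] at e4
    rw [Matrix.inv_eq_right_inv e4, ha, Matrix.mul_neg, ← Matrix.mul_assoc, mul_inv_one_add_mul hl]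
    abel

theorem blocks_level_section {R : Type} [CommRing R] {y : Matrix (Fin (d 0)) (Fin (d 1)) R}
    {x : Matrix (Fin (d 1)) (Fin (d 0)) R} (h : IsUnit (1 + x * y)) :
    blocks d (1 + y * x)⁻¹ 0 0 (1 + x * y) * (blocks d 1 0 (-(x * (1 + y * x)⁻¹)) 1 *
      (blocks d 1 y 0 1 * (blocks d 1 0 x 1 * (blocks d 1 (-((1 + y * x)⁻¹ * y)) 0 1 * 1)))) =
      1 := by
  have hk := isUnit_one_add_mul_comm h
  rw [mul_one, prod_stokes_eq h, ← blocks_lower_inv, ← mul_assoc (blocks d 1 0 _ 1)⁻¹,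
    isUnit_inv_mul isUnit_blocks_lower, one_mul, blocks_mul, ← blocks_one]
  simp [isUnit_inv_mul hk, isUnit_mul_inv h]

theorem val_fis_level (p : (fisSpace d).Pt) :
    val p (blockDiag d (fisH d) * stokesProd (fisStokes d) (2 * 2)) =
      blocks d (p.h 0).val 0 0 (p.h 1).val * (blocks d 1 0 p.s 1 * (blocks d 1 p.y 0 1 *
        (blocks d 1 0 p.x 1 * (blocks d 1 p.a 0 1 * 1)))) := by
  have e : stokesProd (fisStokes d) (2 * 2) = fisStokes d 3 * (fisStokes d 2 * (fisStokes d 1 *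
    (fisStokes d 0 * 1))) := rfl
  rw [e, val_mul, val_mul, val_mul, val_mul, val_mul, val_fisStokes, val_fisStokes, val_fisStokes,
    val_fisStokes, val_one, blockDiag_eq_blocks, val_blocks, val_zero, val_zero]
  rfl

theorem inv_conj_eq_one_iff {m : Type} [Fintype m] [DecidableEq m] (c : GL m ℂ)
    (b : Matrix m m ℂ) : c.val⁻¹ * b * c.val = 1 ↔ b = 1 := by
  have h1 : c.val⁻¹ * c.val = 1 := isUnit_inv_mul c.isUnit
  have h2 : c.val * c.val⁻¹ = 1 := isUnit_mul_inv c.isUnit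
  constructor
  · intro h
    calc b = c.val * c.val⁻¹ * b * (c.val * c.val⁻¹) := by
          rw [h2, Matrix.one_mul, Matrix.mul_one]
      _ = c.val * (c.val⁻¹ * b * c.val) * c.val⁻¹ := by simp only [Matrix.mul_assoc]
      _ = 1 := by rw [h, Matrix.mul_one, h2]
  · rintro rfl
    rw [Matrix.mul_one, h1]

theorem val_fisSum_μ_inl (p : (fisSpace d).Pt) :
    val (X := (fisSum d).X) p ((fisSum d).μ (Sum.inl ())) = 1 ↔
      blocks d (p.h 0).val 0 0 (p.h 1).val * (blocks d 1 0 p.s 1 * (blocks d 1 p.y 0 1 *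
        (blocks d 1 0 p.x 1 * (blocks d 1 p.a 0 1 * 1)))) = 1 := by
  rw [fisSum_μ_inl]
  refine (Eq.congr_left (val_fisμ_none d p)).trans ?_
  rw [val_fis_level]
  exact inv_conj_eq_one_iff p.C _

end Fission

end FissionVar

end

/-! ### The reduction of the fission space to the Van den Bergh space -/

noncomputable section

namespace FissionVar

open FunSpace

section FissionReduction

variable (d : Fin 2 → ℕ)

/-- The points of the fission space at which the first component of the moment map is trivial. -/
def fisZ : Set (fisSum d).X.Pt := {p | ∀ k, val p ((fisSum d).μ (Sum.inl k)) = 1}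

/-- The points of the fission space at which the first component of the moment map is trivial,
as a variety. -/
def fisLevel : FunSpace := (fisSum d).X.restrict (fisZ d)

variable {d}

/-- The underlying point of the fission space. -/
def fisLevelPt (z : (fisLevel d).Pt) : FisPt d := z.1

theorem fisLevelPt_spec (z : (fisLevel d).Pt) :
    IsUnit (1 + (fisLevelPt z).x * (fisLevelPt z).y) ∧
    (fisLevelPt z).a =
      -((1 + (fisLevelPt z).y * (fisLevelPt z).x)⁻¹ * (fisLevelPt z).y) ∧
    (fisLevelPt z).s =
      -((fisLevelPt z).x * (1 + (fisLevelPt z).y * (fisLevelPt z).x)⁻¹) ∧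
    (((fisLevelPt z).h 0)⁻¹).val = 1 + (fisLevelPt z).y * (fisLevelPt z).x ∧
    (((fisLevelPt z).h 1)⁻¹).val = (1 + (fisLevelPt z).x * (fisLevelPt z).y)⁻¹ := by
  have h := blocks_level ((fisLevelPt z).h 0).isUnit ((fisLevelPt z).h 1).isUnit
    ((val_fisSum_μ_inl (fisLevelPt z)).1 (z.2 ()))
  rwa [← Matrix.coe_units_inv, ← Matrix.coe_units_inv] at h

variable (d)

/-- The projection to the Van den Bergh space. -/
def fisProj : Hom (fisLevel d) (vdbSpace d) where
  toFun z := ⟨((fisLevelPt z).x, (fisLevelPt z).y), (fisLevelPt_spec z).1⟩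
  regular f hf := by
    refine comp_mem_of_adjoin (s := vdbGen d) (φ := fun z : (fisLevel d).Pt =>
      (⟨((fisLevelPt z).x, (fisLevelPt z).y), (fisLevelPt_spec z).1⟩ : VdbPt d)) ?_ hf
    rintro _ (((⟨i, j, rfl⟩ | ⟨i, j, rfl⟩) | ⟨i, j, rfl⟩) | ⟨i, j, rfl⟩)
    · exact ⟨_, (IsFisGen.x i j).mem, fun _ => rfl⟩
    · exact ⟨_, (IsFisGen.y i j).mem, fun _ => rfl⟩
    -- On the level set the inverses are themselves coordinates: `(1 + xy)⁻¹ = h₁⁻¹`, and in the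
    -- next case `(1 + yx)⁻¹ = h₀`.
    · exact ⟨_, (IsFisGen.h' 1 i j).mem, fun z =>
        (congrFun (congrFun (fisLevelPt_spec z).2.2.2.2 i) j).symm⟩
    · refine ⟨_, (IsFisGen.h 0 i j).mem, fun z => ?_⟩
      have h := (fisLevelPt_spec z).2.2.2.1
      have h1 : (1 + (fisLevelPt z).y * (fisLevelPt z).x)⁻¹ = ((fisLevelPt z).h 0).val := by
        rw [← h, ← Matrix.coe_units_inv, inv_inv]
      exact congrFun (congrFun h1 i) j

variable {d}

/-- A section of the projection to the Van den Bergh space. -/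
def fisSectionPt (p : VdbPt d) : FisPt d where
  C := 1
  a := -((1 + p.1.2 * p.1.1)⁻¹ * p.1.2)
  x := p.1.1
  y := p.1.2
  s := -(p.1.1 * (1 + p.1.2 * p.1.1)⁻¹)
  h
    | 0 => (isUnit_one_add_mul_comm p.2).unit⁻¹
    | 1 => p.2.unit

theorem fisSectionPt_h_zero (p : VdbPt d) :
    ((fisSectionPt p).h 0).val = (1 + p.1.2 * p.1.1)⁻¹ :=
  Matrix.coe_units_inv (isUnit_one_add_mul_comm p.2).unit

theorem fisSectionPt_h_zero_inv (p : VdbPt d) :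
    (((fisSectionPt p).h 0)⁻¹).val = 1 + p.1.2 * p.1.1 :=
  congrArg Units.val (inv_inv (isUnit_one_add_mul_comm p.2).unit)

theorem fisSectionPt_h_one (p : VdbPt d) :
    ((fisSectionPt p).h 1).val = 1 + p.1.1 * p.1.2 := rfl

theorem fisSectionPt_h_one_inv (p : VdbPt d) :
    (((fisSectionPt p).h 1)⁻¹).val = (1 + p.1.1 * p.1.2)⁻¹ :=
  Matrix.coe_units_inv p.2.unit

/-- A section of the projection to the Van den Bergh space. -/
def fisSection (p : VdbPt d) : (fisLevel d).Pt :=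
  ⟨fisSectionPt p, fun _ => (val_fisSum_μ_inl (fisSectionPt p)).2 (by
    rw [fisSectionPt_h_zero, fisSectionPt_h_one]
    exact blocks_level_section p.2)⟩

theorem fisSection_regular {F : (fisLevel d).Pt → ℂ} (hF : F ∈ (fisLevel d).reg) :
    F ∘ fisSection ∈ (vdbSpace d).reg := by
  obtain ⟨f, hf, hF⟩ := hF
  have e : F ∘ fisSection = f ∘ fisSectionPt := funext fun p => hF (fisSection p)
  rw [e]
  refine comp_mem_of_adjoin (s := {F | IsFisGen d F}) (φ := fisSectionPt) ?_ hf
  have c1 : ∀ c : ℂ, (fun _ : VdbPt d => c) ∈ (vdbSpace d).reg := (vdbSpace d).reg.algebraMap_mem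
  have hx := entriesIn_vdb_x d
  have hy := entriesIn_vdb_y d
  have hk := entriesIn_vdb_k d
  rintro _ (⟨i, j⟩ | ⟨i, j⟩ | ⟨i, j⟩ | ⟨i, j⟩ | ⟨i, j⟩ | ⟨i, j⟩ | ⟨k, i, j⟩ | ⟨k, i, j⟩)
  · exact c1 _
  · exact c1 _
  · exact (hk.mul hy).neg i j
  · exact hx i j
  · exact hy i j
  · exact (hx.mul hk).neg i j
  · fin_cases k
    · exact (congrArg (· ∈ (vdbSpace d).reg) (funext fun p : VdbPt d =>
        congrFun (congrFun (fisSectionPt_h_zero p) i) j)).mpr (hk i j)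
    · exact ((EntriesIn.const 1).add (hx.mul hy)) i j
  · fin_cases k
    · exact (congrArg (· ∈ (vdbSpace d).reg) (funext fun p : VdbPt d =>
        congrFun (congrFun (fisSectionPt_h_zero_inv p) i) j)).mpr
        (((EntriesIn.const 1).add (hy.mul hx)) i j)
    · exact (congrArg (· ∈ (vdbSpace d).reg) (funext fun p : VdbPt d =>
        congrFun (congrFun (fisSectionPt_h_one_inv p) i) j)).mpr (entriesIn_vdb_l d i j)

/-- Points with the same projection lie in one orbit of the general linear group. -/
theorem fisLevelPt_eq_act {z z' : (fisLevel d).Pt} (h : fisProj d z = fisProj d z') :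
    ∃ g : GLProd (fisDim d), (∀ j, g (Sum.inr j) = 1) ∧ z'.1 = (fisSum d).act g z.1 := by
  have hx : (fisLevelPt z).x = (fisLevelPt z').x := congrArg (fun p : VdbPt d => p.1.1) h
  have hy : (fisLevelPt z).y = (fisLevelPt z').y := congrArg (fun p : VdbPt d => p.1.2) h
  obtain ⟨-, ha, hs, h0, h1⟩ := fisLevelPt_spec z
  obtain ⟨-, ha', hs', h0', h1'⟩ := fisLevelPt_spec z'
  -- The group element acts by `C ↦ C c⁻¹`, which carries the first `C` to the second; all other
  -- coordinates are functions of `x` and `y`.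
  let c : GL (Fin (∑ i, d i)) ℂ := (fisLevelPt z').C⁻¹ * (fisLevelPt z).C
  let g : GLProd (fisDim d) := fun k => match k with
    | Sum.inl _ => c
    | Sum.inr _ => 1
  refine ⟨g, fun _ => rfl, ?_⟩
  change fisLevelPt z' = fisAct (QHDatum.pullGL fisEquiv (fissionDim_eq d) g) (fisLevelPt z)
  have hN : fisNone (QHDatum.pullGL fisEquiv (fissionDim_eq d) g) = c := fisNone_pullGL g
  have hS : fisSome (QHDatum.pullGL fisEquiv (fissionDim_eq d) g) = 1 := fisSome_pullGL g
  have hh : ∀ i, (fisLevelPt z').h i = (fisLevelPt z).h i := by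
    intro i
    refine inv_injective (Units.ext ?_)
    fin_cases i
    · exact h0'.trans (by rw [← hx, ← hy]; exact h0.symm)
    · exact h1'.trans (by rw [← hx, ← hy]; exact h1.symm)
  refine FisPt.ext ?_ ?_ ?_ ?_ ?_ (funext fun i => ?_) <;>
    simp only [fisAct, hN, hS, map_one, Pi.one_apply, one_mul, inv_one, Units.val_one,
      Matrix.one_mul, Matrix.mul_one, mul_one]
  · simp only [c, _root_.mul_inv_rev, inv_inv, mul_inv_cancel_left]
  · rw [ha, ha', hx, hy]
  · exact hx.symm
  · exact hy.symm
  · rw [hs, hs', hx, hy]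
  · exact hh i

theorem fisProj_act {z z' : (fisLevel d).Pt} (g : GLProd (fisDim d))
    (h : z'.1 = (fisSum d).act g z.1) :
    fisProj d z' = (vdb d).act (fun j => g (Sum.inr j)) (fisProj d z) := by
  have hx := congrArg FisPt.x h
  have hy := congrArg FisPt.y h
  have hS := fisSome_pullGL g
  refine Subtype.ext (Prod.ext (hx.trans ?_) (hy.trans ?_))
  · change (fisSome (QHDatum.pullGL fisEquiv (fissionDim_eq d) g) 1).val * _ *
      ((fisSome (QHDatum.pullGL fisEquiv (fissionDim_eq d) g) 0)⁻¹).val = _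
    rw [hS]
    rfl
  · change (fisSome (QHDatum.pullGL fisEquiv (fissionDim_eq d) g) 0).val * _ *
      ((fisSome (QHDatum.pullGL fisEquiv (fissionDim_eq d) g) 1)⁻¹).val = _
    rw [hS]
    rfl

/-- The solutions for `a`, `s` and `h` hold at every point of the level set, hence over its ring of
functions, and so may be differentiated along its Zariski tangent vectors. The fission form
restricted there is then evaluated by `fissionForm_of_level` and `fusionTerms_four_eq_vdbForm`. -/
theorem fisLevel_form (z : (fisLevel d).Pt) (v w : (fisLevel d).Tangent z) :
    (vdb d).ω (fisProj d z) ((fisProj d).push v) ((fisProj d).push w) =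
      (fisSum d).ω z.1 (((fisSum d).X.incl (fisZ d)).push v)
        (((fisSum d).X.incl (fisZ d)).push w) := by
  let ι : Hom (fisLevel d) (fisSpace d) := (fisSum d).X.incl (fisZ d)
  let x := (fisX d).map ι.pull
  let y := (fisY d).map ι.pull
  have hval : ∀ {m n : Type} (F : Matrix m n (fisSpace d).reg) (z : (fisLevel d).Pt),
      val z (F.map ι.pull) = val (X := fisSpace d) (fisLevelPt z) F := fun _ _ => rfl
  have hxy : IsUnit (1 + x * y) := by
    -- The coordinate `h₁⁻¹` takes the value `(1 + xy)⁻¹` on the level set and so is a regular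
    -- inverse.
    refine isUnit_of_val (G := (fisH' d 1).map ι.pull) fun z => ?_
    obtain ⟨hu, -, -, -, h1⟩ := fisLevelPt_spec z
    have h2 : val (X := fisSpace d) (fisLevelPt z) (fisH' d 1) =
        (1 + (fisLevelPt z).x * (fisLevelPt z).y)⁻¹ := h1
    rw [val_one_add_mul, hval, hval, hval, h2]
    exact isUnit_mul_inv hu
  have hyx := isUnit_one_add_mul_comm hxy
  have hk : ∀ z : (fisLevel d).Pt, val z (1 + y * x)⁻¹ =
      (1 + (fisLevelPt z).y * (fisLevelPt z).x)⁻¹ := fun z => by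
    rw [val_inv hyx, val_one_add_mul]
    rfl
  have ha : (fisA d).map ι.pull = -((1 + y * x)⁻¹ * y) := ext_val fun z => by
    rw [val_neg, val_mul, hk]
    exact (fisLevelPt_spec z).2.1
  have hs : (fisS d).map ι.pull = -(x * (1 + y * x)⁻¹) := ext_val fun z => by
    rw [val_neg, val_mul, hk]
    exact (fisLevelPt_spec z).2.2.1
  have hm : ∀ F G : Matrix (Fin (∑ i, d i)) (Fin (∑ i, d i)) (fisSpace d).reg,
      (F * G).map ι.pull = F.map ι.pull * G.map ι.pull := fun F G => Matrix.map_mul (f := ι.pull)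
  have hu : ∀ {F : Matrix (Fin (∑ i, d i)) (Fin (∑ i, d i)) (fisSpace d).reg}, IsUnit F →
      IsUnit (F.map ι.pull) := fun h => h.map ι.pull.mapMatrix
  let S : Fin (2 * 2) → Matrix (Fin (∑ i, d i)) (Fin (∑ i, d i)) (fisLevel d).reg :=
    fun j => (fisStokes d j).map ι.pull
  have h1 : ∀ B, (blocks d 1 B 0 1).map ι.pull = blocks d 1 (B.map ι.pull) 0 1 := fun B => by
    rw [blocks_map, Matrix.map_one _ (map_zero _) (map_one _),
      Matrix.map_one _ (map_zero _) (map_one _), Matrix.map_zero _ (map_zero _)]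
  have h2 : ∀ B, (blocks d 1 0 B 1).map ι.pull = blocks d 1 0 (B.map ι.pull) 1 := fun B => by
    rw [blocks_map, Matrix.map_one _ (map_zero _) (map_one _),
      Matrix.map_one _ (map_zero _) (map_one _), Matrix.map_zero _ (map_zero _)]
  have s0 : S 0 = blocks d 1 (-((1 + y * x)⁻¹ * y)) 0 1 := by rw [← ha]; exact h1 _
  have s1 : S 1 = blocks d 1 0 x 1 := h2 _
  have s2 : S 2 = blocks d 1 y 0 1 := h1 _
  have s3 : S 3 = blocks d 1 0 (-(x * (1 + y * x)⁻¹)) 1 := by rw [← hs]; exact h2 _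
  have hb : (blockDiag d (fisH d)).map ι.pull *
      ([S 3, S 2, S 1, S 0] : List (Matrix _ _ (fisLevel d).reg)).prod = 1 := by
    have e : (blockDiag d (fisH d)).map ι.pull *
        ([S 3, S 2, S 1, S 0] : List (Matrix _ _ (fisLevel d).reg)).prod =
        (blockDiag d (fisH d) * stokesProd (fisStokes d) (2 * 2)).map ι.pull := by
      have e : stokesProd (fisStokes d) (2 * 2) = fisStokes d 3 * (fisStokes d 2 * (fisStokes d 1 *
        (fisStokes d 0 * 1))) := rfl
      rw [e, mul_one, hm, hm, hm, hm]
      simp only [List.prod_cons, List.prod_nil, mul_one]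
      rfl
    rw [e]
    refine ext_val fun z => ?_
    refine (hval _ z).trans (((val_fis_level (fisLevelPt z)).trans ?_).trans (val_one z).symm)
    exact (val_fisSum_μ_inl (fisLevelPt z)).1 (z.2 ())
  have hL : (vdb d).ω (fisProj d z) ((fisProj d).push v) ((fisProj d).push w) =
      vdbForm x y v w := rfl
  have hR : (fisSum d).ω z.1 (((fisSum d).X.incl (fisZ d)).push v)
      (((fisSum d).X.incl (fisZ d)).push w) =
      fissionForm (fisC d) (fisStokes d) (blockDiag d (fisH d)) (ι.push v) (ι.push w) := rfl
  rw [hL, hR, fissionForm_push, fissionForm_of_level (hu (isUnit_fisC d))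
    (fun j => hu (isUnit_fisStokes d j)) (hu (isUnit_blockDiag_fisH d)) hb]
  change _ = -(1 / 2 : ℂ) * fusionTerms v w [S 3, S 2, S 1, S 0]
  rw [s0, s1, s2, s3, fusionTerms_four_eq_vdbForm hxy]

/-- The fibres of the projection to `(x, y)` are single orbits, which only move `C`, and `C = 1` is
a regular section. Invariant functions therefore descend by restriction to the section. -/
theorem isReduction_vdb : (fisSum d).IsReduction (vdb d) := by
  refine ⟨(isQuasiHamiltonian_vdb d).1, fisProj d, ⟨(vdb d).affine, ?_, ?_⟩,
    fun p => ⟨fisSection p, rfl⟩, fun z z' h => fisLevelPt_eq_act h,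
    fun g z z' h => fisProj_act g h, fun z j => ?_, fisLevel_form⟩
  · rintro z z' ⟨g, hg, h⟩
    refine ((fisProj_act (z := z) (z' := z') g h).trans ?_).symm
    have e : (fun j => g (Sum.inr j)) = (1 : GLProd d) := funext hg
    rw [e]
    exact (vdb d).act_one _
  · intro F hF hinv
    refine ⟨⟨F ∘ fisSection, fisSection_regular hF⟩, funext fun z => ?_, fun f hf =>
      Subtype.ext (funext fun p => ?_)⟩
    · exact hinv z (fisSection (fisProj d z)) (fisLevelPt_eq_act rfl)
    · exact (congrFun hf (fisSection p)).symm
  · rw [fisSum_μ_inr]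
    obtain ⟨-, -, -, h0, h1⟩ := fisLevelPt_spec z
    fin_cases j
    · refine Eq.trans ?_ ((congrArg (val (X := fisSpace d) (fisLevelPt z)) (fisH_inv d 0)).trans
        h0).symm
      exact val_one_add_mul (X := vdbSpace d) _ _ _
    · refine Eq.trans ?_ ((congrArg (val (X := fisSpace d) (fisLevelPt z)) (fisH_inv d 1)).trans
        h1).symm
      exact (val_inv (isUnit_vdb d) _).trans
        (congrArg (·⁻¹) (val_one_add_mul (X := vdbSpace d) _ _ _))

theorem fissionBuilt_vdb (d : Fin 2 → ℕ) : FissionBuilt (vdb d) :=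
  FissionBuilt.reduction _ _ ((FissionBuilt.fission d 2 _ one_le_two one_le_two
    (isFissionSpace_fis d)).relabelled fisEquiv (fissionDim_eq d)) isReduction_vdb

end FissionReduction

end FissionVar

end

/-! ### Iterated fusion along an ordered list -/

noncomputable section

namespace FissionVar

open FunSpace QHDatum

/-! ### Fusion of a list of factors at the vertices of a quiver -/

theorem pullGL_pullGL {I J V : Type} {n : I → ℕ} {m : J → ℕ} {α : V → ℕ} {f : I → J}
    {r : I → V} {r' : J → V} (hf : ∀ i, n i = m (f i)) (hr : ∀ i, n i = α (r i))
    (hr' : ∀ j, m j = α (r' j)) (h : ∀ i, r' (f i) = r i) (g : GLProd α) :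
    pullGL f hf (pullGL r' hr' g) = pullGL r hr g := by
  funext i
  apply Units.ext
  rw [pullGL_val, pullGL_val, pullGL_val, castMat_trans,
    ← castMat_family (fun j => (g j).val) (h i), castMat_trans]

theorem wedgeTr_castMat {T : Type} {a b c : ℕ} (h : a = b) (h' : c = b)
    (β : T → Matrix (Fin a) (Fin a) ℂ) (γ : T → Matrix (Fin c) (Fin c) ℂ) (v w : T) :
    wedgeTr (fun u => castMat h (β u)) (fun u => castMat h' (γ u)) v w =
      wedgeTr β (fun u => castMat (h'.trans h.symm) (γ u)) v w := by
  subst h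
  rfl

section FuseList

variable {B V : Type} (h : B → V) (α : V → ℕ)

open Classical in
/-- The members of the list `L` of factors that are based at the vertex `i`. -/
def listAt {R : Type} (F : ∀ b, Matrix (Fin (α (h b))) (Fin (α (h b))) R) (L : List B) (i : V) :
    List (Matrix (Fin (α i)) (Fin (α i)) R) :=
  L.flatMap fun b => if hb : h b = i then [castMat (congrArg α hb) (F b)] else []

variable {α h} in
theorem listAt_cons_self {R : Type} (F : ∀ b, Matrix (Fin (α (h b))) (Fin (α (h b))) R)
    (c : B) (L : List B) : listAt h α F (c :: L) (h c) = F c :: listAt h α F L (h c) := by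
  rw [listAt, List.flatMap_cons, dif_pos rfl]
  rfl

variable {α h} in
theorem listAt_cons_of_ne {R : Type} (F : ∀ b, Matrix (Fin (α (h b))) (Fin (α (h b))) R)
    {c : B} (L : List B) {i : V} (hi : h c ≠ i) :
    listAt h α F (c :: L) i = listAt h α F L i := by
  rw [listAt, List.flatMap_cons, dif_neg hi]
  rfl

/-- The vertex at which a factor is based, after the factors in `L` have been absorbed. -/
def vtx (L : List B) : {b // b ∉ L} ⊕ V → V := Sum.elim (fun b => h b.1) id

open Classical in
/-- The map of index sets that absorbs the factor `c` in the factor of its vertex. -/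
def absorb (c : B) (L : List B) : {b // b ∉ L} ⊕ V → {b // b ∉ c :: L} ⊕ V
  | .inl b => if hb : b.1 = c then .inr (h c)
      else .inl ⟨b.1, fun hm => (List.mem_cons.1 hm).elim hb b.2⟩
  | .inr i => .inr i

variable {h}

theorem absorb_self {c : B} {L : List B} (hc : c ∉ L) :
    absorb h c L (.inl ⟨c, hc⟩) = .inr (h c) := dif_pos rfl

theorem absorb_of_ne {b c : B} {L : List B} (hb : b ∉ c :: L) (hb' : b ∉ L) :
    absorb h c L (.inl ⟨b, hb'⟩) = .inl ⟨b, hb⟩ :=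
  dif_neg fun e : b = c => hb (e ▸ List.mem_cons_self)

theorem vtx_absorb (c : B) (L : List B) (t : {b // b ∉ L} ⊕ V) :
    vtx h (c :: L) (absorb h c L t) = vtx h L t := by
  rcases t with ⟨b, hb⟩ | i
  · by_cases e : b = c
    · subst e
      rw [absorb_self]
      rfl
    · rw [absorb_of_ne (fun hm => (List.mem_cons.1 hm).elim e hb)]
      rfl
  · rfl

theorem isFusionMap_absorb {c : B} {L : List B} (hc : c ∉ L) :
    IsFusionMap (absorb h c L) (.inl ⟨c, hc⟩) (.inr (h c)) where
  ne := Sum.inl_ne_inr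
  eq := (absorb_self hc).symm
  surj := by
    rintro (⟨b, hb⟩ | i)
    · exact ⟨.inl ⟨b, fun hm => hb (List.mem_cons_of_mem _ hm)⟩, absorb_of_ne hb _⟩
    · exact ⟨.inr i, rfl⟩
  inj := by
    have hl : ∀ (b : {b // b ∉ L}) (i : V), absorb h c L (.inl b) = .inr i →
        b = ⟨c, hc⟩ ∧ i = h c := by
      rintro ⟨b, hb⟩ i e
      by_cases hbc : b = c
      · subst hbc
        rw [absorb_self] at e
        exact ⟨rfl, (Sum.inr.inj e).symm⟩
      · rw [absorb_of_ne (fun hm => (List.mem_cons.1 hm).elim hbc hb)] at e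
        exact absurd e Sum.inl_ne_inr
    rintro (b | i) (b' | i') e
    · by_cases hb : b.1 = c
      · have hb : b = ⟨c, hc⟩ := Subtype.ext hb
        subst hb
        rw [absorb_self] at e
        rw [(hl b' _ e.symm).1]
        exact Or.inl rfl
      · rw [absorb_of_ne (fun hm => (List.mem_cons.1 hm).elim hb b.2)] at e
        by_cases hb' : b'.1 = c
        · have hb' : b' = ⟨c, hc⟩ := Subtype.ext hb'
          subst hb'
          rw [absorb_self] at e
          exact absurd e Sum.inl_ne_inr
        · rw [absorb_of_ne (fun hm => (List.mem_cons.1 hm).elim hb' b'.2)] at e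
          have e' : b.1 = b'.1 := Subtype.mk.inj (Sum.inl.inj e)
          exact Or.inl (congrArg Sum.inl (Subtype.ext e'))
    · obtain ⟨rfl, rfl⟩ := hl b i' e
      exact Or.inr (Or.inl ⟨rfl, rfl⟩)
    · obtain ⟨rfl, rfl⟩ := hl b' i e.symm
      exact Or.inr (Or.inr ⟨rfl, rfl⟩)
    · exact Or.inl (congrArg Sum.inr (Sum.inr.inj e))

variable {α}

/-- The moment map of the free factor `b`. -/
def freeμ (M : QHDatum ({b : B // b ∉ []} ⊕ V) (fun t => α (vtx h [] t))) (b : B) :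
    Matrix (Fin (α (h b))) (Fin (α (h b))) M.X.reg := M.μ (.inl ⟨b, List.not_mem_nil⟩)

/-- The moment map of the vertex `i`. -/
def vertexμ (M : QHDatum ({b : B // b ∉ []} ⊕ V) (fun t => α (vtx h [] t))) (i : V) :
    Matrix (Fin (α i)) (Fin (α i)) M.X.reg := M.μ (.inr i)

/-- The moment maps fused at the vertex `i`. -/
def momentsAt (M : QHDatum ({b : B // b ∉ []} ⊕ V) (fun t => α (vtx h [] t))) (L : List B)
    (i : V) : List (Matrix (Fin (α i)) (Fin (α i)) M.X.reg) :=
  listAt h α (freeμ M) L i ++ [vertexμ M i]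

/-- `N` is obtained from `M` by fusing the factors in the list `L`, in this order, in front of the
factors of their vertices. -/
structure IsListFusion [Fintype V] (M : QHDatum ({b : B // b ∉ []} ⊕ V) (fun t => α (vtx h [] t)))
    (L : List B) (N : QHDatum ({b // b ∉ L} ⊕ V) (fun t => α (vtx h L t))) (φ : Hom M.X N.X) :
    Prop where
  iso : φ.IsIso
  act : ∀ (g : GLProd α) x, φ (M.act (pullGL (vtx h []) (fun _ => rfl) g) x) =
    N.act (pullGL (vtx h L) (fun _ => rfl) g) (φ x)
  μ_inl : ∀ b hb, (N.μ (.inl ⟨b, hb⟩)).map φ.pull = freeμ M b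
  μ_inr : ∀ i, (N.μ (.inr i)).map φ.pull = (momentsAt M L i).prod
  form : ∀ x (v w : M.X.Tangent x), N.ω (φ x) (φ.push v) (φ.push w) = M.ω x v w -
    (1 / 2 : ℂ) * ∑ i, fusionTerms v w (momentsAt M L i)

variable {M : QHDatum ({b : B // b ∉ []} ⊕ V) (fun t => α (vtx h [] t))}

theorem momentsAt_cons_self (c : B) (L : List B) :
    momentsAt M (c :: L) (h c) = freeμ M c :: momentsAt M L (h c) := by
  rw [momentsAt, listAt_cons_self, List.cons_append, momentsAt]

theorem momentsAt_cons_of_ne {c : B} {L : List B} {i : V} (hi : h c ≠ i) :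
    momentsAt M (c :: L) i = momentsAt M L i := by
  rw [momentsAt, listAt_cons_of_ne _ _ hi, momentsAt]

variable [Fintype V]

theorem IsListFusion.nil : IsListFusion M [] M (Hom.id M.X) where
  iso := Hom.id_isIso _
  act _ _ := rfl
  μ_inl _ _ := rfl
  μ_inr i := by
    rw [momentsAt, listAt, List.flatMap_nil, List.nil_append, List.prod_singleton]
    rfl
  form x v w := by
    have e : ∀ i, fusionTerms v w (momentsAt M [] i) = 0 :=
      fun i => by
        rw [momentsAt, listAt, List.flatMap_nil, List.nil_append, fusionTerms, fusionTerms, List.prod_nil,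
          wedgeTr, mcR_one, mcR_one, Matrix.mul_zero, Matrix.mul_zero, Matrix.trace_zero,
          sub_zero, add_zero]
    simp only [e, Finset.sum_const_zero, mul_zero, sub_zero]
    rfl

/-- The list is absorbed from its last element to its first, each factor being placed in front of
what its vertex already carries. The new fusion term pairs `c` with the product of the factors
already there, which is the recursion defining `fusionTerms`. -/
theorem IsListFusion.cons {c : B} {L : List B} (hc : c ∉ L)
    {N : QHDatum ({b // b ∉ L} ⊕ V) (fun t => α (vtx h L t))} {φ : Hom M.X N.X}
    (H : IsListFusion M L N φ) :
    IsListFusion M (c :: L)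
      (N.fuse (fun t => congrArg α (vtx_absorb c L t).symm) (isFusionMap_absorb hc)) φ := by
  classical
  set hf : ∀ t, α (vtx h L t) = α (vtx h (c :: L) (absorb h c L t)) :=
    fun t => congrArg α (vtx_absorb c L t).symm
  have hm := isFusionMap_absorb (h := h) hc
  have hF : (N.μ (.inl ⟨c, hc⟩)).map φ.pull = freeμ M c := H.μ_inl c hc
  let μ' : ∀ j, Matrix (Fin (α (vtx h (c :: L) j))) (Fin (α (vtx h (c :: L) j))) N.X.reg :=
    N.fuseμ (m := fun t => α (vtx h (c :: L) t)) (absorb h c L) hf _ _ hm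
  -- The fused moment map is known only at indices of the form `absorb h c L t`; this moves it along
  -- an equality of indices, with any proof that the sizes agree.
  have key : ∀ {j j' : {b // b ∉ c :: L} ⊕ V} (_ : j = j')
      (e' : α (vtx h (c :: L) j) = α (vtx h (c :: L) j')), μ' j' = castMat e' (μ' j) := by
    rintro j _ rfl _
    rfl
  have key₁ : μ' (absorb h c L (.inl ⟨c, hc⟩)) = _ :=
    N.fuseμ_fused (m := fun t => α (vtx h (c :: L) t)) hf hm
  have key₂ : ∀ t (h₁ : t ≠ .inl ⟨c, hc⟩) (h₂ : t ≠ .inr (h c)), μ' (absorb h c L t) = _ :=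
    fun t h₁ h₂ => N.fuseμ_of_ne (m := fun t => α (vtx h (c :: L) t)) hf hm h₁ h₂
  let ν : ∀ b, b ∉ L → Matrix (Fin (α (h b))) (Fin (α (h b))) N.X.reg := fun b hb => N.μ (.inl ⟨b, hb⟩)
  let ν' : ∀ i, Matrix (Fin (α i)) (Fin (α i)) N.X.reg := fun i => N.μ (.inr i)
  have hμc : μ' (.inr (h c)) = ν c hc * ν' (h c) := by
    rw [key (absorb_self hc) (by rw [absorb_self hc]), key₁, castMat_mul, castMat_trans,
      castMat_trans]
    rfl
  refine ⟨H.iso, fun g x => ?_, fun b hb => ?_, fun i => ?_, fun x v w => ?_⟩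
  · refine (H.act g x).trans ?_
    exact congrArg (fun k => N.act k (φ x))
      (pullGL_pullGL hf (fun _ => rfl) (fun _ => rfl) (vtx_absorb c L) g).symm
  · have hb' : b ∉ L := fun hm => hb (List.mem_cons_of_mem _ hm)
    refine Eq.trans ?_ (H.μ_inl b hb')
    have e : μ' (.inl ⟨b, hb⟩) = ν b hb' := by
      rw [key (absorb_of_ne (h := h) hb hb') (by rw [absorb_of_ne (h := h) hb hb']), key₂ _ (fun e => hb ?_)
        Sum.inl_ne_inr, castMat_trans]
      · rfl
      · have e' : b = c := Subtype.mk.inj (Sum.inl.inj e)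
        exact e' ▸ List.mem_cons_self
    exact congrArg (fun G : Matrix (Fin (α (h b))) (Fin (α (h b))) N.X.reg => G.map φ.pull) e
  · by_cases hi : h c = i
    · subst hi
      rw [momentsAt_cons_self, List.prod_cons, ← H.μ_inr, ← hF]
      exact (congrArg (fun G : Matrix (Fin (α (h c))) (Fin (α (h c))) N.X.reg =>
        G.map φ.pull) hμc).trans (Matrix.map_mul (f := φ.pull))
    · rw [momentsAt_cons_of_ne hi, ← H.μ_inr]
      have e : μ' (.inr i) = ν' i :=
        key₂ (.inr i) Sum.inr_ne_inl fun e => hi (Sum.inr.inj e).symm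
      exact congrArg (fun G : Matrix (Fin (α i)) (Fin (α i)) N.X.reg => G.map φ.pull) e
  · have e1 : ∀ i, fusionTerms v w (momentsAt M (c :: L) i) =
        fusionTerms v w (momentsAt M L i) +
        if i = h c then wedgeTr (fun u : M.X.Tangent x => mcL (freeμ M c) u)
          (fun u => mcR (momentsAt M L (h c)).prod u) v w else 0 := by
      intro i
      by_cases hi : h c = i
      · subst hi
        rw [momentsAt_cons_self, fusionTerms, if_pos rfl, add_comm]
      · rw [momentsAt_cons_of_ne hi, if_neg (Ne.symm hi), add_zero]
    -- By the inductive hypothesis the moment map of `N` at the vertex of `c` pulls back to the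
    -- product of the moments already absorbed there.
    have e2 : (N.fuse (m := fun t => α (vtx h (c :: L) t)) hf hm).ω (φ x) (φ.push v) (φ.push w) =
        N.ω (φ x) (φ.push v) (φ.push w) - (1 / 2 : ℂ) *
          wedgeTr (fun u : M.X.Tangent x => mcL (freeμ M c) u)
          (fun u => mcR (momentsAt M L (h c)).prod u) v w := by
      rw [← H.μ_inr, ← hF]
      refine congrArg (fun r => N.ω (φ x) (φ.push v) (φ.push w) - (1 / 2 : ℂ) * r) ?_
      exact wedgeTr_castMat (hf _) ((hf _).trans (congrArg (fun t => α (vtx h (c :: L) t)) hm.eq))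
        (fun u => mcL (N.μ (.inl ⟨c, hc⟩)) u) (fun u => mcR (N.μ (.inr (h c))) u)
        (φ.push v) (φ.push w)
    refine e2.trans ?_
    rw [H.form, Finset.sum_congr rfl fun i _ => e1 i, Finset.sum_add_distrib, Finset.sum_ite_eq',
      if_pos (Finset.mem_univ _)]
    ring

/-- The axioms are carried for every `Fintype` structure, because the index type changes at each
fusion. Absence of repetitions ensures that each factor is still free when its turn comes. -/
theorem exists_isListFusion [Fintype B] (hM : FissionBuilt M)
    (hM' : ∀ _ : Fintype ({b : B // b ∉ []} ⊕ V), M.IsQuasiHamiltonian) (L : List B)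
    (hL : L.Nodup) :
    ∃ (N : QHDatum ({b // b ∉ L} ⊕ V) (fun t => α (vtx h L t))) (φ : Hom M.X N.X),
      FissionBuilt N ∧ (∀ _ : Fintype ({b : B // b ∉ L} ⊕ V), N.IsQuasiHamiltonian) ∧
      IsListFusion M L N φ := by
  classical
  induction L with
  | nil => exact ⟨M, Hom.id M.X, hM, hM', IsListFusion.nil⟩
  | cons c L ih =>
    obtain ⟨hc, hL⟩ := List.nodup_cons.1 hL
    obtain ⟨N, φ, hN, hN', H⟩ := ih hL
    exact ⟨_, φ, hN.fused _ (isFusionMap_absorb hc),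
      fun _ => (hN' inferInstance).fuse _ (isFusionMap_absorb hc), H.cons hc⟩

end FuseList

end FissionVar

end

noncomputable section

namespace FissionVar

open FunSpace QHDatum

/-! ### The product of the Van den Bergh spaces of a quiver -/

section QuiverSpace

variable {V A : Type} (src tgt : A → V) (α : V → ℕ)

/-- The dimensions at the ends of an arrow. -/
def endDim (a : A) : Fin 2 → ℕ
  | 0 => α (tgt a)
  | 1 => α (src a)

/-- The index sets of the groups acting on the pieces of a quiver. -/
abbrev PieceIdx : A ⊕ V → Type
  | .inl _ => Fin 2
  | .inr _ => Unit

instance (t : A ⊕ V) : Fintype (PieceIdx t) :=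
  match t with
  | .inl _ => inferInstanceAs (Fintype (Fin 2))
  | .inr _ => inferInstanceAs (Fintype Unit)

/-- The dimensions of the pieces of a quiver. -/
abbrev pieceDim : ∀ t : A ⊕ V, PieceIdx t → ℕ
  | .inl a => endDim src tgt α a
  | .inr i => fun _ => α i

variable (q : V → ℂˣ)

/-- The pieces of a quiver: a Van den Bergh space for each arrow and a point for each vertex. -/
def piece : ∀ t : A ⊕ V, QHDatum (PieceIdx t) (pieceDim src tgt α t)
  | .inl a => vdb (endDim src tgt α a)
  -- The scalar is inverted so that the value `1` of the fused moment map means that the product of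
  -- the arrow factors equals `q i`.
  | .inr i => scalarClass (α i) (q i)⁻¹

theorem fissionBuilt_piece (t : A ⊕ V) : FissionBuilt (piece src tgt α q t) :=
  match t with
  | .inl a => fissionBuilt_vdb (endDim src tgt α a)
  | .inr i => FissionBuilt.conj _ _ (isConjugacyClass_scalarClass (α i) (q i)⁻¹)

theorem isQuasiHamiltonian_piece (t : A ⊕ V) : (piece src tgt α q t).IsQuasiHamiltonian :=
  match t with
  | .inl a => isQuasiHamiltonian_vdb (endDim src tgt α a)
  | .inr i => isQuasiHamiltonian_scalarClass (α i) (q i)⁻¹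

theorem exists_isBasicOpen_piece (t : A ⊕ V) :
    ∃ (σ : Type) (_ : Finite σ) (f : MvPolynomial σ ℂ) (c : σ → (piece src tgt α q t).X.reg),
      IsBasicOpen (piece src tgt α q t).X f c :=
  match t with
  | .inl a => ⟨_, inferInstance, _, _, vdbSpace_isBasicOpen (endDim src tgt α a)⟩
  | .inr _ => ⟨_, inferInstance, _, _, onePt_isBasicOpen⟩

theorem isQuasiHamiltonian_pi_piece [Fintype V] [Fintype A] :
    (QHDatum.pi (piece src tgt α q)).IsQuasiHamiltonian := by
  choose σ hσ f c h using exists_isBasicOpen_piece src tgt α q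
  exact isQuasiHamiltonian_pi (isBasicOpen_pi _ h).smooth (isQuasiHamiltonian_piece src tgt α q)

/-- The factors of the group acting on the product of the pieces of a quiver are indexed by the
arrows of the double quiver and the vertices. -/
def pieceEquiv : (Σ t : A ⊕ V, PieceIdx t) ≃ {b : A ⊕ A // b ∉ []} ⊕ V where
  toFun
    | ⟨.inl a, (0 : Fin 2)⟩ => .inl ⟨.inl a, List.not_mem_nil⟩
    | ⟨.inl a, (1 : Fin 2)⟩ => .inl ⟨.inr a, List.not_mem_nil⟩
    | ⟨.inr i, _⟩ => .inr i
  invFun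
    | .inl ⟨.inl a, _⟩ => ⟨.inl a, (0 : Fin 2)⟩
    | .inl ⟨.inr a, _⟩ => ⟨.inl a, (1 : Fin 2)⟩
    | .inr i => ⟨.inr i, ()⟩
  left_inv := by
    rintro ⟨a | i, j⟩
    · match j with
      | (0 : Fin 2) => rfl
      | (1 : Fin 2) => rfl
    · rfl
  right_inv := by rintro (⟨a | a, _⟩ | i) <;> rfl

theorem pieceDim_eq : ∀ p : Σ t : A ⊕ V, PieceIdx t,
    pieceDim src tgt α p.1 p.2 = α (vtx (headD src tgt) [] (pieceEquiv p))
  | ⟨.inl _, (0 : Fin 2)⟩ => rfl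
  | ⟨.inl _, (1 : Fin 2)⟩ => rfl
  | ⟨.inr _, _⟩ => rfl

variable [Fintype V] [Fintype A]

/-- The product of the pieces of a quiver, with the factors of the group indexed by the arrows of
the double quiver and the vertices. -/
def unfused : QHDatum ({b : A ⊕ A // b ∉ []} ⊕ V) (fun t => α (vtx (headD src tgt) [] t)) :=
  (QHDatum.pi (piece src tgt α q)).relabel (m := fun t => α (vtx (headD src tgt) [] t))
    pieceEquiv (pieceDim_eq src tgt α)

/-- The product of the Van den Bergh spaces of a quiver. -/
abbrev quiverSpace : FunSpace := FunSpace.pi fun t => (piece src tgt α q t).X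

/-- The projection to the Van den Bergh space of an arrow. -/
def projArrow (a : A) : Hom (quiverSpace src tgt α q) (vdbSpace (endDim src tgt α a)) :=
  proj (fun t => (piece src tgt α q t).X) (.inl a)

/-- The tautological representation over the product of the Van den Bergh spaces of a quiver. -/
def tautRep : RepD src tgt α (quiverSpace src tgt α q).reg
  | .inl a => (vdbY (endDim src tgt α a)).map (projArrow src tgt α q a).pull
  | .inr a => (vdbX (endDim src tgt α a)).map (projArrow src tgt α q a).pull

/-- The exponents `ε(b)` are built into the moment map of the Van den Bergh space. Its component at
the head of `a` is `1 + aa*`, and the one at the tail is `(1 + a*a)⁻¹`. -/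
theorem freeμ_unfused (b : A ⊕ A) :
    freeμ (unfused src tgt α q) b = factor (tautRep src tgt α q) b := by
  have hp := fun p => (QHDatum.pi (piece src tgt α q)).relabel_μ
    (m := fun t => α (vtx (headD src tgt) [] t)) pieceEquiv (pieceDim_eq src tgt α) p
  rcases b with a | a
  · refine (hp ⟨.inl a, (0 : Fin 2)⟩).trans ?_
    exact map_one_add_mul (projArrow src tgt α q a).pull.toRingHom (vdbY (endDim src tgt α a))
      (vdbX (endDim src tgt α a))
  · refine (hp ⟨.inl a, (1 : Fin 2)⟩).trans ?_
    refine (map_inv_of_isUnit (projArrow src tgt α q a).pull.toRingHom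
      (isUnit_vdb (endDim src tgt α a))).trans ?_
    exact congrArg (·⁻¹) (map_one_add_mul (projArrow src tgt α q a).pull.toRingHom
      (vdbX (endDim src tgt α a)) (vdbY (endDim src tgt α a)))

theorem vertexμ_unfused (i : V) : vertexμ (unfused src tgt α q) i =
    (quiverSpace src tgt α q).constMat (scalarGL (α i) (q i)⁻¹).val :=
  (QHDatum.pi (piece src tgt α q)).relabel_μ
    (m := fun t => α (vtx (headD src tgt) [] t)) pieceEquiv (pieceDim_eq src tgt α) ⟨.inr i, ()⟩

theorem isUnit_factor_tautRep (b : A ⊕ A) : IsUnit (factor (tautRep src tgt α q) b) := by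
  rw [← freeμ_unfused]
  exact (unfused src tgt α q).μ_unit _

theorem unfused_ω {x : (quiverSpace src tgt α q).Pt} (v w : (quiverSpace src tgt α q).Tangent x) :
    (unfused src tgt α q).ω x v w = ∑ a, vdbForm
      (opp (tautRep src tgt α q) a) (arr (tautRep src tgt α q) a) v w := by
  have h : (unfused src tgt α q).ω x v w = ∑ t, (piece src tgt α q t).ω (x t)
      ((proj (fun t => (piece src tgt α q t).X) t).push v)
      ((proj (fun t => (piece src tgt α q t).X) t).push w) := rfl
  rw [h, Fintype.sum_sum_type]
  refine (congrArg₂ (· + ·) (Finset.sum_congr rfl fun a _ => ?_)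
    (Finset.sum_eq_zero fun i _ => ?_)).trans (add_zero _)
  · rfl
  · rfl

theorem listAt_factor (ord : List (A ⊕ A)) (i : V) :
    listAt (headD src tgt) α (freeμ (unfused src tgt α q)) ord i =
      factorsAt ord (tautRep src tgt α q) i := by
  have h : freeμ (unfused src tgt α q) = factor (tautRep src tgt α q) :=
    funext (freeμ_unfused src tgt α q)
  rw [h]
  rfl

theorem isUnit_of_mem_listAt {B V R : Type} [CommRing R] {h : B → V} {α : V → ℕ}
    {F : ∀ b, Matrix (Fin (α (h b))) (Fin (α (h b))) R} (hF : ∀ b, IsUnit (F b)) {L : List B}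
    {i : V} {G : Matrix (Fin (α i)) (Fin (α i)) R} (hG : G ∈ listAt h α F L i) : IsUnit G := by
  obtain ⟨b, -, hb⟩ := List.mem_flatMap.1 hG
  split_ifs at hb with hi
  · rw [List.mem_singleton.1 hb]
    exact castMat_isUnit _ (hF b)
  · exact absurd hb List.not_mem_nil

/-- A constant map has zero Maurer-Cartan forms, so the parameters `q` shift the moment map but
leave the two-form alone. -/
theorem fusionTerms_concat_constMat {X : FunSpace} {m : Type} [Fintype m] [DecidableEq m]
    {L : List (Matrix m m X.reg)} (hL : ∀ F ∈ L, IsUnit F) {c : Matrix m m ℂ}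
    (hc : IsUnit (X.constMat c)) {x : X.Pt} (v w : X.Tangent x) :
    fusionTerms v w (L ++ [X.constMat c]) = fusionTerms v w L := by
  rw [fusionTerms_concat L hL hc, wedgeTr, mcR, mcR, der_constMat, der_constMat, Matrix.zero_mul,
    Matrix.mul_zero, Matrix.mul_zero, sub_self, add_zero]

/-- The fused space is kept together with an isomorphism from the unfused product. Its moment map
and form can thus be compared with those of representations through the tautological one. -/
theorem exists_fusedQuiver {ord : List (A ⊕ A)} (hnodup : ord.Nodup) (hall : ∀ b, b ∈ ord) :
    ∃ (M : QHDatum V α) (φ : Hom (quiverSpace src tgt α q) M.X), FissionBuilt M ∧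
      M.IsQuasiHamiltonian ∧ φ.IsIso ∧
      (∀ (g : GLProd α) x, φ ((unfused src tgt α q).act
        (pullGL (vtx (headD src tgt) []) (fun _ => rfl) g) x) = M.act g (φ x)) ∧
      (∀ i, (M.μ i).map φ.pull = (factorsAt ord (tautRep src tgt α q) i).prod *
        (quiverSpace src tgt α q).constMat (scalarGL (α i) (q i)⁻¹).val) ∧
      ∀ x (v w : (quiverSpace src tgt α q).Tangent x), M.ω (φ x) (φ.push v) (φ.push w) =
        ∑ a, vdbForm (opp (tautRep src tgt α q) a)
          (arr (tautRep src tgt α q) a) v w -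
        (1 / 2 : ℂ) * ∑ i, fusionTerms v w (factorsAt ord (tautRep src tgt α q) i) := by
  classical
  obtain ⟨N, φ, hN, hN', H⟩ := exists_isListFusion (M := unfused src tgt α q)
    ((fissionBuilt_pi (fissionBuilt_piece src tgt α q)).relabelled _ _)
    (fun _ => (isQuasiHamiltonian_pi_piece src tgt α q).relabel
      (m := fun t => α (vtx (headD src tgt) [] t)) _ _) ord hnodup
  -- Every arrow of the double quiver has been absorbed, so the factors of the group are now indexed
  -- by the vertices alone.
  have : IsEmpty {b // b ∉ ord} := ⟨fun b => b.2 (hall b.1)⟩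
  let e : {b // b ∉ ord} ⊕ V ≃ V := Equiv.emptySum _ V
  have he : ∀ t, α (vtx (headD src tgt) ord t) = α (e t) := by
    rintro (b | i)
    · exact isEmptyElim b
    · rfl
  have hm : ∀ i, momentsAt (unfused src tgt α q) ord i =
      factorsAt ord (tautRep src tgt α q) i ++
        [(quiverSpace src tgt α q).constMat (scalarGL (α i) (q i)⁻¹).val] := fun i =>
    congrArg₂ (fun L F => L ++ [F]) (listAt_factor src tgt α q ord i)
      (vertexμ_unfused src tgt α q i)
  refine ⟨N.relabel e he, φ, hN.relabelled e he, (hN' inferInstance).relabel e he, H.iso,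
    fun g x => ?_, fun i => ?_, fun x v w => ?_⟩
  · refine (H.act g x).trans (congrArg (fun k => N.act k (φ x)) (funext fun t => ?_))
    rcases t with b | i
    · exact isEmptyElim b
    · exact Units.ext rfl
  · refine (congrArg (fun G : Matrix (Fin (α i)) (Fin (α i)) N.X.reg => G.map φ.pull)
      (N.relabel_μ e he (.inr i))).trans ((H.μ_inr i).trans ?_)
    refine (congrArg List.prod (hm i)).trans ?_
    exact List.prod_append.trans (congrArg (_ * ·) List.prod_singleton)
  · refine (H.form x v w).trans (congrArg₂ (fun r s => r - (1 / 2 : ℂ) * s)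
      (unfused_ω src tgt α q v w) (Finset.sum_congr rfl fun i _ => ?_))
    exact (congrArg (fusionTerms v w) (hm i)).trans <| fusionTerms_concat_constMat
      (fun F hF => isUnit_of_mem_listAt (isUnit_factor_tautRep src tgt α q) hF)
      (((scalarGL (α i) (q i)⁻¹).isUnit).map (algebraMap ℂ _).mapMatrix) v w

end QuiverSpace

end FissionVar

end

noncomputable section

namespace FissionVar

open FunSpace QHDatum

section

variable {V A : Type} {src tgt : A → V} {α : V → ℕ}

/-! ### Base change of representations of the double quiver -/

theorem onePlus_map {R S : Type} [CommRing R] [CommRing S] (f : R →+* S) (x : RepD src tgt α R)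
    (b : A ⊕ A) : (onePlus x b).map f = onePlus (fun b => (x b).map f) b := by
  rcases b with a | a
  · exact map_one_add_mul f (arr x a) (opp x a)
  · exact map_one_add_mul f (opp x a) (arr x a)

theorem factor_map {R S : Type} [CommRing R] [CommRing S] (f : R →+* S) {x : RepD src tgt α R}
    (hx : ∀ b, IsUnit (onePlus x b)) (b : A ⊕ A) :
    (factor x b).map f = factor (fun b => (x b).map f) b := by
  rcases b with a | a
  · exact onePlus_map f x (.inl a)
  · exact (map_inv_of_isUnit f (hx (.inr a))).trans (congrArg (·⁻¹) (onePlus_map f x (.inr a)))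

theorem factorsAt_map {R S : Type} [CommRing R] [CommRing S] (f : R →+* S)
    {x : RepD src tgt α R} (hx : ∀ b, IsUnit (onePlus x b)) (ord : List (A ⊕ A)) (i : V) :
    (factorsAt ord x i).map (fun F => F.map f) = factorsAt ord (fun b => (x b).map f) i := by
  rw [factorsAt, factorsAt, List.map_flatMap]
  congr 1
  funext b
  split_ifs with hb
  · rw [List.map_singleton, castMat_map, factor_map f hx]
  · rfl

theorem list_prod_map {m R S : Type} [Fintype m] [DecidableEq m] [CommRing R] [CommRing S]
    (f : R →+* S) (L : List (Matrix m m R)) :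
    L.prod.map f = (L.map fun F => F.map f).prod :=
  map_list_prod f.mapMatrix L

theorem fusionTerms_push {X Y : FunSpace} {m : Type} [Fintype m] [DecidableEq m] (φ : Hom X Y)
    {x : X.Pt} (v w : X.Tangent x) (L : List (Matrix m m Y.reg)) :
    fusionTerms (φ.push v) (φ.push w) L = fusionTerms v w (L.map fun F => F.map φ.pull) := by
  induction L with
  | nil => rfl
  | cons F L ih =>
    rw [List.map_cons, fusionTerms, fusionTerms, ih]
    congr 1
    have e := list_prod_map φ.pull.toRingHom L
    have e' : (L.map fun F => F.map φ.pull).prod = L.prod.map φ.pull := e.symm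
    rw [e']
    rfl

/-! ### Representations as points of the product of the Van den Bergh spaces -/

theorem isUnit_onePlus_tautRep [Fintype V] [Fintype A] (q : V → ℂˣ) (b : A ⊕ A) :
    IsUnit (onePlus (tautRep src tgt α q) b) := by
  have h := isUnit_factor_tautRep src tgt α q
  rcases b with a | a
  · exact h (.inl a)
  · exact Matrix.isUnit_nonsing_inv_iff.1 (h (.inr a))

variable {ord : List (A ⊕ A)} {q : V → ℂˣ}

/-- The representation corresponding to a point of the product of the Van den Bergh spaces. -/
def repOf (z : (quiverSpace src tgt α q).Pt) : RepD src tgt α ℂ :=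
  fun b => val z (tautRep src tgt α q b)

/-- The point of the product of the Van den Bergh spaces corresponding to a representation. -/
def ptOfRep (x : RepD src tgt α ℂ) (hx : ∀ b, IsUnit (onePlus x b)) :
    (quiverSpace src tgt α q).Pt
  | .inl a => (⟨(opp x a, arr x a), hx (.inr a)⟩ : VdbPt (endDim src tgt α a))
  | .inr _ => ()

theorem repOf_ptOfRep (x : RepD src tgt α ℂ) (hx : ∀ b, IsUnit (onePlus x b)) :
    repOf (ptOfRep (q := q) x hx) = x := by
  funext b
  rcases b with a | a <;> rfl

theorem repOf_injective : Function.Injective (repOf (src := src) (tgt := tgt) (α := α) (q := q)) := by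
  intro z z' h
  funext t
  rcases t with a | i
  · exact Subtype.ext (Prod.ext (congrFun h (.inr a)) (congrFun h (.inl a)))
  · rfl

/-- Representations form a subvariety of the product of the Van den Bergh spaces. -/
def repToQuiver (src tgt : A → V) (α : V → ℕ) (ord : List (A ⊕ A)) (q : V → ℂˣ) :
    Hom (repVar src tgt α ord q) (quiverSpace src tgt α q) where
  toFun x := ptOfRep x.1 x.2.1
  regular f hf := by
    refine comp_mem_of_adjoin (P := (quiverSpace src tgt α q).Pt) ?_ hf
    rintro _ ⟨a | i, f, hf, rfl⟩
    · refine comp_mem_of_adjoin (P := VdbPt (endDim src tgt α a)) (s := vdbGen _)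
        (φ := fun x : RepPt src tgt α ord q => ⟨(opp x.1 a, arr x.1 a), x.2.1 (.inr a)⟩) ?_ hf
      have h₁ : ∀ b i j, (fun x : RepPt src tgt α ord q => x.1 b i j) ∈
          (repVar src tgt α ord q).reg := fun b i j =>
        Algebra.subset_adjoin (R := ℂ) (A := RepPt src tgt α ord q → ℂ) (Or.inl ⟨b, i, j, rfl⟩)
      have h₂ : ∀ b i j, (fun x : RepPt src tgt α ord q => (onePlus x.1 b)⁻¹ i j) ∈
          (repVar src tgt α ord q).reg := fun b i j =>
        Algebra.subset_adjoin (R := ℂ) (A := RepPt src tgt α ord q → ℂ) (Or.inr ⟨b, i, j, rfl⟩)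
      rintro _ (((⟨i, j, rfl⟩ | ⟨i, j, rfl⟩) | ⟨i, j, rfl⟩) | ⟨i, j, rfl⟩)
      · exact h₁ (.inr a) i j
      · exact h₁ (.inl a) i j
      · exact h₂ (.inr a) i j
      · exact h₂ (.inl a) i j
    · exact (repVar src tgt α ord q).reg.algebraMap_mem (f ())

theorem repOf_repToQuiver (x : RepPt src tgt α ord q) :
    repOf (repToQuiver src tgt α ord q x) = x.1 := repOf_ptOfRep x.1 x.2.1

theorem tautRep_pull (b : A ⊕ A) :
    (tautRep src tgt α q b).map (repToQuiver src tgt α ord q).pull = coord src tgt α ord q b :=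
  ext_val fun x => congrFun (repOf_repToQuiver x) b

theorem isUnit_onePlus_repOf [Fintype V] [Fintype A] (z : (quiverSpace src tgt α q).Pt)
    (b : A ⊕ A) : IsUnit (onePlus (repOf z) b) := by
  have h := isUnit_val (isUnit_onePlus_tautRep (src := src) (tgt := tgt) (α := α) q b) z
  exact (onePlus_map ((quiverSpace src tgt α q).evalAt z).toRingHom (tautRep src tgt α q) b) ▸ h

variable [Fintype V] [Fintype A]

theorem repRel_iff (g : GLProd α) (x x' : RepPt src tgt α ord q) :
    repRel src tgt α ord q g x x' ↔ repToQuiver src tgt α ord q x' =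
      (unfused src tgt α q).act (pullGL (vtx (headD src tgt) []) (fun _ => rfl) g)
        (repToQuiver src tgt α ord q x) := by
  have key : ∀ b, repOf ((unfused src tgt α q).act
      (pullGL (vtx (headD src tgt) []) (fun _ => rfl) g) (repToQuiver src tgt α ord q x)) b =
      (g (headD src tgt b)).val * x.1 b * ((g (tailD src tgt b))⁻¹).val := by
    rintro (a | a) <;> rfl
  constructor
  · intro h
    refine repOf_injective ?_
    rw [repOf_repToQuiver]
    funext b
    exact (h b).trans (key b).symm
  · intro h b
    rw [← key b]
    exact (congrFun (repOf_repToQuiver x') b).symm.trans (congrFun (congrArg repOf h) b)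

theorem val_factorsAt_prod (z : (quiverSpace src tgt α q).Pt) (i : V) :
    val z (factorsAt ord (tautRep src tgt α q) i).prod = (factorsAt ord (repOf z) i).prod :=
  (list_prod_map ((quiverSpace src tgt α q).evalAt z).toRingHom _).trans
    (congrArg List.prod (factorsAt_map _ (isUnit_onePlus_tautRep q) ord i))

theorem mul_scalarGL_inv_eq_one_iff {m : ℕ} (c : ℂˣ) (F : Matrix (Fin m) (Fin m) ℂ) :
    F * (scalarGL m c⁻¹).val = 1 ↔ F = (c : ℂ) • (1 : Matrix (Fin m) (Fin m) ℂ) := by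
  have e : (scalarGL m c⁻¹) = (scalarGL m c)⁻¹ := map_inv _ c
  rw [e, Units.mul_inv_eq_one]
  exact Eq.congr_right (Algebra.algebraMap_eq_smul_one (c : ℂ))

/-- The two-form on the product of the Van den Bergh spaces restricts to the two-form on the space
of representations. -/
theorem repForm_eq (x : (repVar src tgt α ord q).Pt) (v w : (repVar src tgt α ord q).Tangent x) :
    ∑ a, vdbForm (opp (tautRep src tgt α q) a) (arr (tautRep src tgt α q) a)
        ((repToQuiver src tgt α ord q).push v) ((repToQuiver src tgt α ord q).push w) -
      (1 / 2 : ℂ) * ∑ i, fusionTerms ((repToQuiver src tgt α ord q).push v)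
        ((repToQuiver src tgt α ord q).push w) (factorsAt ord (tautRep src tgt α q) i) =
      repForm src tgt α ord q x v w := by
  refine congrArg₂ (fun r s => r - (1 / 2 : ℂ) * s)
    (Finset.mul_sum Finset.univ _ (1 / 2 : ℂ)).symm (Finset.sum_congr rfl fun i _ => ?_)
  rw [fusionTerms_push]
  congr 1
  refine (factorsAt_map (repToQuiver src tgt α ord q).pull.toRingHom
    (isUnit_onePlus_tautRep q) ord i).trans ?_
  congr 1
  exact funext tautRep_pull

end

end FissionVar

end

noncomputable section

namespace FissionVar

open FunSpace QHDatum

/-! ### Quotients and final reductions -/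

theorem isReducedVariety_comp_inv {V : Type} {α : V → ℕ} {M : QHDatum V α} {Z Y : FunSpace}
    {r : Z.Pt → Z.Pt → Prop} {φ : Hom Z M.level} (hφ : φ.IsIso)
    (hr : ∀ x x', r x x' ↔ M.levelOrbit (φ x) (φ x')) {π : Hom Z Y} (h : IsAffineQuotient r π) :
    M.IsReducedVariety (π.comp (Hom.inv hφ)) := by
  obtain ⟨hY, hinv, huniv⟩ := h
  have hr' : ∀ z z', M.levelOrbit z z' → r (Hom.inv hφ z) (Hom.inv hφ z') := fun z z' hz => by
    rw [hr, Hom.apply_inv, Hom.apply_inv]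
    exact hz
  refine ⟨hY, fun z z' hz => hinv _ _ (hr' z z' hz), fun F hF hF' => ?_⟩
  obtain ⟨f, hf, huniq⟩ := huniv (F ∘ φ) (φ.regular F hF) fun x x' hx => hF' _ _ ((hr x x').1 hx)
  refine ⟨f, funext fun z => ?_, fun f' hf' => huniq f' (funext fun x => ?_)⟩
  · have := congrFun hf (Hom.inv hφ z)
    rwa [Function.comp_apply, Hom.apply_inv] at this
  · have := congrFun hf' (φ x)
    refine this.trans ?_
    exact congrArg (fun y => f'.1 (π y)) (Hom.inv_apply hφ x)

/-- The factors `V` are relabelled as `V ⊕ Empty`, and the reduction is by all of them. What remains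
is indexed by `Empty`, so the conditions on the residual moment map are vacuous and the residual
action is trivial. -/
theorem FissionBuilt.of_isReducedVariety {V : Type} {α : V → ℕ} {m : Empty → ℕ} {M : QHDatum V α}
    {N : QHDatum Empty m} (hM : FissionBuilt M) (hs : Algebra.Smooth ℂ N.X.reg)
    {π : Hom M.level N.X} (hπ : M.IsReducedVariety π) (hsurj : Function.Surjective π)
    (horb : ∀ z z', π z = π z' → M.levelOrbit z z')
    (hω : ∀ z (v w : M.level.Tangent z), N.ω (π z) (π.push v) (π.push w) =
      M.ω z.1 ((M.X.incl _).push v) ((M.X.incl _).push w)) : FissionBuilt N := by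
  let n : V ⊕ Empty → ℕ := Sum.elim α m
  let e : V ≃ V ⊕ Empty := (Equiv.sumEmpty V Empty).symm
  have he : ∀ i, α i = n (e i) := fun _ => rfl
  obtain ⟨hN, hinv, huniv⟩ := hπ
  have hr : ∀ (g : GLProd n) (z z' : M.level.Pt), z'.1 = (M.relabel e he).act g z.1 →
      M.levelOrbit z z' := fun g z z' h => ⟨pullGL e he g, h⟩
  have hr' : ∀ z z' : M.level.Pt, M.levelOrbit z z' →
      ∃ g : GLProd n, (∀ j, g (Sum.inr j) = 1) ∧ z'.1 = (M.relabel e he).act g z.1 := by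
    rintro z z' ⟨g, hg⟩
    refine ⟨fun t => match t with
      | .inl i => g i
      | .inr j => j.elim, fun j => j.elim, ?_⟩
    exact hg
  refine FissionBuilt.reduction (n := n) (M.relabel e he) N (hM.relabelled e he)
    ⟨hs, π, ⟨hN, ?_, ?_⟩, hsurj, fun z z' h => hr' z z' (horb z z' h), fun g z z' h => ?_,
      fun z j => j.elim, hω⟩
  · rintro z z' ⟨g, -, h⟩
    exact hinv z z' (hr g z z' h)
  · exact fun F hF hF' => huniv F hF fun z z' h => hF' z z' (hr' z z' h)
  · have h1 : (fun j => g (Sum.inr j)) = (1 : GLProd m) := funext fun j => j.elim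
    refine (hinv z z' (hr g z z' h)).symm.trans ?_
    exact (N.act_one _).symm.trans (congrArg (fun k => N.act k (π z)) h1.symm)

/-! ### Multiplicative quiver varieties as reductions -/

section

variable {V A : Type} {src tgt : A → V} {α : V → ℕ} {ord : List (A ⊕ A)} {q : V → ℂˣ}
  [Fintype V] [Fintype A] {M : QHDatum V α} {φ : Hom (quiverSpace src tgt α q) M.X}

theorem mem_level_iff (hμ : ∀ i, (M.μ i).map φ.pull =
      (factorsAt ord (tautRep src tgt α q) i).prod *
        (quiverSpace src tgt α q).constMat (scalarGL (α i) (q i)⁻¹).val)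
    (z : (quiverSpace src tgt α q).Pt) :
    (∀ i, val (φ z) (M.μ i) = 1) ↔
      ∀ i, (factorsAt ord (repOf z) i).prod = (q i : ℂ) • 1 := by
  refine forall_congr' fun i => ?_
  have h : val (φ z) (M.μ i) = (factorsAt ord (repOf z) i).prod * (scalarGL (α i) (q i)⁻¹).val := by
    refine (congrArg (val z) (hμ i)).trans ?_
    rw [val_mul, val_factorsAt_prod, val_constMat]
  rw [h, mul_scalarGL_inv_eq_one_iff]

/-- The map from the space of representations to the fibre of the moment map. -/
def repToLevel (hμ : ∀ i, (M.μ i).map φ.pull =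
      (factorsAt ord (tautRep src tgt α q) i).prod *
        (quiverSpace src tgt α q).constMat (scalarGL (α i) (q i)⁻¹).val) :
    Hom (repVar src tgt α ord q) M.level where
  toFun x := ⟨φ (repToQuiver src tgt α ord q x), (mem_level_iff hμ _).2 fun i =>
    (congrArg (fun y => (factorsAt ord y i).prod) (repOf_repToQuiver x)).trans (x.2.2 i)⟩
  regular f hf := by
    obtain ⟨F, hF, h⟩ := hf
    have h' := (repToQuiver src tgt α ord q).regular _ (φ.regular F hF)
    exact (congrArg (· ∈ (repVar src tgt α ord q).reg)
      (funext fun x : RepPt src tgt α ord q => h _)).mpr h'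

/-- Any point of the quiver space is a representation with all `1 + bb*` invertible, and the moment
map condition is the defining relation. The generators of the regular functions on representations,
including the inverses `(1 + bb*)⁻¹`, are restrictions of regular functions on the whole space. -/
theorem repToLevel_isIso (hφ : φ.IsIso) (hμ : ∀ i, (M.μ i).map φ.pull =
      (factorsAt ord (tautRep src tgt α q) i).prod *
        (quiverSpace src tgt α q).constMat (scalarGL (α i) (q i)⁻¹).val) :
    (repToLevel hμ).IsIso := by
  have hex : ∀ F : (quiverSpace src tgt α q).reg,
      ∃ f ∈ M.level.reg, F.1 ∘ repToQuiver src tgt α ord q = f ∘ repToLevel hμ := fun F => by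
    obtain ⟨f, hf, e⟩ := hφ.2 F.1 F.2
    exact ⟨fun z => f z.1, ⟨f, hf, fun _ => rfl⟩,
      funext fun x => congrFun e (repToQuiver src tgt α ord q x)⟩
  refine Hom.isIso_of_adjoin (φ := repToLevel hμ) ⟨fun x x' h => ?_, fun z => ?_⟩ rfl ?_
  · have h1 : repToQuiver src tgt α ord q x = repToQuiver src tgt α ord q x' :=
      hφ.1.1 (congrArg Subtype.val h)
    refine Subtype.ext ?_
    exact (repOf_repToQuiver x).symm.trans ((congrArg repOf h1).trans (repOf_repToQuiver x'))
  · obtain ⟨y, hy⟩ := hφ.1.2 z.1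
    have hz := z.2
    have hl : ∀ i, (factorsAt ord (repOf y) i).prod = (q i : ℂ) • 1 :=
      (mem_level_iff hμ y).1 fun i => by rw [hy]; exact hz i
    refine ⟨⟨repOf y, isUnit_onePlus_repOf y, hl⟩, Subtype.ext (Eq.trans ?_ hy)⟩
    exact congrArg φ (repOf_injective (repOf_ptOfRep _ (isUnit_onePlus_repOf y)))
  · rintro _ (⟨b, i, j, rfl⟩ | ⟨b, i, j, rfl⟩)
    · obtain ⟨f, hf, e⟩ := hex (tautRep src tgt α q b i j)
      refine ⟨f, hf, Eq.trans (funext fun x => ?_) e⟩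
      exact (congrFun (congrFun (congrFun (repOf_repToQuiver x) b) i) j).symm
    · obtain ⟨f, hf, e⟩ := hex ((onePlus (tautRep src tgt α q) b)⁻¹ i j)
      refine ⟨f, hf, Eq.trans (funext fun x => ?_) e⟩
      have h := val_inv (isUnit_onePlus_tautRep (src := src) (tgt := tgt) (α := α) q b)
        (repToQuiver src tgt α ord q x)
      have h' : val (repToQuiver src tgt α ord q x) (onePlus (tautRep src tgt α q) b) =
          onePlus x.1 b := by
        refine (onePlus_map ((quiverSpace src tgt α q).evalAt _).toRingHom _ b).trans ?_
        exact congrArg (fun y => onePlus y b) (repOf_repToQuiver x)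
      rw [h'] at h
      exact (congrFun (congrFun h i) j).symm

theorem repRel_iff_levelOrbit (hφ : φ.IsIso) (hact : ∀ (g : GLProd α) x,
      φ ((unfused src tgt α q).act (pullGL (vtx (headD src tgt) []) (fun _ => rfl) g) x) =
        M.act g (φ x)) (g : GLProd α) (x x' : RepPt src tgt α ord q) :
    repRel src tgt α ord q g x x' ↔ φ (repToQuiver src tgt α ord q x') =
      M.act g (φ (repToQuiver src tgt α ord q x)) := by
  refine (repRel_iff g x x').trans (hφ.1.1.eq_iff.symm.trans ?_)
  exact Eq.congr_right (hact g (repToQuiver src tgt α ord q x))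

end

end FissionVar

end

/-! ### The main theorem -/

open FissionVar FissionVar.FunSpace in
theorem mainTheorem10 {V A : Type} [Fintype V] [Fintype A] (src tgt : A → V) (α : V → ℕ)
    (ord : List (A ⊕ A)) (hnodup : ord.Nodup) (hall : ∀ b, b ∈ ord) (q : V → ℂˣ) :
    (∀ (Y : FunSpace) (π : Hom (repVar src tgt α ord q) Y),
      IsMultiplicativeQuiverVariety src tgt α ord q π → IsFissionVariety Y) ∧
    ∃ M : QHDatum V α, FissionBuilt M ∧ M.IsQuasiHamiltonian ∧
      ∃ φ : Hom (repVar src tgt α ord q) M.level, φ.IsIso ∧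
        (∀ g x x', repRel src tgt α ord q g x x' → (φ x').1 = M.act g (φ x).1) ∧
        (∀ x (v w : (repVar src tgt α ord q).Tangent x),
          M.ω (φ x).1 ((M.X.incl _).push (φ.push v)) ((M.X.incl _).push (φ.push w)) =
            repForm src tgt α ord q x v w) ∧
        (∀ (Y : FunSpace) (π : Hom (repVar src tgt α ord q) Y),
          IsMultiplicativeQuiverVariety src tgt α ord q π →
          ∃ π' : Hom M.level Y, (∀ x, π' (φ x) = π x) ∧ M.IsReducedVariety π') ∧
        (∀ (m : Empty → ℕ) (N : QHDatum Empty m) (π : Hom (repVar src tgt α ord q) N.X),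
          IsMultiplicativeQuiverVariety src tgt α ord q π → Algebra.Smooth ℂ N.X.reg →
          Function.Surjective π →
          (∀ x x', π x = π x' → ∃ g, repRel src tgt α ord q g x x') →
          (∀ x (v w : (repVar src tgt α ord q).Tangent x),
            N.ω (π x) (π.push v) (π.push w) = repForm src tgt α ord q x v w) →
          FissionBuilt N) := by
  obtain ⟨M, φ, hb, hq, hφ, hact, hμ, hω⟩ := exists_fusedQuiver src tgt α q hnodup hall
  have hΦ := repToLevel_isIso hφ hμ
  have hform : ∀ x (v w : (repVar src tgt α ord q).Tangent x),
      M.ω (repToLevel hμ x).1 ((M.X.incl _).push ((repToLevel hμ).push v))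
        ((M.X.incl _).push ((repToLevel hμ).push w)) = repForm src tgt α ord q x v w :=
    fun x v w => (hω (repToQuiver src tgt α ord q x) ((repToQuiver src tgt α ord q).push v)
      ((repToQuiver src tgt α ord q).push w)).trans (repForm_eq x v w)
  have hrel : ∀ x x', (∃ g, repRel src tgt α ord q g x x') ↔
      M.levelOrbit (repToLevel hμ x) (repToLevel hμ x') := fun x x' =>
    exists_congr fun g => repRel_iff_levelOrbit hφ hact g x x'
  have hred : ∀ (Y : FunSpace) (π : Hom (repVar src tgt α ord q) Y),
      IsMultiplicativeQuiverVariety src tgt α ord q π →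
      M.IsReducedVariety (π.comp (Hom.inv hΦ)) := fun Y π h => isReducedVariety_comp_inv hΦ hrel h
  refine ⟨fun Y π h => ⟨V, inferInstance, α, M, _, hb, hq, hred Y π h⟩, M, hb, hq,
    repToLevel hμ, hΦ, fun g x x' h => (repRel_iff_levelOrbit hφ hact g x x').1 h, hform,
    fun Y π h => ⟨_, fun x => congrArg π (Hom.inv_apply hΦ x), hred Y π h⟩,
    fun m N π h hs hsurj horb hN => ?_⟩
  refine hb.of_isReducedVariety hs (hred N.X π h) (fun y => ?_) (fun z z' hz => ?_)
    fun z v w => ?_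
  · obtain ⟨x, rfl⟩ := hsurj y
    exact ⟨repToLevel hμ x, congrArg π (Hom.inv_apply hΦ x)⟩
  · have := (hrel _ _).1 (horb _ _ hz)
    rwa [Hom.apply_inv, Hom.apply_inv] at this
  · refine (hN (Hom.inv hΦ z) ((Hom.inv hΦ).push v) ((Hom.inv hΦ).push w)).trans
      ((hform _ _ _).symm.trans ?_)
    -- Pushing a vector through the inverse and back gives the same functional, but at a base point
    -- only propositionally equal to `z`; hence the comparison of underlying linear maps.
    have ht : ∀ u : M.level.Tangent z,
        ((M.X.incl _).push ((repToLevel hμ).push ((Hom.inv hΦ).push u))).1 =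
          ((M.X.incl {x | ∀ i, val x (M.μ i) = 1}).push u).1 := fun u =>
      LinearMap.ext fun f => congrArg u.1 (Subtype.ext (funext fun y =>
        congrArg (fun y : M.level.Pt => f.1 y.1) (Hom.apply_inv hΦ y)))
    exact Form.congr_point _ (congrArg Subtype.val (Hom.apply_inv hΦ z)) (ht v) (ht w)
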